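/- **Setting.** Let $d\ge 2$, let $\mathcal P$ be the set of probability vectors $(p_z)_{z\in\mathbb Z^d}$, and let $\mathbb P$ be an i.i.d. product probability measure on the space of environments $\omega=(\omega_x)_{x\in\mathbb Z^d}\in\mathcal P^{\mathbb Z^d}$. Put $\pi_{x,y}(\omega)=\omega_{x,y-x}$, and let $P^\omega_x$ be the law of the Markov chain $(X_n)_{n\ge0}$ on $\mathbb Z^d$ with $X_0=x$ and transition probabilities $\pi_{y,z}(\omega)$. Fix $\hat u\in\mathbb Z^d\setminus\{0\}$ and assume: - (N) there is $\delta>0$ such that $\sum_z (z\cdot\hat u)\,\pi_{0,z}\ge\delta$ for $\mathbb P$-a.e. $\omega$; - (M) there are $M,s_0>0$ such that $\sum_z e^{s_0|z|}\pi_{0,z}\le e^{s_0M}$ for $\mathbb P$-a.e. $\omega$; - (R) there is $\kappa>0$ such that $\sum_{z\cdot\hat u=1}\pi_{0,z}\ge\kappa$ for $\mathbb P$-a.e. $\omega$; moreover $\mathbb P\{\forall z:\pi_{0,0}+\pi_{0,z}<1\}>0$, and the set $\{z:\mathbb E\pi_{0,z}>0\}$ is not contained in $\mathbb R v$ for any $v\in\mathbb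 R^d$. Let $P_x=\mathbb E P^\omega_x$ and $P_{x,y}=\mathbb E[P^\omega_x\otimes P^\omega_y]$. Thus $P_{x,y}$ is the law of two walks $(X,\tilde X)$ in a common environment, and $P_x\otimes P_y$ is the law of two walks in independent environments. Let $\mathbb V_d=\{z\in\mathbb Z^d:z\cdot\hat u=0\}$. **Common regeneration times.** For a pair of paths $(X,\tilde X)$ put $$\beta=\inf\{n:X_n\cdot\hat u<X_0\cdot\hat u\},\quad \gamma_\ell=\inf\{n:X_n\cdot\hat u\ge\ell\},\quad \gamma^+_\ell=\inf\{n:X_n\cdot\hat u>\ell\},\quad M_n=\max_{i\le n}X_i\cdot\hat u,$$ and define $\tilde\beta,\tilde\gamma_\ell,\tilde\gamma_\ell^+,\tilde M_n$ in the same way from $\tilde X$. Let $$L=\inf\{\ell>(X_0\cdot\hat u)\wedge(\tilde X_0\cdot\hat u): X_{\gamma_\ell}\cdot\hat u=\tilde X_{\tilde\gamma_\ell}\cdot\hat u=\ell\},$$ with $\gamma_L=\tilde\gamma_L=\infty$ if there is no such $\ell$. Let $\theta^{m,n}$ shift $X$ by $m$ and $\tilde X$ by $n$. For pairs of times, $(\sigma,\tilde\sigma)+(\tau,\tilde\tau)\circ\theta^{\sigma,\tilde\sigma}$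 is understood as $(\infty,\infty)$ unless $\sigma,\tilde\sigma<\infty$. If $\beta\wedge\tilde\beta<\infty$, let $(\rho,\tilde\rho)=(\gamma^+_m,\tilde\gamma^+_m)$ with $m=M_{\beta\wedge\tilde\beta}\vee\tilde M_{\beta\wedge\tilde\beta}$; otherwise $\rho=\tilde\rho=\infty$. Set $$(\nu_0,\tilde\nu_0)=(0,0),\quad (\nu_1,\tilde\nu_1)=(\rho,\tilde\rho)+(\gamma_L,\tilde\gamma_L)\circ\theta^{\rho,\tilde\rho},\quad (\nu_{k+1},\tilde\nu_{k+1})=(\nu_k,\tilde\nu_k)+(\nu_1,\tilde\nu_1)\circ\theta^{\nu_k,\tilde\nu_k},$$ and $K=\sup\{k\ge0:\nu_k\vee\tilde\nu_k<\infty\}$, with $(\nu_K,\tilde\nu_K)=(\infty,\infty)$ if $K=\infty$. With $(\nu,\tilde\nu)=(\gamma_L,\tilde\gamma_L)$, the common regeneration times are $$(\mu_0,\tilde\mu_0)=(0,0),\quad (\mu_1,\tilde\mu_1)=(\nu,\tilde\nu)+(\nu_K,\tilde\nu_K)\circ\theta^{\nu,\tilde\nu},\quad (\mu_{i+1},\tilde\mu_{i+1})=(\mu_i,\tilde\mu_i)+(\mu_1,\tilde\mu_1)\circ\theta^{\mu_i,\tilde\mu_i}.$$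 For a pair $(X,\bar X)$ of walks in independent environments, the times given by the same recipe are written $(\rho_i,\bar\rho_i)$, and the first backtracking time of $\bar X$ is written $\bar\beta$. **Claim 1 (common environment).** For $x\in\mathbb V_d$ we have $P_{0,x}[\beta=\tilde\beta=\infty]>0$; define $$q(x,y)=P_{0,x}\bigl[\tilde X_{\tilde\mu_1}-X_{\mu_1}=y\,\big|\,\beta=\tilde\beta=\infty\bigr].$$ Whenever $x\cdot\hat u=y\cdot\hat u$, under $P_{x,y}$ all $\mu_i,\tilde\mu_i$ are a.s. finite and $(\tilde X_{\tilde\mu_i}-X_{\mu_i})_{i\ge1}$ is a time-homogeneous Markov chain on $\mathbb V_d$ with transition probability $q$. That is, the process is a.s. $\mathbb V_d$-valued, $\sum_{y\in\mathbb V_d}q(x,y)=1$ for $x\in\mathbb V_d$, and for all $n\ge1$ and $z_1,\dots,z_{n+1}\in\mathbb V_d$ $$P_{x,y}[\tilde X_{\tilde\mu_i}-X_{\mu_i}=z_i,\ 1\le i\le n+1]=P_{x,y}[\tilde X_{\tilde\mu_i}-X_{\mu_i}=z_i,\ 1\le i\le n]\;q(z_n,z_{n+1}).$$ **Claim 2 (independent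 environments).** For $x\in\mathbb V_d$ we have $P_0\otimes P_x[\beta=\bar\beta=\infty]>0$; define $$\bar q(x,y)=P_0\otimes P_x\bigl[\bar X_{\bar\rho_1}-X_{\rho_1}=y\,\big|\,\beta=\bar\beta=\infty\bigr].$$ Whenever $x\cdot\hat u=y\cdot\hat u$, under $P_x\otimes P_y$ all $\rho_i,\bar\rho_i$ are a.s. finite and $(\bar X_{\bar\rho_i}-X_{\rho_i})_{i\ge1}$ is a symmetric random walk on $\mathbb V_d$: it is, in the same sense, a Markov chain on $\mathbb V_d$ with transition probability $\bar q$, and for all $x,y\in\mathbb V_d$ $$\bar q(x,y)=\bar q(0,y-x)=\bar q(0,x-y)=P_0\otimes P_0\bigl[\bar X_{\bar\rho_1}-X_{\rho_1}=y-x\,\big|\,\beta=\bar\beta=\infty\bigr].$$ -/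

import Mathlib

open MeasureTheory ProbabilityTheory Preorder
open scoped ENNReal

namespace RWRE

noncomputable section

/-- Sites of the integer lattice. -/
abbrev Site (d : ℕ) := Fin d → ℤ

/-- The level `x · û` of a site. -/
def level {d : ℕ} (u x : Site d) : ℤ := x ⬝ᵥ u

/-- The hyperplane `V_d = {z : z · û = 0}`. -/
def hyperplane {d : ℕ} (u : Site d) : Set (Site d) := {z | level u z = 0}

/-- The simplex of probability vectors on the lattice. -/
abbrev StepLaw (d : ℕ) := {p : Site d → ℝ // (∀ z, 0 ≤ p z) ∧ HasSum p 1}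

/-- Environments, with the product σ-field (each simplex carries the σ-field generated by the
coordinates). -/
abbrev Env (d : ℕ) := Site d → StepLaw d

/-- `π_{x,y}(ω) = ω_{x,y-x}`. -/
def trans {d : ℕ} (ω : Env d) (x y : Site d) : ℝ := (ω x).1 (y - x)

/-- Infinite paths `x_{0,∞}`. -/
abbrev Path (d : ℕ) := ℕ → Site d

/-! ### The quenched and averaged laws of the walk -/

/-- The one-step kernel of the walk in the environment `ω`: from `x` jump to `y` with probability
`π_{x,y}(ω)`. -/
def stepKernel {d : ℕ} (ω : Env d) : Kernel (Site d) (Site d) :=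
  Kernel.ofFunOfCountable fun x =>
    Measure.sum fun y => ENNReal.ofReal (trans ω x y) • Measure.dirac y

theorem stepKernel_singleton {d : ℕ} (ω : Env d) (x y : Site d) :
    stepKernel ω x {y} = ENNReal.ofReal (trans ω x y) := by
  change (Measure.sum fun y => ENNReal.ofReal (trans ω x y) • Measure.dirac y) {y} = _
  rw [Measure.sum_apply _ (measurableSet_singleton y), tsum_eq_single y]
  · simp
  · intro z hz
    simp [hz]

instance isMarkovKernel_stepKernel {d : ℕ} (ω : Env d) :
    IsMarkovKernel (stepKernel ω) := by
  refine ⟨fun x => ⟨?_⟩⟩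
  change (Measure.sum fun y => ENNReal.ofReal (trans ω x y) • Measure.dirac y) Set.univ = 1
  rw [Measure.sum_apply _ MeasurableSet.univ]
  have h : HasSum (fun y => trans ω x y) 1 :=
    (Equiv.hasSum_iff (Equiv.subRight x)).2 (ω x).2.2
  have h0 : ∀ y, 0 ≤ trans ω x y := fun y => (ω x).2.1 _
  simp only [Measure.smul_apply, measure_univ, smul_eq_mul, mul_one]
  rw [← ENNReal.ofReal_tsum_of_nonneg h0 h.summable, h.tsum_eq, ENNReal.ofReal_one]

/-- The quenched path measure `P_x^ω`: the law of the canonical Markov chain with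
`P_x^ω(X_0 = x) = 1` and `P_x^ω(X_{n+1} = z | X_n = y) = π_{y,z}(ω)`. -/
def quenchedLaw {d : ℕ} (x : Site d) (ω : Env d) : Measure (Path d) :=
  Kernel.trajMeasure (X := fun _ => Site d) (Measure.dirac x) fun n =>
    (stepKernel ω).comap (fun h : (i : Finset.Iic n) → Site d => h ⟨n, Finset.mem_Iic.2 le_rfl⟩)
      (measurable_pi_apply _)

instance isProbabilityMeasure_quenchedLaw {d : ℕ} (x : Site d) (ω : Env d) :
    IsProbabilityMeasure (quenchedLaw x ω) := by
  unfold quenchedLaw; infer_instance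

/-- Finite-dimensional distributions of the walk in a fixed environment. -/
theorem quenchedLaw_cylinder {d : ℕ} (x : Site d) (ω : Env d) (n : ℕ) (a : ℕ → Site d) :
    quenchedLaw x ω {X | ∀ i ≤ n, X i = a i} =
      (if a 0 = x then 1 else 0) *
        ∏ i ∈ Finset.range n, ENNReal.ofReal (trans ω (a i) (a (i + 1))) := by
  induction n with
  | zero =>
    have hm : MeasurableSet {h : (i : Finset.Iic 0) → Site d |
        h ⟨0, Finset.mem_Iic.2 le_rfl⟩ = a 0} := by
      have hf : Measurable fun h : (i : Finset.Iic 0) → Site d =>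
          h ⟨0, Finset.mem_Iic.2 le_rfl⟩ := measurable_pi_apply _
      exact hf (measurableSet_singleton (a 0))
    have e : {X : Path d | ∀ i ≤ 0, X i = a i} = frestrictLe (π := fun _ => Site d) 0 ⁻¹'
        {h | h ⟨0, Finset.mem_Iic.2 le_rfl⟩ = a 0} := by
      ext X
      simp [frestrictLe]
    rw [e, ← Measure.map_apply (measurable_frestrictLe 0) hm, quenchedLaw, Kernel.trajMeasure,
      Measure.map_comp _ _ (measurable_frestrictLe 0), Kernel.traj_map_frestrictLe,
      Kernel.partialTraj_self, Measure.id_comp, Measure.map_apply (by fun_prop) hm,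
      Measure.dirac_apply' _ (by exact (MeasurableEquiv.measurable _) hm)]
    simp [Set.indicator_apply, MeasurableEquiv.piUnique, eq_comm]
  | succ n ih =>
    set κ : (n : ℕ) → Kernel ((i : Finset.Iic n) → Site d) (Site d) := fun n =>
      (stepKernel ω).comap
        (fun h : (i : Finset.Iic n) → Site d => h ⟨n, Finset.mem_Iic.2 le_rfl⟩)
        (measurable_pi_apply _) with hκ
    have key := Kernel.map_frestrictLe_trajMeasure_compProd_eq_map_trajMeasure
      (X := fun _ => Site d) (μ₀ := Measure.dirac x) (κ := κ) (a := n)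
    let B : Set ((i : Finset.Iic n) → Site d) := {h | ∀ i, h i = a i}
    have hB : MeasurableSet B := by
      have : B = ⋂ i : Finset.Iic n, (fun h => h i) ⁻¹' {a i} := by ext; simp [B]
      rw [this]
      exact MeasurableSet.iInter fun i => (measurable_pi_apply i) (measurableSet_singleton _)
    have e : {X : Path d | ∀ i ≤ n + 1, X i = a i} =
        (fun X : Path d => (frestrictLe (π := fun _ => Site d) n X, X (n + 1))) ⁻¹'
          (B ×ˢ {a (n + 1)}) := by
      ext X
      simp only [Set.mem_ofPred_eq, Set.mem_preimage, Set.mem_prod, B, Set.mem_singleton_iff]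
      constructor
      · intro h
        exact ⟨fun i => h i ((Finset.mem_Iic.1 i.2).trans (Nat.le_succ n)), h _ le_rfl⟩
      · rintro ⟨h1, h2⟩ i hi
        rcases Nat.le_succ_iff.1 hi with h | h
        · exact h1 ⟨i, Finset.mem_Iic.2 h⟩
        · exact h ▸ h2
    have e' : {X : Path d | ∀ i ≤ n, X i = a i} = frestrictLe (π := fun _ => Site d) n ⁻¹' B := by
      ext X
      simp [B, frestrictLe]
    rw [e, ← Measure.map_apply (by fun_prop) (hB.prod (measurableSet_singleton _))]
    change (Measure.map _ (Kernel.trajMeasure (X := fun _ => Site d) (Measure.dirac x) κ)) _ = _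
    rw [← key, Measure.compProd_apply_prod hB (measurableSet_singleton _),
      setLIntegral_congr_fun (g := fun _ => ENNReal.ofReal (trans ω (a n) (a (n + 1)))) hB]
    · rw [setLIntegral_const, Measure.map_apply (measurable_frestrictLe n) hB, ← e']
      change _ * quenchedLaw x ω _ = _
      rw [ih, Finset.prod_range_succ]
      ring
    · intro h hh
      have := hh ⟨n, Finset.mem_Iic.2 le_rfl⟩
      simp [hκ, Kernel.comap_apply, stepKernel_singleton, this]

theorem measurable_quenchedLaw {d : ℕ} (x : Site d) :
    Measurable (quenchedLaw (d := d) x) := by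
  have hcyl (n : ℕ) (S : Set ((i : Finset.Iic n) → Site d)) :
      Measurable fun ω : Env d =>
        quenchedLaw x ω (frestrictLe (π := fun _ => Site d) n ⁻¹' S) := by
    have hS : frestrictLe (π := fun _ => Site d) n ⁻¹' S =
        ⋃ h : S, {X : Path d | ∀ i ≤ n, X i =
          (fun j => if hj : j ∈ Finset.Iic n then h.1 ⟨j, hj⟩ else 0) i} := by
      ext X
      simp only [Set.mem_preimage, Set.mem_iUnion, Set.mem_ofPred_eq]
      constructor
      · intro hX
        refine ⟨⟨_, hX⟩, fun i hi => ?_⟩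
        simp [hi, frestrictLe]
      · rintro ⟨h, hX⟩
        convert h.2 using 1
        ext1 i
        have := hX i (Finset.mem_Iic.1 i.2)
        simpa [Finset.mem_Iic.1 i.2] using this
    have hmeas (a : ℕ → Site d) : MeasurableSet {X : Path d | ∀ i ≤ n, X i = a i} := by
      have : {X : Path d | ∀ i ≤ n, X i = a i} = ⋂ i, ⋂ (_ : i ≤ n), (fun X => X i) ⁻¹' {a i} := by
        ext; simp
      rw [this]
      exact MeasurableSet.iInter fun i => MeasurableSet.iInter fun _ =>
        (measurable_pi_apply i) (measurableSet_singleton _)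
    rw [hS]
    have : Countable S := inferInstance
    have hdisj : Pairwise (Function.onFun Disjoint fun h : S => {X : Path d | ∀ i ≤ n, X i =
        (fun j => if hj : j ∈ Finset.Iic n then h.1 ⟨j, hj⟩ else 0) i}) := by
      intro h h' hne
      refine Set.disjoint_left.2 fun X hX hX' => hne (Subtype.ext (funext fun i => ?_))
      have h1 := hX i (Finset.mem_Iic.1 i.2)
      have h2 := hX' i (Finset.mem_Iic.1 i.2)
      simp only [i.2, dite_true, Subtype.coe_eta] at h1 h2
      exact h1.symm.trans h2
    simp_rw [measure_iUnion hdisj fun h => hmeas _, quenchedLaw_cylinder]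
    refine Measurable.tsum fun h => Measurable.const_mul ?_ _
    refine Finset.measurable_prod _ fun i _ => ENNReal.measurable_ofReal.comp ?_
    unfold trans
    exact (measurable_pi_apply _).comp (measurable_subtype_coe.comp (measurable_pi_apply _))
  refine Measurable.measure_of_isPiSystem_of_isProbabilityMeasure
    (S := measurableCylinders fun _ : ℕ => Site d)
    generateFrom_measurableCylinders.symm isPiSystem_measurableCylinders fun t ht => ?_
  obtain ⟨s, S, -, rfl⟩ := (mem_measurableCylinders _).1 ht
  have hs : s ⊆ Finset.Iic (s.sup id) := fun i hi => Finset.mem_Iic.2 (Finset.le_sup (f := id) hi)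
  exact hcyl (s.sup id) (Finset.restrict₂ (π := fun _ => Site d) hs ⁻¹' S)

/-- The quenched path measure as a probability kernel from environments to paths. -/
def quenched {d : ℕ} (x : Site d) : Kernel (Env d) (Path d) :=
  ⟨quenchedLaw x, measurable_quenchedLaw x⟩

/-- The averaged law `P_x = 𝔼 P_x^ω` of one walk. -/
def averaged {d : ℕ} (P : Measure (Env d)) (x : Site d) : Measure (Path d) :=
  P.bind (quenched x)

/-- `P_{x,y} = 𝔼 [P_x^ω ⊗ P_y^ω]`: two walks in a common environment, independent given the
environment. -/
def commonEnvLaw {d : ℕ} (P : Measure (Env d)) (x y : Site d) : Measure (Path d × Path d) :=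
  P.bind fun ω => (quenched x ω).prod (quenched y ω)

/-- `P_x ⊗ P_y`: two independent walks in independent environments. -/
def indepEnvLaw {d : ℕ} (P : Measure (Env d)) (x y : Site d) : Measure (Path d × Path d) :=
  (averaged P x).prod (averaged P y)

/-! ### Common regeneration times

A pair of (possibly infinite) times `(α, α')` of a pair of paths `(x, y)` is a value in `ℕ∞ × ℕ∞`.
Times of a pair of paths are functions `Path d → Path d → ℕ∞ × ℕ∞`. -/

/-- `inf {n ≥ 0 : p n}`, with `inf ∅ = ∞`. -/
def firstTime (p : ℕ → Prop) : ℕ∞ := sInf {t | ∃ n : ℕ, p n ∧ t = n}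

/-- The first backtracking time `β = inf {n : X_n · û < X_0 · û}`. -/
def backtrack {d : ℕ} (u : Site d) (x : Path d) : ℕ∞ :=
  firstTime fun n => level u (x n) < level u (x 0)

/-- `γ_ℓ = inf {n : X_n · û ≥ ℓ}`. -/
def gam {d : ℕ} (u : Site d) (l : ℤ) (x : Path d) : ℕ∞ := firstTime fun n => l ≤ level u (x n)

/-- `γ⁺_ℓ = inf {n : X_n · û > ℓ}`. -/
def gamPlus {d : ℕ} (u : Site d) (l : ℤ) (x : Path d) : ℕ∞ :=
  firstTime fun n => l < level u (x n)

/-- The running maximum `M_n = max {X_i · û : i ≤ n}`. -/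
def runMax {d : ℕ} (u : Site d) (x : Path d) (n : ℕ) : ℤ :=
  (Finset.range (n + 1)).sup' Finset.nonempty_range_add_one fun i => level u (x i)

/-- The levels `ℓ > (X_0 · û) ∧ (X̃_0 · û)` with `X_{γ_ℓ} · û = X̃_{γ̃_ℓ} · û = ℓ` (in particular,
both `γ_ℓ` and `γ̃_ℓ` are finite). -/
def freshLevels {d : ℕ} (u : Site d) (x y : Path d) : Set ℤ :=
  {l | min (level u (x 0)) (level u (y 0)) < l ∧
    ∃ m n : ℕ, gam u l x = m ∧ gam u l y = n ∧ level u (x m) = l ∧ level u (y n) = l}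

open Classical in
/-- `(γ_L, γ̃_L)`, where `L` is the smallest fresh common level, and `(∞, ∞)` if there is none.
(The set of fresh levels is bounded below, so `sInf` is its smallest element.) -/
def gamL {d : ℕ} (u : Site d) (x y : Path d) : ℕ∞ × ℕ∞ :=
  if (freshLevels u x y).Nonempty then
    (gam u (sInf (freshLevels u x y)) x, gam u (sInf (freshLevels u x y)) y)
  else (⊤, ⊤)

/-- The left shift `θ^k`. -/
def shift {d : ℕ} (k : ℕ) (x : Path d) : Path d := fun n => x (n + k)

/-- `(σ, σ̃) + (τ, τ̃) ∘ θ^{σ, σ̃}`, which is `(∞, ∞)` unless both `σ` and `σ̃` are finite. -/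
def andThen {d : ℕ} (σ τ : Path d → Path d → ℕ∞ × ℕ∞) (x y : Path d) : ℕ∞ × ℕ∞ :=
  if (σ x y).1 ⊔ (σ x y).2 < ⊤ then
    σ x y + τ (shift (σ x y).1.toNat x) (shift (σ x y).2.toNat y)
  else (⊤, ⊤)

/-- `(ρ, ρ̃)`: the first times strictly above the level `M_{β ∧ β̃} ∨ M̃_{β ∧ β̃}`; infinite if neither
walk backtracks. -/
def rho {d : ℕ} (u : Site d) (x y : Path d) : ℕ∞ × ℕ∞ :=
  if backtrack u x ⊓ backtrack u y < ⊤ then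
    let b := (backtrack u x ⊓ backtrack u y).toNat
    let m := max (runMax u x b) (runMax u y b)
    (gamPlus u m x, gamPlus u m y)
  else (⊤, ⊤)

/-- `(ν_k, ν̃_k)`, with `(ν_1, ν̃_1) = (ρ, ρ̃) + (γ_L, γ̃_L) ∘ θ^{ρ, ρ̃}` and
`(ν_{k+1}, ν̃_{k+1}) = (ν_k, ν̃_k) + (ν_1, ν̃_1) ∘ θ^{ν_k, ν̃_k}`. -/
def nu {d : ℕ} (u : Site d) : ℕ → Path d → Path d → ℕ∞ × ℕ∞
  | 0 => fun _ _ => (0, 0)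
  | k + 1 => andThen (nu u k) (andThen (rho u) (gamL u))

/-- The set of `k ≥ 0` with `ν_k ∨ ν̃_k < ∞`. -/
def finiteNu {d : ℕ} (u : Site d) (x y : Path d) : Set ℕ := {k | (nu u k x y).1 ⊔ (nu u k x y).2 < ⊤}

open Classical in
/-- `(ν_K, ν̃_K)`, where `K = sup {k ≥ 0 : ν_k ∨ ν̃_k < ∞}`; infinite if `K = ∞`. -/
def nuLast {d : ℕ} (u : Site d) (x y : Path d) : ℕ∞ × ℕ∞ :=
  if BddAbove (finiteNu u x y) then nu u (sSup (finiteNu u x y)) x y else (⊤, ⊤)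

/-- The common regeneration times `(μ_i, μ̃_i)`: `(μ_0, μ̃_0) = (0, 0)`,
`(μ_1, μ̃_1) = (ν, ν̃) + (ν_K, ν̃_K) ∘ θ^{ν, ν̃}` with `(ν, ν̃) = (γ_L, γ̃_L)`, and
`(μ_{i+1}, μ̃_{i+1}) = (μ_i, μ̃_i) + (μ_1, μ̃_1) ∘ θ^{μ_i, μ̃_i}`. -/
def regen {d : ℕ} (u : Site d) : ℕ → Path d → Path d → ℕ∞ × ℕ∞
  | 0 => fun _ _ => (0, 0)
  | i + 1 => andThen (regen u i) (andThen (gamL u) (nuLast u))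

/-- The difference `X̃_{μ̃_i} - X_{μ_i}` of the pair `p = (X, X̃)`; a junk value where `μ_i` or `μ̃_i` is
infinite. -/
def regenDiff {d : ℕ} (u : Site d) (i : ℕ) (p : Path d × Path d) : Site d :=
  p.2 (regen u i p.1 p.2).2.toNat - p.1 (regen u i p.1 p.2).1.toNat

/-- The event `{β = β̃ = ∞}`. -/
def noBacktrack {d : ℕ} (u : Site d) : Set (Path d × Path d) :=
  {p | backtrack u p.1 = ⊤ ∧ backtrack u p.2 = ⊤}

/-- `q(x, y) = P_{0,x}[X̃_{μ̃_1} - X_{μ_1} = y | β = β̃ = ∞]`. -/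
def q {d : ℕ} (P : Measure (Env d)) (u x y : Site d) : ℝ≥0∞ :=
  (commonEnvLaw P 0 x)[|noBacktrack u] {p | regenDiff u 1 p = y}

/-- `q̄(x, y) = P_0 ⊗ P_x[X̄_{ρ̄_1} - X_{ρ_1} = y | β = β̄ = ∞]`. -/
def qbar {d : ℕ} (P : Measure (Env d)) (u x y : Site d) : ℝ≥0∞ :=
  (indepEnvLaw P 0 x)[|noBacktrack u] {p | regenDiff u 1 p = y}

/-! ### The hypotheses on the environment -/

/-- Non-nestling: for some `δ > 0`, almost surely `∑_z (z · û) π_{0,z} ≥ δ`. -/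
def HypN {d : ℕ} (P : Measure (Env d)) (u : Site d) : Prop :=
  ∃ δ : ℝ, 0 < δ ∧ ∀ᵐ ω ∂P, Summable (fun z => (level u z : ℝ) * trans ω 0 z) ∧
    δ ≤ ∑' z, (level u z : ℝ) * trans ω 0 z

/-- The Euclidean length of a site. -/
def siteNorm {d : ℕ} (z : Site d) : ℝ := √(∑ i, (z i : ℝ) ^ 2)

/-- Exponential moments: for some `M, s₀ > 0`, almost surely
`∑_z exp(s₀ |z|) π_{0,z} ≤ exp(s₀ M)`. -/
def HypM {d : ℕ} (P : Measure (Env d)) : Prop :=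
  ∃ M s₀ : ℝ, 0 < M ∧ 0 < s₀ ∧ ∀ᵐ ω ∂P,
    ∑' z, ENNReal.ofReal (Real.exp (s₀ * siteNorm z) * trans ω 0 z)
      ≤ ENNReal.ofReal (Real.exp (s₀ * M))

/-- The set `𝒥 = {z : 𝔼 π_{0,z} > 0}` of admissible steps. -/
def admissible {d : ℕ} (P : Measure (Env d)) : Set (Site d) := {z | 0 < ∫ ω, trans ω 0 z ∂P}

/-- Regularity of the environment. -/
def HypR {d : ℕ} (P : Measure (Env d)) (u : Site d) : Prop :=
  (∃ κ : ℝ, 0 < κ ∧ ∀ᵐ ω ∂P, κ ≤ ∑' z : {z : Site d // level u z = 1}, trans ω 0 z) ∧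
  0 < P {ω | ∀ z, trans ω 0 0 + trans ω 0 z < 1} ∧
  ∀ v : Fin d → ℝ, ∃ z ∈ admissible P, ∀ r : ℝ, (fun i => (z i : ℝ)) ≠ r • v

/-! ### Markov chains on a countable set -/

/-- `(Y_k)_{k ≥ 1}` is, under `P`, a time-homogeneous Markov chain on the countable set `V` with
transition probability `q` (its initial distribution, the law of `Y_1`, being arbitrary). -/
structure IsMarkovChain {Ω S : Type*} [MeasurableSpace Ω] [MeasurableSpace S] (P : Measure Ω)
    (V : Set S) (Y : ℕ → Ω → S) (q : S → S → ℝ≥0∞) : Prop where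
  measurable : ∀ k, 1 ≤ k → Measurable (Y k)
  mem : ∀ k, 1 ≤ k → ∀ᵐ ω ∂P, Y k ω ∈ V
  stochastic : ∀ x ∈ V, ∑' y : V, q x y = 1
  markov : ∀ n, 1 ≤ n → ∀ z : ℕ → S, (∀ k, z k ∈ V) →
    P {ω | ∀ k, 1 ≤ k → k ≤ n + 1 → Y k ω = z k} =
      P {ω | ∀ k, 1 ≤ k → k ≤ n → Y k ω = z k} * q (z n) (z (n + 1))

/-- A symmetric random walk on `V`: a Markov chain whose transition probability is
translation invariant and symmetric, `q(x, y) = q(0, y - x) = q(0, x - y)`. -/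
structure IsSymmetricRandomWalk {Ω S : Type*} [MeasurableSpace Ω] [MeasurableSpace S]
    [AddGroup S] (P : Measure Ω) (V : Set S) (Y : ℕ → Ω → S) (q : S → S → ℝ≥0∞) : Prop
    extends IsMarkovChain P V Y q where
  translation : ∀ x ∈ V, ∀ y ∈ V, q x y = q 0 (y - x)
  symmetric : ∀ x ∈ V, ∀ y ∈ V, q 0 (y - x) = q 0 (x - y)

end

end RWRE

namespace RWRE

variable {d : ℕ} {u : Site d}

/-! ### Deterministic properties of the regeneration times -/

/-! A common regeneration is a pair of times at which both walks stand at the same level, strictly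
above all their earlier levels, and after which neither goes below it. The steps before it leave
from sites strictly below this level; the steps after it leave from sites at or above it. In an
i.i.d. environment these two halves are independent, so the pair restarts as two walks conditioned
not to backtrack. By translation invariance only the difference z of the two positions is
remembered.

The obstacle is that regeneration times look into the future. `IsRegular.regenOne_eq_coe_iff`
isolates this: the first regeneration is at (m, n) exactly when (m, n) is one of the successive
candidates, which is visible by the times m and n, and neither path backtracks afterwards. Given no
backtracking after the last regeneration, the same condition at an earlier one concerns a finite
stretch only (`mem_noBacktrack_shift_iff`). Hence prescribed differences up to a regeneration at (m,
n) form an event S ∩ {no backtracking after (m, n)} with S determined by the past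
(`exists_isDetermined_regen`). By `IsEnvPairLaw.pairLaw_inter_shift` its probability is that of S
times the probability, from (0, z), of no backtracking; prescribing also the next difference only
changes the second factor. Summed over (m, n), the two probabilities have the conditional
probability q as their ratio.

Almost sure finiteness is proved in a fixed environment. Uniform drift and exponential moments make
exp(-λ X·û) contract in mean. Together with unit upward steps this bounds from below the probability
of never backtracking, so failed attempts have geometric tails (`quenchedPair_isFin_nu_le`). For
common levels, a logistic Lyapunov function bounds the weighted time spent below a level, hence the
chance of a long overshoot, and each walk enters a given high level exactly with probability bounded
below (`exists_le_quenchedLaw_ladder`). Given the environments the walks are independent, and a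
zero-one law yields arbitrarily high common levels.

Both claims are instances of one statement about a law of pairs of environments, carried by the
diagonal in the first case and a product in the second. In independent environments one walk may be
translated alone and the walks may be exchanged, whence the invariance and symmetry of q̄. -/

theorem firstTime_eq_coe_iff {p : ℕ → Prop} {n : ℕ} :
    firstTime p = n ↔ p n ∧ ∀ i < n, ¬ p i := by
  classical
  by_cases h : ∃ n, p n
  · have e : firstTime p = (Nat.find h : ℕ) := by
      refine le_antisymm (sInf_le ⟨_, Nat.find_spec h, rfl⟩) (le_sInf ?_)
      rintro _ ⟨k, hk, rfl⟩
      exact_mod_cast Nat.find_min' h hk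
    rw [e, Nat.cast_inj, Nat.find_eq_iff]
  · have e : firstTime p = ⊤ := by
      rw [firstTime, sInf_eq_top]
      rintro _ ⟨k, hk, rfl⟩
      exact absurd ⟨k, hk⟩ h
    rw [e]
    constructor
    · intro h'
      exact absurd h' (ENat.natCast_ne_top n).symm
    · intro h'
      exact absurd ⟨n, h'.1⟩ h

theorem firstTime_eq_top_iff {p : ℕ → Prop} : firstTime p = ⊤ ↔ ∀ n, ¬ p n := by
  rw [firstTime, sInf_eq_top]
  constructor
  · intro h n hn
    exact ENat.natCast_ne_top n (h _ ⟨n, hn, rfl⟩)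
  · rintro h _ ⟨n, hn, rfl⟩
    exact absurd hn (h n)

theorem firstTime_inf (p r : ℕ → Prop) :
    firstTime p ⊓ firstTime r = firstTime fun n => p n ∨ r n := by
  rw [firstTime, firstTime, firstTime, ← sInf_union]
  congr 1
  ext t
  simp only [Set.mem_union, Set.mem_ofPred_eq]
  constructor
  · rintro (⟨n, h, e⟩ | ⟨n, h, e⟩)
    exacts [⟨n, Or.inl h, e⟩, ⟨n, Or.inr h, e⟩]
  · rintro ⟨n, h | h, e⟩
    exacts [Or.inl ⟨n, h, e⟩, Or.inr ⟨n, h, e⟩]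

theorem exists_firstTime {p : ℕ → Prop} (h : ∃ n, p n) : ∃ n : ℕ, firstTime p = n := by
  classical
  exact ⟨Nat.find h, firstTime_eq_coe_iff.2 ⟨Nat.find_spec h, fun i hi => Nat.find_min h hi⟩⟩

theorem mem_noBacktrack {p : Path d × Path d} : p ∈ noBacktrack u ↔
    (∀ n, level u (p.1 0) ≤ level u (p.1 n)) ∧ ∀ n, level u (p.2 0) ≤ level u (p.2 n) := by
  simp [noBacktrack, backtrack, firstTime_eq_top_iff]

/-- Both times of the pair are finite. -/
def IsFin (v : ℕ∞ × ℕ∞) : Prop := ∃ m n : ℕ, v = (↑m, ↑n)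

theorem isFin_iff {v : ℕ∞ × ℕ∞} : IsFin v ↔ v.1 ⊔ v.2 < ⊤ := by
  obtain ⟨a, b⟩ := v
  constructor
  · rintro ⟨m, n, h⟩
    rw [Prod.mk.injEq] at h
    simp [h.1, h.2]
  · intro h
    rw [max_lt_iff] at h
    lift a to ℕ using h.1.ne
    lift b to ℕ using h.2.ne
    exact ⟨a, b, rfl⟩

/-- The event that a pair of times equals `(m, n)` only depends on the two paths up to the
times `m` and `n`, respectively. -/
def IsAdapted (σ : Path d → Path d → ℕ∞ × ℕ∞) : Prop :=
  ∀ ⦃x y x' y' : Path d⦄ ⦃m n : ℕ⦄, σ x y = (↑m, ↑n) → (∀ i ≤ m, x' i = x i) →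
    (∀ i ≤ n, y' i = y i) → σ x' y' = (↑m, ↑n)

/-- The walks are at a common level at times `m`, `n`, which neither has reached before. -/
def IsRecord (u : Site d) (m n : ℕ) (x y : Path d) : Prop :=
  (∀ i < m, level u (x i) < level u (x m)) ∧ (∀ i < n, level u (y i) < level u (y n)) ∧
    level u (x m) = level u (y n)

/-- A record above the lower of the two initial levels. -/
def IsFresh (u : Site d) (m n : ℕ) (x y : Path d) : Prop :=
  min (level u (x 0)) (level u (y 0)) < level u (x m) ∧ IsRecord u m n x y

/-- A sum of times is finite only if both terms are. Equality with a finite pair is the form in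
which times are handled throughout; it replaces arithmetic in `ℕ∞` by quantifiers over natural
numbers. -/
theorem andThen_eq_coe_iff {σ τ : Path d → Path d → ℕ∞ × ℕ∞} {x y : Path d} {m n : ℕ} :
    andThen σ τ x y = (↑m, ↑n) ↔ ∃ m' n' k l : ℕ, σ x y = (↑m', ↑n') ∧
      τ (shift m' x) (shift n' y) = (↑k, ↑l) ∧ m = m' + k ∧ n = n' + l := by
  rw [andThen]
  constructor
  · intro h
    split_ifs at h with h1
    · obtain ⟨m', n', e⟩ := isFin_iff.2 h1
      rw [e] at h
      simp only [ENat.toNat_natCast] at h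
      have h2 : IsFin (τ (shift m' x) (shift n' y)) := by
        rw [isFin_iff]
        by_contra h3
        rcases not_and_or.1 (mt max_lt_iff.2 h3) with h4 | h4
        · rw [not_lt_top_iff] at h4
          have := congrArg Prod.fst h
          simp [h4] at this
        · rw [not_lt_top_iff] at h4
          have := congrArg Prod.snd h
          simp [h4] at this
      obtain ⟨k, l, e'⟩ := h2
      refine ⟨m', n', k, l, e, e', ?_⟩
      rw [e', Prod.mk_add_mk, Prod.mk.injEq] at h
      exact ⟨by exact_mod_cast h.1.symm, by exact_mod_cast h.2.symm⟩
    · exact absurd (congrArg Prod.fst h).symm (ENat.natCast_ne_top _)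
  · rintro ⟨m', n', k, l, e, e', rfl, rfl⟩
    rw [if_pos (isFin_iff.1 ⟨m', n', e⟩), e]
    simp only [ENat.toNat_natCast]
    rw [e']
    simp

theorem isFin_andThen_iff {σ τ : Path d → Path d → ℕ∞ × ℕ∞} {x y : Path d} :
    IsFin (andThen σ τ x y) ↔ ∃ m n : ℕ, σ x y = (↑m, ↑n) ∧
      IsFin (τ (shift m x) (shift n y)) := by
  constructor
  · rintro ⟨m, n, h⟩
    obtain ⟨m', n', k, l, e, e', -, -⟩ := andThen_eq_coe_iff.1 h
    exact ⟨m', n', e, k, l, e'⟩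
  · rintro ⟨m', n', e, k, l, e'⟩
    exact ⟨_, _, andThen_eq_coe_iff.2 ⟨m', n', k, l, e, e', rfl, rfl⟩⟩

theorem andThen_of_eq_coe {σ τ : Path d → Path d → ℕ∞ × ℕ∞} {x y : Path d} {m n : ℕ}
    (h : σ x y = (↑m, ↑n)) :
    andThen σ τ x y = ((m : ℕ∞), (n : ℕ∞)) + τ (shift m x) (shift n y) := by
  rw [andThen, if_pos (isFin_iff.1 ⟨m, n, h⟩), h]
  simp only [ENat.toNat_natCast]

theorem IsAdapted.andThen {σ τ : Path d → Path d → ℕ∞ × ℕ∞} (hσ : IsAdapted σ)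
    (hτ : IsAdapted τ) : IsAdapted (andThen σ τ) := by
  intro x y x' y' m n h hx hy
  obtain ⟨m', n', k, l, e, e', rfl, rfl⟩ := andThen_eq_coe_iff.1 h
  refine andThen_eq_coe_iff.2 ⟨m', n', k, l, ?_, ?_, rfl, rfl⟩
  · exact hσ e (fun i hi => hx i (by omega)) (fun i hi => hy i (by omega))
  · exact hτ e' (fun i hi => hx _ (by omega)) (fun i hi => hy _ (by omega))

/-! ### Common fresh levels -/

theorem mem_freshLevels {x y : Path d} {l : ℤ} :
    l ∈ freshLevels u x y ↔ ∃ m n, IsFresh u m n x y ∧ level u (x m) = l := by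
  simp only [freshLevels, Set.mem_ofPred_eq, gam, firstTime_eq_coe_iff, IsFresh, IsRecord, not_le]
  constructor
  · rintro ⟨h, m, n, ⟨-, h1⟩, ⟨-, h2⟩, rfl, h3⟩
    exact ⟨m, n, ⟨h, h1, by rwa [h3], h3.symm⟩, rfl⟩
  · rintro ⟨m, n, ⟨h, h1, h2, h3⟩, rfl⟩
    exact ⟨h, m, n, ⟨le_rfl, h1⟩, ⟨h3.le, by rwa [h3]⟩, rfl, h3.symm⟩

theorem IsRecord.gam_fst {m n : ℕ} {x y : Path d} (h : IsRecord u m n x y) :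
    gam u (level u (x m)) x = m :=
  firstTime_eq_coe_iff.2 ⟨le_rfl, fun i hi => (h.1 i hi).not_ge⟩

theorem IsRecord.gam_snd {m n : ℕ} {x y : Path d} (h : IsRecord u m n x y) :
    gam u (level u (x m)) y = n :=
  firstTime_eq_coe_iff.2 ⟨h.2.2.le, fun i hi => by rw [h.2.2]; exact (h.2.1 i hi).not_ge⟩

theorem sInf_mem_freshLevels {x y : Path d} (h : (freshLevels u x y).Nonempty) :
    sInf (freshLevels u x y) ∈ freshLevels u x y :=
  Int.csInf_mem h ⟨_, fun _ hl => hl.1.le⟩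

theorem sInf_freshLevels_le {x y : Path d} {l : ℤ} (h : l ∈ freshLevels u x y) :
    sInf (freshLevels u x y) ≤ l :=
  csInf_le ⟨_, fun _ hl => hl.1.le⟩ h

/-- Two records are ordered alike by level and by either time, so minimality of the level means that
no fresh pair is earlier in both coordinates. In this form only the paths up to m and n enter, which
gives adaptedness. -/
theorem gamL_eq_coe_iff {x y : Path d} {m n : ℕ} : gamL u x y = (↑m, ↑n) ↔
    IsFresh u m n x y ∧ ∀ m' < m, ∀ n' < n, ¬ IsFresh u m' n' x y := by
  constructor
  · intro h
    rw [gamL] at h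
    split_ifs at h with h1
    · obtain ⟨m', n', hf, e⟩ := mem_freshLevels.1 (sInf_mem_freshLevels h1)
      rw [← e, hf.2.gam_fst, hf.2.gam_snd, Prod.mk.injEq, Nat.cast_inj, Nat.cast_inj] at h
      obtain ⟨rfl, rfl⟩ := h
      refine ⟨hf, fun k hk l _ hf' => ?_⟩
      have := sInf_freshLevels_le (mem_freshLevels.2 ⟨_, _, hf', rfl⟩)
      rw [← e] at this
      exact this.not_gt (hf.2.1 k hk)
    · exact absurd (congrArg Prod.fst h).symm (ENat.natCast_ne_top _)
  · rintro ⟨hf, hmin⟩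
    have hmem := mem_freshLevels.2 ⟨m, n, hf, rfl⟩
    have e : sInf (freshLevels u x y) = level u (x m) := by
      refine le_antisymm (sInf_freshLevels_le hmem) ?_
      by_contra! hlt
      obtain ⟨m', n', hf', e'⟩ := mem_freshLevels.1 (sInf_mem_freshLevels ⟨_, hmem⟩)
      rw [← e'] at hlt
      refine hmin m' ?_ n' ?_ hf'
      · by_contra! hle
        rcases hle.eq_or_lt with rfl | h
        · exact hlt.ne rfl
        · exact (hf'.2.1 m h).not_gt hlt
      · rw [hf.2.2.2, hf'.2.2.2] at hlt
        by_contra! hle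
        rcases hle.eq_or_lt with rfl | h
        · exact hlt.ne rfl
        · exact (hf'.2.2.1 n h).not_gt hlt
    rw [gamL, if_pos ⟨_, hmem⟩, e, hf.2.gam_fst, hf.2.gam_snd]

theorem isFin_gamL_iff {x y : Path d} : IsFin (gamL u x y) ↔ (freshLevels u x y).Nonempty := by
  constructor
  · rintro ⟨m, n, h⟩
    exact ⟨_, mem_freshLevels.2 ⟨m, n, (gamL_eq_coe_iff.1 h).1, rfl⟩⟩
  · intro h
    obtain ⟨m', n', hf, e⟩ := mem_freshLevels.1 (sInf_mem_freshLevels h)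
    exact ⟨m', n', by rw [gamL, if_pos h, ← e, hf.2.gam_fst, hf.2.gam_snd]⟩

theorem IsFresh.congr {x y x' y' : Path d} {m n : ℕ} (h : IsFresh u m n x y)
    (hx : ∀ i ≤ m, x' i = x i) (hy : ∀ i ≤ n, y' i = y i) : IsFresh u m n x' y' := by
  obtain ⟨h0, h1, h2, h3⟩ := h
  refine ⟨?_, fun i hi => ?_, fun i hi => ?_, ?_⟩
  · rwa [hx _ (zero_le), hy _ (zero_le), hx _ le_rfl]
  · rw [hx _ hi.le, hx _ le_rfl]
    exact h1 i hi
  · rw [hy _ hi.le, hy _ le_rfl]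
    exact h2 i hi
  · rwa [hx _ le_rfl, hy _ le_rfl]

theorem isAdapted_gamL : IsAdapted (gamL u) := by
  intro x y x' y' m n h hx hy
  rw [gamL_eq_coe_iff] at h ⊢
  exact ⟨h.1.congr hx hy, fun k hk l hl hf => h.2 k hk l hl
    (hf.congr (fun i hi => (hx i (by omega)).symm) fun i hi => (hy i (by omega)).symm)⟩

/-! ### Attempts following a backtracking -/

theorem rho_eq_coe_iff {x y : Path d} {m n : ℕ} : rho u x y = (↑m, ↑n) ↔
    ∃ b : ℕ, ((level u (x b) < level u (x 0) ∨ level u (y b) < level u (y 0)) ∧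
      ∀ i < b, ¬ (level u (x i) < level u (x 0) ∨ level u (y i) < level u (y 0))) ∧
      gamPlus u (max (runMax u x b) (runMax u y b)) x = m ∧
      gamPlus u (max (runMax u x b) (runMax u y b)) y = n := by
  simp_rw [← firstTime_eq_coe_iff (p := fun b => level u (x b) < level u (x 0) ∨
    level u (y b) < level u (y 0))]
  rw [← firstTime_inf]
  change _ ↔ ∃ b : ℕ, backtrack u x ⊓ backtrack u y = b ∧ _
  rw [rho]
  constructor
  · intro h
    split_ifs at h with h1
    · refine ⟨_, (ENat.natCast_toNat h1.ne).symm, ?_⟩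
      simpa using h
    · exact absurd (congrArg Prod.fst h).symm (ENat.natCast_ne_top _)
  · rintro ⟨b, h, h1, h2⟩
    rw [if_pos (by rw [h]; exact ENat.natCast_lt_top b), h]
    simp [h1, h2]

theorem level_le_runMax {x : Path d} {i n : ℕ} (h : i ≤ n) : level u (x i) ≤ runMax u x n :=
  Finset.le_sup' (fun i => level u (x i)) (Finset.mem_range.2 (by omega))

theorem runMax_congr {x x' : Path d} {n : ℕ} (h : ∀ i ≤ n, x' i = x i) :
    runMax u x' n = runMax u x n :=
  Finset.sup'_congr _ rfl fun i hi => by rw [h i (by simpa [Nat.lt_succ_iff] using hi)]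

theorem lt_of_gamPlus_eq {x : Path d} {l : ℤ} {b m : ℕ} (hb : runMax u x b ≤ l)
    (h : gamPlus u l x = m) : b < m := by
  by_contra! hle
  exact ((level_le_runMax hle).trans hb).not_gt (firstTime_eq_coe_iff.1 h).1

theorem gamPlus_congr {x x' : Path d} {l : ℤ} {m : ℕ} (hm : gamPlus u l x = m)
    (h : ∀ i ≤ m, x' i = x i) : gamPlus u l x' = m := by
  rw [gamPlus, firstTime_eq_coe_iff] at hm ⊢
  exact ⟨by rw [h m le_rfl]; exact hm.1, fun i hi => by rw [h i hi.le]; exact hm.2 i hi⟩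

/-- The backtracking time b precedes m and n, because up to time b neither path exceeds the
threshold defining ρ. So both b and the threshold can be read off the paths before m and n. -/
theorem isAdapted_rho : IsAdapted (rho u) := by
  intro x y x' y' m n h hx hy
  obtain ⟨b, hb, hm, hn⟩ := rho_eq_coe_iff.1 h
  have hbm : b < m := lt_of_gamPlus_eq (le_max_left _ _) hm
  have hbn : b < n := lt_of_gamPlus_eq (le_max_right _ _) hn
  refine rho_eq_coe_iff.2 ⟨b, ⟨?_, fun i hi => ?_⟩, ?_, ?_⟩
  · rw [hx b hbm.le, hx 0 (zero_le), hy b hbn.le, hy 0 (zero_le)]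
    exact hb.1
  · rw [hx i (by omega), hx 0 (zero_le), hy i (by omega), hy 0 (zero_le)]
    exact hb.2 i hi
  · rw [runMax_congr fun i hi => hx i (by omega), runMax_congr fun i hi => hy i (by omega)]
    exact gamPlus_congr hm hx
  · rw [runMax_congr fun i hi => hx i (by omega), runMax_congr fun i hi => hy i (by omega)]
    exact gamPlus_congr hn hy

theorem isAdapted_zero : IsAdapted (nu u 0) := fun _ _ _ _ _ _ h _ _ => h

theorem isAdapted_nu (k : ℕ) : IsAdapted (nu u k) := by
  induction k with
  | zero => exact isAdapted_zero
  | succ k ih => exact ih.andThen (isAdapted_rho.andThen isAdapted_gamL)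

theorem isRecord_of_gamL {x y : Path d} {m n : ℕ} (h : gamL u x y = (↑m, ↑n)) :
    IsRecord u m n x y := (gamL_eq_coe_iff.1 h).1.2

theorem IsRecord.trans {x y : Path d} {m n k l : ℕ} (h : IsRecord u m n x y)
    (h' : IsRecord u k l (shift m x) (shift n y)) : IsRecord u (m + k) (n + l) x y := by
  have key : ∀ (x : Path d) (m k : ℕ), (∀ i < m, level u (x i) < level u (x m)) →
      (∀ i < k, level u (shift m x i) < level u (shift m x k)) →
      ∀ i < m + k, level u (x i) < level u (x (m + k)) := by
    intro x m k h1 h2 i hi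
    have h3 : level u (x m) ≤ level u (x (m + k)) := by
      rcases Nat.eq_zero_or_pos k with rfl | hk
      · exact le_rfl
      · have := (h2 0 hk).le
        simpa [shift, add_comm] using this
    rcases lt_or_ge i m with h4 | h4
    · exact (h1 i h4).trans_le h3
    · have := h2 (i - m) (by omega)
      simpa [shift, h4, add_comm] using this
  refine ⟨key x m k h.1 h'.1, key y n l h.2.1 h'.2.1, ?_⟩
  have := h'.2.2
  simpa [shift, add_comm] using this

/-- Before ρ both paths stay at or below the threshold t, and at ρ both are above it. A fresh level
after ρ lies above the lower of the two levels at ρ, hence above t, and is therefore a record for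
the whole paths. The two levels at ρ need not agree. -/
theorem isRecord_of_rho_gamL {x y : Path d} {m n : ℕ}
    (h : andThen (rho u) (gamL u) x y = (↑m, ↑n)) : IsRecord u m n x y := by
  obtain ⟨r, s, k, l, hr, hg, rfl, rfl⟩ := andThen_eq_coe_iff.1 h
  obtain ⟨b, -, hm, hn⟩ := rho_eq_coe_iff.1 hr
  obtain ⟨hf, hrec⟩ := (gamL_eq_coe_iff.1 hg).1
  rw [gamPlus, firstTime_eq_coe_iff] at hm hn
  set t := max (runMax u x b) (runMax u y b)
  have ht : t < level u (x (r + k)) := by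
    refine lt_trans (lt_min ?_ ?_) (by simpa [shift, add_comm] using hf)
    · exact hm.1
    · exact hn.1
  have ht' : level u (x (r + k)) = level u (y (s + l)) := by
    have := hrec.2.2
    simpa [shift, add_comm] using this
  have key : ∀ (x : Path d) (r k : ℕ), t < level u (x (r + k)) →
      (∀ i < r, ¬ t < level u (x i)) →
      (∀ i < k, level u (shift r x i) < level u (shift r x k)) →
      ∀ i < r + k, level u (x i) < level u (x (r + k)) := by
    intro x r k h1 h2 h3 i hi
    rcases lt_or_ge i r with h4 | h4
    · exact (not_lt.1 (h2 i h4)).trans_lt h1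
    · have := h3 (i - r) (by omega)
      simpa [shift, h4, add_comm] using this
  exact ⟨key x r k ht hm.2 hrec.1, key y s l (ht' ▸ ht) hn.2 hrec.2.1, ht'⟩

/-- Equal initial levels are needed only for k = 0, where the pair (0, 0) must itself be a record.
-/
theorem isRecord_of_nu {x y : Path d} (h0 : level u (x 0) = level u (y 0)) (k : ℕ) :
    ∀ {m n : ℕ}, nu u k x y = (↑m, ↑n) → IsRecord u m n x y := by
  induction k with
  | zero =>
    intro m n h
    obtain ⟨hm, hn⟩ := Prod.mk.injEq .. ▸ h
    obtain rfl : 0 = m := by exact_mod_cast hm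
    obtain rfl : 0 = n := by exact_mod_cast hn
    exact ⟨by simp, by simp, h0⟩
  | succ k ih =>
    intro m n h
    obtain ⟨r, s, k, l, hr, hg, rfl, rfl⟩ := andThen_eq_coe_iff.1 h
    exact (ih hr).trans (isRecord_of_rho_gamL hg)

theorem isFin_nu_of_succ {x y : Path d} {k : ℕ} (h : IsFin (nu u (k + 1) x y)) :
    IsFin (nu u k x y) := by
  obtain ⟨m, n, h, -⟩ := isFin_andThen_iff.1 h
  exact ⟨m, n, h⟩

theorem isFin_nu_mono {x y : Path d} {k l : ℕ} (hkl : k ≤ l) (h : IsFin (nu u l x y)) :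
    IsFin (nu u k x y) := by
  induction hkl with
  | refl => exact h
  | step _ ih => exact ih (isFin_nu_of_succ h)

/-- The indices k with ν_k finite form an initial segment, so K is the one finite index whose
successor is infinite. -/
theorem nuLast_eq_coe_iff {x y : Path d} {m n : ℕ} : nuLast u x y = (↑m, ↑n) ↔
    ∃ k, nu u k x y = (↑m, ↑n) ∧ ¬ IsFin (nu u (k + 1) x y) := by
  have hmem : ∀ k, k ∈ finiteNu u x y ↔ IsFin (nu u k x y) := fun k => isFin_iff.symm
  rw [nuLast]
  constructor
  · intro h
    split_ifs at h with hb
    · refine ⟨_, h, fun h' => ?_⟩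
      have := le_csSup hb ((hmem _).2 h')
      omega
    · exact absurd (congrArg Prod.fst h).symm (ENat.natCast_ne_top _)
  · rintro ⟨k, hk, hk'⟩
    have hub : k ∈ upperBounds (finiteNu u x y) := by
      intro j hj
      by_contra! hlt
      exact hk' (isFin_nu_mono hlt ((hmem j).1 hj))
    have hK : sSup (finiteNu u x y) = k :=
      IsGreatest.csSup_eq ⟨(hmem k).2 ⟨m, n, hk⟩, hub⟩
    rw [if_pos ⟨k, hub⟩, hK, hk]

theorem isFin_nuLast {x y : Path d} (h : BddAbove (finiteNu u x y)) :
    IsFin (nuLast u x y) := by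
  rw [nuLast, if_pos h, isFin_iff]
  refine Nat.sSup_mem (s := finiteNu u x y) ⟨0, ?_⟩ h
  exact isFin_iff.1 ⟨0, 0, rfl⟩

theorem not_isFin_rho_of_noBacktrack {x y : Path d} (h : (x, y) ∈ noBacktrack u) :
    ¬ IsFin (rho u x y) := by
  rintro ⟨m, n, h'⟩
  obtain ⟨b, ⟨hb, -⟩, -⟩ := rho_eq_coe_iff.1 h'
  rw [mem_noBacktrack] at h
  rcases hb with hb | hb
  · exact hb.not_ge (h.1 b)
  · exact hb.not_ge (h.2 b)

/-- A pair of paths both of which reach every level, with common fresh levels and finitely many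
backtracking attempts after every pair of times. -/
structure IsRegular (u : Site d) (x y : Path d) : Prop where
  unbounded_fst : ∀ l : ℤ, ∃ n, l < level u (x n)
  unbounded_snd : ∀ l : ℤ, ∃ n, l < level u (y n)
  fresh : ∀ m n, (freshLevels u (shift m x) (shift n y)).Nonempty
  bddAbove : ∀ m n, BddAbove (finiteNu u (shift m x) (shift n y))

theorem shift_shift (m n : ℕ) (x : Path d) : shift n (shift m x) = shift (m + n) x := by
  funext i
  simp only [shift]
  congr 1
  omega

theorem shift_zero (x : Path d) : shift 0 x = x := rfl

theorem exists_lt_level_shift {x : Path d} (h : ∀ l : ℤ, ∃ n, l < level u (x n)) (m : ℕ) (l : ℤ) :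
    ∃ n, l < level u (shift m x n) := by
  obtain ⟨n, hn⟩ := h (max l (runMax u x m))
  rw [max_lt_iff] at hn
  have hmn : m ≤ n := by
    by_contra! hlt
    exact hn.2.not_ge (level_le_runMax hlt.le)
  exact ⟨n - m, by simpa [shift, hmn] using hn.1⟩

theorem IsRegular.shift {x y : Path d} (h : IsRegular u x y) (m n : ℕ) :
    IsRegular u (shift m x) (shift n y) where
  unbounded_fst := exists_lt_level_shift h.1 m
  unbounded_snd := exists_lt_level_shift h.2 n
  fresh k l := by rw [shift_shift, shift_shift]; exact h.3 _ _
  bddAbove k l := by rw [shift_shift, shift_shift]; exact h.4 _ _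

theorem IsRegular.isFin_rho {x y : Path d} (h : IsRegular u x y) (hb : (x, y) ∉ noBacktrack u) :
    IsFin (rho u x y) := by
  rw [mem_noBacktrack, not_and_or] at hb
  push Not at hb
  have hb' : ∃ b, level u (x b) < level u (x 0) ∨ level u (y b) < level u (y 0) := by
    rcases hb with ⟨b, hb⟩ | ⟨b, hb⟩
    exacts [⟨b, Or.inl hb⟩, ⟨b, Or.inr hb⟩]
  obtain ⟨b, hb⟩ := exists_firstTime hb'
  obtain ⟨m, hm⟩ := exists_firstTime (h.1 (max (runMax u x b) (runMax u y b)))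
  obtain ⟨n, hn⟩ := exists_firstTime (h.2 (max (runMax u x b) (runMax u y b)))
  exact ⟨m, n, rho_eq_coe_iff.2 ⟨b, firstTime_eq_coe_iff.1 hb, hm, hn⟩⟩

theorem IsRegular.isFin_gamL {x y : Path d} (h : IsRegular u x y) : IsFin (gamL u x y) :=
  isFin_gamL_iff.2 (h.fresh 0 0)

/-- On a regular pair a backtracking always leads to a further finite attempt: ρ is finite because
levels are unbounded, and γ_L because fresh levels exist after any times. -/
theorem IsRegular.isFin_nu_succ_iff {x y : Path d} (h : IsRegular u x y) {k m n : ℕ}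
    (hk : nu u k x y = (↑m, ↑n)) :
    IsFin (nu u (k + 1) x y) ↔ (RWRE.shift m x, RWRE.shift n y) ∉ noBacktrack u := by
  rw [nu, isFin_andThen_iff]
  constructor
  · rintro ⟨m', n', hk', hf⟩ hb
    rw [hk, Prod.mk.injEq, Nat.cast_inj, Nat.cast_inj] at hk'
    obtain ⟨rfl, rfl⟩ := hk'
    obtain ⟨r, s, hr, -⟩ := isFin_andThen_iff.1 hf
    exact not_isFin_rho_of_noBacktrack hb ⟨r, s, hr⟩
  · intro hb
    refine ⟨m, n, hk, ?_⟩
    obtain ⟨r, s, hr⟩ := (h.shift m n).isFin_rho hb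
    exact isFin_andThen_iff.2 ⟨r, s, hr, ((h.shift m n).shift r s).isFin_gamL⟩

/-- The times `(ν, ν̃) + (ν_k, ν̃_k) ∘ θ^{ν, ν̃}`, for some `k`, are `(m, n)`. -/
def IsCandidate (u : Site d) (m n : ℕ) (x y : Path d) : Prop :=
  ∃ k, andThen (gamL u) (nu u k) x y = (↑m, ↑n)

theorem IsCandidate.isRecord {x y : Path d} {m n : ℕ} (h : IsCandidate u m n x y) :
    IsRecord u m n x y := by
  obtain ⟨k, h⟩ := h
  obtain ⟨r, s, k, l, hr, hg, rfl, rfl⟩ := andThen_eq_coe_iff.1 h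
  have h1 := isRecord_of_gamL hr
  exact h1.trans (isRecord_of_nu (by simpa [RWRE.shift] using h1.2.2) _ hg)

theorem IsCandidate.congr {x y x' y' : Path d} {m n : ℕ} (h : IsCandidate u m n x y)
    (hx : ∀ i ≤ m, x' i = x i) (hy : ∀ i ≤ n, y' i = y i) : IsCandidate u m n x' y' := by
  obtain ⟨k, h⟩ := h
  exact ⟨k, isAdapted_gamL.andThen (isAdapted_nu k) h hx hy⟩

/-- The first common regeneration time `(μ_1, μ̃_1)`. -/
noncomputable def regenOne (u : Site d) : Path d → Path d → ℕ∞ × ℕ∞ :=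
  andThen (gamL u) (nuLast u)

theorem regen_succ (i : ℕ) : regen u (i + 1) = andThen (regen u i) (regenOne u) := rfl

theorem regen_one (x y : Path d) : regen u 1 x y = regenOne u x y := by
  rw [regen_succ, andThen_of_eq_coe (m := 0) (n := 0) rfl, shift_zero, shift_zero]
  simp only [Nat.cast_zero]
  exact zero_add _

/-- The only part of the definition that looks beyond (m, n) is the requirement that the next ν be
infinite, and on a regular pair this says that nothing backtracks after (m, n). The event splits
into a condition on the past and one on the future. -/
theorem IsRegular.regenOne_eq_coe_iff {x y : Path d} (h : IsRegular u x y) {m n : ℕ} :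
    regenOne u x y = (↑m, ↑n) ↔
      IsCandidate u m n x y ∧ (RWRE.shift m x, RWRE.shift n y) ∈ noBacktrack u := by
  simp only [regenOne, IsCandidate, andThen_eq_coe_iff, nuLast_eq_coe_iff]
  constructor
  · rintro ⟨r, s, k, l, hg, ⟨j, hj, hj'⟩, rfl, rfl⟩
    refine ⟨⟨j, r, s, k, l, hg, hj, rfl, rfl⟩, ?_⟩
    rw [(h.shift r s).isFin_nu_succ_iff hj, not_not, shift_shift, shift_shift] at hj'
    exact hj'
  · rintro ⟨⟨j, r, s, k, l, hg, hj, rfl, rfl⟩, hb⟩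
    refine ⟨r, s, k, l, hg, ⟨j, hj, ?_⟩, rfl, rfl⟩
    rw [(h.shift r s).isFin_nu_succ_iff hj, not_not, shift_shift, shift_shift]
    exact hb

theorem IsRegular.isFin_regenOne {x y : Path d} (h : IsRegular u x y) :
    IsFin (regenOne u x y) := by
  obtain ⟨m, n, hg⟩ := h.isFin_gamL
  exact isFin_andThen_iff.2 ⟨m, n, hg, isFin_nuLast (h.bddAbove m n)⟩

theorem IsRegular.isFin_regen {x y : Path d} (h : IsRegular u x y) (i : ℕ) :
    IsFin (regen u i x y) := by
  induction i with
  | zero => exact ⟨0, 0, rfl⟩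
  | succ i ih =>
    obtain ⟨m, n, hg⟩ := ih
    exact isFin_andThen_iff.2 ⟨m, n, hg, (h.shift m n).isFin_regenOne⟩

/-- A set of pairs of paths that only depends on the paths up to the times `m` and `n`. -/
def IsDetermined (m n : ℕ) (S : Set (Path d × Path d)) : Prop :=
  ∀ ⦃x y x' y' : Path d⦄, (x, y) ∈ S → (∀ i ≤ m, x' i = x i) → (∀ i ≤ n, y' i = y i) →
    (x', y') ∈ S

theorem regenDiff_of_eq {x y : Path d} {i m n : ℕ} (h : regen u i x y = (↑m, ↑n)) :
    regenDiff u i (x, y) = y n - x m := by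
  simp [regenDiff, h]

/-- The shift moves time and not space, so no recentring is needed: the next difference is a
function of the future pair alone. -/
theorem IsRegular.regenDiff_succ {x y : Path d} (h : IsRegular u x y) {i m n : ℕ}
    (hi : regen u i x y = (↑m, ↑n)) :
    regenDiff u (i + 1) (x, y) = regenDiff u 1 (RWRE.shift m x, RWRE.shift n y) := by
  obtain ⟨k, l, hk⟩ := (h.shift m n).isFin_regenOne
  rw [regenDiff_of_eq (i := i + 1) (andThen_eq_coe_iff.2 ⟨m, n, k, l, hi, hk, rfl, rfl⟩),
    regenDiff_of_eq (i := 1) (by rw [regen_one]; exact hk)]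
  simp [RWRE.shift, add_comm]

/-- After m and n the paths stay above levels that already dominate those at m' and n', so only the
stretches in between remain to be checked. This turns the future condition at an earlier
regeneration into a condition on the past of a later one. -/
theorem mem_noBacktrack_shift_iff {x y : Path d} {m n m' n' : ℕ} (hm : m' ≤ m) (hn : n' ≤ n)
    (hx : level u (x m') ≤ level u (x m)) (hy : level u (y n') ≤ level u (y n))
    (h : (shift m x, shift n y) ∈ noBacktrack u) :
    (shift m' x, shift n' y) ∈ noBacktrack u ↔
      (∀ j, m' ≤ j → j ≤ m → level u (x m') ≤ level u (x j)) ∧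
      (∀ j, n' ≤ j → j ≤ n → level u (y n') ≤ level u (y j)) := by
  have key : ∀ (x : Path d) (m m' : ℕ), m' ≤ m → level u (x m') ≤ level u (x m) →
      (∀ k, level u (shift m x 0) ≤ level u (shift m x k)) →
      ((∀ k, level u (shift m' x 0) ≤ level u (shift m' x k)) ↔
        ∀ j, m' ≤ j → j ≤ m → level u (x m') ≤ level u (x j)) := by
    intro x m m' hm hx h
    constructor
    · intro h' j hj _
      have := h' (j - m')
      simpa [shift, hj] using this
    · intro h' k
      simp only [shift, zero_add]
      rcases le_total (k + m') m with hk | hk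
      · exact h' _ (by omega) hk
      · have := h (k + m' - m)
        simp only [shift, zero_add, Nat.sub_add_cancel hk] at this
        exact hx.trans this
  rw [mem_noBacktrack] at h ⊢
  exact and_congr (key x m m' hm hx h.1) (key y n n' hn hy h.2)

/-- On regular pairs of paths, the event that the `i`-th regeneration times are `(m, n)` while the
first `i` differences take given values is the intersection of an event determined by the paths up
to the times `m`, `n`, at which they have a record, and the event that there is no backtracking
afterwards. -/
theorem exists_isDetermined_regen (z : ℕ → Site d) (i : ℕ) : ∀ m n : ℕ,
    ∃ S : Set (Path d × Path d), IsDetermined m n S ∧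
      (∀ x y, (x, y) ∈ S → IsRecord u m n x y ∧ y n - x m = z (i + 1)) ∧
      ∀ x y, IsRegular u x y → ((regen u (i + 1) x y = (↑m, ↑n) ∧
        ∀ k, 1 ≤ k → k ≤ i + 1 → regenDiff u k (x, y) = z k) ↔
        ((x, y) ∈ S ∧ (shift m x, shift n y) ∈ noBacktrack u)) := by
  induction i with
  | zero =>
    intro m n
    refine ⟨{p | IsCandidate u m n p.1 p.2 ∧ p.2 n - p.1 m = z 1}, ?_, ?_, ?_⟩
    · intro x y x' y' h hx hy
      refine ⟨h.1.congr hx hy, ?_⟩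
      rw [← h.2]
      simp [hx m le_rfl, hy n le_rfl]
    · exact fun x y h => ⟨h.1.isRecord, h.2⟩
    · intro x y h
      rw [zero_add, regen_one, h.regenOne_eq_coe_iff]
      constructor
      · rintro ⟨⟨hc, hb⟩, hz⟩
        refine ⟨⟨hc, ?_⟩, hb⟩
        rw [← hz 1 le_rfl le_rfl, regenDiff_of_eq (by
          rw [regen_one, h.regenOne_eq_coe_iff]; exact ⟨hc, hb⟩)]
      · rintro ⟨⟨hc, hz⟩, hb⟩
        refine ⟨⟨hc, hb⟩, fun k hk hk' => ?_⟩
        obtain rfl : k = 1 := by omega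
        rw [regenDiff_of_eq (by rw [regen_one, h.regenOne_eq_coe_iff]; exact ⟨hc, hb⟩)]
        exact hz
  | succ i ih =>
    intro m n
    choose S hS1 hS2 hS3 using ih
    -- (m', n') is the previous regeneration and (k, l) the candidate after it. The two conditions
    -- on finite stretches stand for no backtracking after (m', n'), to which they are equivalent
    -- once there is none after (m, n).
    refine ⟨{p | ∃ m' n' k l, m = m' + k ∧ n = n' + l ∧ p ∈ S m' n' ∧
      IsCandidate u k l (shift m' p.1) (shift n' p.2) ∧
      (∀ j, m' ≤ j → j ≤ m → level u (p.1 m') ≤ level u (p.1 j)) ∧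
      (∀ j, n' ≤ j → j ≤ n → level u (p.2 n') ≤ level u (p.2 j)) ∧
      p.2 n - p.1 m = z (i + 1 + 1)}, ?_, ?_, ?_⟩
    · rintro x y x' y' ⟨m', n', k, l, rfl, rfl, hp, hc, h1, h2, h3⟩ hx hy
      refine ⟨m', n', k, l, rfl, rfl, ?_, ?_, ?_, ?_, ?_⟩
      · exact hS1 _ _ hp (fun i hi => hx i (by omega)) (fun i hi => hy i (by omega))
      · exact hc.congr (fun i hi => hx _ (by omega)) (fun i hi => hy _ (by omega))
      · intro j hj hj'
        simp only [hx j hj', hx m' (by omega)]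
        exact h1 j hj hj'
      · intro j hj hj'
        simp only [hy j hj', hy n' (by omega)]
        exact h2 j hj hj'
      · simp only [hx _ le_rfl, hy _ le_rfl]
        exact h3
    · rintro x y ⟨m', n', k, l, rfl, rfl, hp, hc, h1, h2, h3⟩
      exact ⟨(hS2 _ _ _ _ hp).1.trans hc.isRecord, h3⟩
    · intro x y h
      rw [regen_succ, andThen_eq_coe_iff]
      constructor
      · rintro ⟨⟨m', n', k, l, hr, hr1, rfl, rfl⟩, hz⟩
        have h1 := (h.shift m' n').regenOne_eq_coe_iff.1 hr1
        rw [shift_shift, shift_shift] at h1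
        have h2 := (hS3 m' n' x y h).1 ⟨hr, fun k hk hk' => hz k hk (by omega)⟩
        have hrec := h1.1.isRecord
        have h3 := (mem_noBacktrack_shift_iff (Nat.le_add_right m' k) (Nat.le_add_right n' l)
          ?_ ?_ h1.2).1 h2.2
        · refine ⟨⟨m', n', k, l, rfl, rfl, h2.1, h1.1, h3.1, h3.2, ?_⟩, h1.2⟩
          rw [← hz (i + 1 + 1) (by omega) le_rfl, regenDiff_of_eq (i := i + 1 + 1)
            (andThen_eq_coe_iff.2 ⟨m', n', k, l, hr, hr1, rfl, rfl⟩)]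
        · have := (mem_noBacktrack.1 h2.2).1 k
          simpa [shift, add_comm] using this
        · have := (mem_noBacktrack.1 h2.2).2 l
          simpa [shift, add_comm] using this
      · rintro ⟨⟨m', n', k, l, rfl, rfl, hp, hc, h1, h2, h3⟩, hb⟩
        have hb' := (mem_noBacktrack_shift_iff (Nat.le_add_right m' k) (Nat.le_add_right n' l)
          (h1 _ (by omega) le_rfl) (h2 _ (by omega) le_rfl) hb).2 ⟨h1, h2⟩
        have hr := (hS3 m' n' x y h).2 ⟨hp, hb'⟩
        have hr1 := (h.shift m' n').regenOne_eq_coe_iff.2 ⟨hc, by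
          rw [shift_shift, shift_shift]; exact hb⟩
        refine ⟨⟨m', n', k, l, hr.1, hr1, rfl, rfl⟩, fun j hj hj' => ?_⟩
        rcases hj'.eq_or_lt with rfl | hj'
        · rw [regenDiff_of_eq (i := i + 1 + 1)
            (andThen_eq_coe_iff.2 ⟨m', n', k, l, hr.1, hr1, rfl, rfl⟩)]
          exact h3
        · exact hr.2 j hj (by omega)

/-! ### Path measures and their cylinders -/

/-- Two measures are compared on a set that is a union of fibres of a countably-valued map by
comparing them on the fibres. -/
theorem measure_le_of_fibers {Ω ι : Type*} [MeasurableSpace Ω] [MeasurableSpace ι] [Countable ι]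
    [MeasurableSingletonClass ι] {f : Ω → ι} (hf : Measurable f) {μ ν : Measure Ω} {S : Set Ω}
    (hS : ∀ ω ∈ S, ∀ ω', f ω' = f ω → ω' ∈ S)
    (h : ∀ ω ∈ S, μ (f ⁻¹' {f ω}) ≤ ν (f ⁻¹' {f ω})) : μ S ≤ ν S := by
  have hm (i : f '' S) : MeasurableSet (f ⁻¹' {i.1}) := hf (measurableSet_singleton _)
  have e : S = ⋃ i : f '' S, f ⁻¹' {i.1} := by
    ext ω
    simp only [Set.mem_iUnion, Set.mem_preimage, Set.mem_singleton_iff]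
    constructor
    · exact fun h => ⟨⟨f ω, ω, h, rfl⟩, rfl⟩
    · rintro ⟨⟨_, ω', h', rfl⟩, h''⟩
      exact hS ω' h' ω h''
  have hd : Pairwise (Function.onFun Disjoint fun i : f '' S => f ⁻¹' {i.1}) := by
    intro i j hij
    refine Set.disjoint_left.2 fun ω h1 h2 => hij (Subtype.ext ?_)
    exact (Set.mem_singleton_iff.1 h1).symm.trans (Set.mem_singleton_iff.1 h2)
  rw [e, measure_iUnion hd hm, measure_iUnion hd hm]
  refine ENNReal.tsum_le_tsum ?_
  rintro ⟨_, ω, hω, rfl⟩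
  exact h ω hω

theorem measurableSet_of_fibers {Ω ι : Type*} [MeasurableSpace Ω] [MeasurableSpace ι] [Countable ι]
    [MeasurableSingletonClass ι] {f : Ω → ι} (hf : Measurable f) {S : Set Ω}
    (hS : ∀ ω ∈ S, ∀ ω', f ω' = f ω → ω' ∈ S) : MeasurableSet S := by
  have : S = f ⁻¹' (f '' S) := by
    refine Set.Subset.antisymm (Set.subset_preimage_image f S) ?_
    rintro ω ⟨ω', h, e⟩
    exact hS ω' h ω e.symm
  rw [this]
  exact hf (Set.to_countable _).measurableSet

/-- The path up to time `n`. -/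
def initial (n : ℕ) (x : Path d) : Fin (n + 1) → Site d := fun i => x i

theorem measurable_initial (n : ℕ) : Measurable (initial (d := d) n) :=
  measurable_pi_lambda _ fun _ => measurable_pi_apply _

theorem initial_eq_iff {n : ℕ} {x y : Path d} : initial n x = initial n y ↔ ∀ i ≤ n, x i = y i := by
  constructor
  · intro h i hi
    exact congrFun h ⟨i, by omega⟩
  · intro h
    funext i
    exact h i (by omega)

/-- Paths agreeing with `a` up to time `n`. -/
def cyl (n : ℕ) (a : Path d) : Set (Path d) := {X | ∀ i ≤ n, X i = a i}

theorem initial_preimage (n : ℕ) (a : Path d) : initial n ⁻¹' {initial n a} = cyl n a := by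
  ext x
  exact initial_eq_iff

theorem measurableSet_cyl (n : ℕ) (a : Path d) : MeasurableSet (cyl n a) := by
  rw [← initial_preimage]
  exact measurable_initial n (measurableSet_singleton _)

theorem measurable_coord (n : ℕ) : Measurable fun X : Path d => X n := measurable_pi_apply n

theorem measurableSet_coord (n : ℕ) (p : Site d → Prop) :
    MeasurableSet {X : Path d | p (X n)} :=
  measurable_coord n (Set.to_countable {z | p z}).measurableSet

theorem measurable_shift (n : ℕ) : Measurable (shift (d := d) n) :=
  measurable_pi_lambda _ fun _ => measurable_pi_apply _

/-- A set of paths that only depends on the path up to time `n`. -/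
def IsDet (n : ℕ) (S : Set (Path d)) : Prop :=
  ∀ ⦃x x' : Path d⦄, x ∈ S → (∀ i ≤ n, x' i = x i) → x' ∈ S

theorem IsDet.measurableSet {n : ℕ} {S : Set (Path d)} (hS : IsDet n S) : MeasurableSet S :=
  measurableSet_of_fibers (measurable_initial n) fun _ h _ e => hS h (initial_eq_iff.1 e)

theorem IsDet.measure_le {n : ℕ} {S : Set (Path d)} (hS : IsDet n S) {μ ν : Measure (Path d)}
    (h : ∀ a ∈ S, μ (cyl n a) ≤ ν (cyl n a)) : μ S ≤ ν S :=
  measure_le_of_fibers (measurable_initial n) (fun _ h _ e => hS h (initial_eq_iff.1 e))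
    fun a ha => by simpa only [initial_preimage] using h a ha

theorem IsDet.measure_congr {n : ℕ} {S : Set (Path d)} (hS : IsDet n S) {μ ν : Measure (Path d)}
    (h : ∀ a ∈ S, μ (cyl n a) = ν (cyl n a)) : μ S = ν S :=
  le_antisymm (hS.measure_le fun a ha => (h a ha).le) (hS.measure_le fun a ha => (h a ha).ge)

theorem measurable_prod_initial (m n : ℕ) :
    Measurable (Prod.map (initial (d := d) m) (initial (d := d) n)) :=
  (measurable_initial m).prodMap (measurable_initial n)

theorem prod_initial_preimage (m n : ℕ) (p : Path d × Path d) :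
    Prod.map (initial m) (initial n) ⁻¹' {Prod.map (initial m) (initial n) p} =
      cyl m p.1 ×ˢ cyl n p.2 := by
  ext q
  simp only [Set.mem_preimage, Set.mem_singleton_iff, Prod.ext_iff, Prod.map_fst, Prod.map_snd,
    initial_eq_iff, Set.mem_prod]
  rfl

theorem IsDetermined.fibers {m n : ℕ} {S : Set (Path d × Path d)} (hS : IsDetermined m n S) :
    ∀ p ∈ S, ∀ q, Prod.map (initial m) (initial n) q = Prod.map (initial m) (initial n) p →
      q ∈ S := by
  rintro ⟨x, y⟩ hp ⟨x', y'⟩ h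
  rw [Prod.ext_iff] at h
  exact hS hp (initial_eq_iff.1 h.1) (initial_eq_iff.1 h.2)

theorem IsDetermined.measurableSet {m n : ℕ} {S : Set (Path d × Path d)}
    (hS : IsDetermined m n S) : MeasurableSet S :=
  measurableSet_of_fibers (measurable_prod_initial m n) hS.fibers

theorem IsDetermined.measure_le {m n : ℕ} {S : Set (Path d × Path d)} (hS : IsDetermined m n S)
    {μ ν : Measure (Path d × Path d)}
    (h : ∀ p ∈ S, μ (cyl m p.1 ×ˢ cyl n p.2) ≤ ν (cyl m p.1 ×ˢ cyl n p.2)) : μ S ≤ ν S :=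
  measure_le_of_fibers (measurable_prod_initial m n) hS.fibers
    fun a ha => by simpa only [prod_initial_preimage] using h a ha

theorem IsDetermined.measure_congr {m n : ℕ} {S : Set (Path d × Path d)}
    (hS : IsDetermined m n S) {μ ν : Measure (Path d × Path d)}
    (h : ∀ p ∈ S, μ (cyl m p.1 ×ˢ cyl n p.2) = ν (cyl m p.1 ×ˢ cyl n p.2)) : μ S = ν S :=
  le_antisymm (hS.measure_le fun a ha => (h a ha).le) (hS.measure_le fun a ha => (h a ha).ge)

/-- The sets of paths that only depend on finitely many steps. -/
theorem generateFrom_isDet :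
    (inferInstance : MeasurableSpace (Path d)) =
      MeasurableSpace.generateFrom {S | ∃ n, IsDet n S} := by
  refine le_antisymm ?_ (MeasurableSpace.generateFrom_le ?_)
  · refine iSup_le fun i => ?_
    rintro _ ⟨t, -, rfl⟩
    refine MeasurableSpace.measurableSet_generateFrom ⟨i, fun x x' hx h => ?_⟩
    simpa [h i le_rfl] using hx
  · rintro S ⟨n, hn⟩
    exact hn.measurableSet

theorem IsDet.mono {m n : ℕ} (hmn : m ≤ n) {S : Set (Path d)} (hS : IsDet m S) : IsDet n S :=
  fun _ _ hx h => hS hx fun i hi => h i (hi.trans hmn)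

theorem IsDet.inter {m n : ℕ} {S T : Set (Path d)} (hS : IsDet m S) (hT : IsDet n T) :
    IsDet (max m n) (S ∩ T) :=
  fun _ _ hx h => ⟨hS.mono (le_max_left _ _) hx.1 h, hT.mono (le_max_right _ _) hx.2 h⟩

/-- Sets depending on finitely many steps form a generating π-system, and each of them is a
countable disjoint union of cylinders. -/
theorem pathMeasure_ext {μ ν : Measure (Path d)} [IsFiniteMeasure μ]
    (h : ∀ n a, μ (cyl n a) = ν (cyl n a)) : μ = ν := by
  refine ext_of_generate_finite _ generateFrom_isDet ?_ ?_ ?_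
  · rintro S ⟨m, hS⟩ T ⟨n, hT⟩ -
    exact ⟨_, hS.inter hT⟩
  · rintro S ⟨n, hS⟩
    exact hS.measure_congr fun a _ => h n a
  · exact IsDet.measure_congr (n := 0) (fun _ _ _ _ => trivial) fun a _ => h 0 a

/-! ### The quenched law -/

/-- Concatenation of the first `n` steps of `a` with `b`. -/
def glue (n : ℕ) (a b : Path d) : Path d := fun i => if i ≤ n then a i else b (i - n)

theorem quenchedLaw_cyl (x : Site d) (ω : Env d) (n : ℕ) (a : Path d) :
    quenchedLaw x ω (cyl n a) = (if a 0 = x then 1 else 0) *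
      ∏ i ∈ Finset.range n, ENNReal.ofReal (trans ω (a i) (a (i + 1))) :=
  quenchedLaw_cylinder x ω n a

/-- If b starts where a ends, the event is the cylinder of the glued path and the product of
transition probabilities splits at time n. Otherwise both sides vanish. -/
theorem quenchedLaw_cyl_inter_shift_cyl (x : Site d) (ω : Env d) (n k : ℕ) (a b : Path d) :
    quenchedLaw x ω (cyl n a ∩ shift n ⁻¹' cyl k b) =
      quenchedLaw x ω (cyl n a) * quenchedLaw (a n) ω (cyl k b) := by
  by_cases hb : b 0 = a n
  · have hglue : ∀ i, glue n a b (n + i) = b i := by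
      intro i
      rcases Nat.eq_zero_or_pos i with rfl | hi
      · simp [glue, hb]
      · rw [glue, if_neg (by omega)]
        congr 1
        omega
    have hglue' : ∀ i ≤ n, glue n a b i = a i := fun i hi => if_pos hi
    have e : cyl n a ∩ shift n ⁻¹' cyl k b = cyl (n + k) (glue n a b) := by
      ext X
      simp only [cyl, Set.mem_inter_iff, Set.mem_preimage, Set.mem_ofPred_eq, shift]
      constructor
      · rintro ⟨h1, h2⟩ i hi
        rcases le_or_gt i n with h | h
        · rw [h1 i h, hglue' i h]
        · obtain ⟨j, rfl⟩ := Nat.exists_eq_add_of_le h.le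
          rw [hglue, ← h2 j (by omega), add_comm]
      · intro h
        refine ⟨fun i hi => ?_, fun i hi => ?_⟩
        · rw [h i (by omega), hglue' i hi]
        · rw [add_comm, h (n + i) (by omega), hglue]
    rw [e, quenchedLaw_cyl, quenchedLaw_cyl, quenchedLaw_cyl, Finset.prod_range_add, if_pos hb,
      hglue' 0 (Nat.zero_le _), one_mul, mul_assoc]
    congr 2
    · refine Finset.prod_congr rfl fun i hi => ?_
      rw [Finset.mem_range] at hi
      rw [hglue' i hi.le, hglue' (i + 1) hi]
    · refine Finset.prod_congr rfl fun i _ => ?_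
      rw [hglue, add_assoc, hglue]
  · have e : cyl n a ∩ shift n ⁻¹' cyl k b = ∅ := by
      ext X
      simp only [cyl, Set.mem_inter_iff, Set.mem_preimage, Set.mem_ofPred_eq, shift,
        Set.mem_empty_iff_false, iff_false, not_and]
      intro h1 h2
      have h3 := h2 0 (Nat.zero_le _)
      rw [zero_add, h1 n le_rfl] at h3
      exact hb h3.symm
    rw [e, quenchedLaw_cyl (a n), if_neg hb]
    simp

/-- The Markov property of the walk in a fixed environment. -/
theorem map_shift_restrict_quenchedLaw (x : Site d) (ω : Env d) (n : ℕ) (a : Path d) :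
    ((quenchedLaw x ω).restrict (cyl n a)).map (shift n) =
      quenchedLaw x ω (cyl n a) • quenchedLaw (a n) ω := by
  refine pathMeasure_ext fun k b => ?_
  rw [Measure.map_apply (measurable_shift n) (measurableSet_cyl k b),
    Measure.restrict_apply (measurable_shift n (measurableSet_cyl k b)), Set.inter_comm,
    quenchedLaw_cyl_inter_shift_cyl]
  rfl

theorem quenchedLaw_cyl_inter_shift (x : Site d) (ω : Env d) (n : ℕ) (a : Path d)
    {A : Set (Path d)} (hA : MeasurableSet A) :
    quenchedLaw x ω (cyl n a ∩ shift n ⁻¹' A) =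
      quenchedLaw x ω (cyl n a) * quenchedLaw (a n) ω A := by
  have := congrArg (fun μ : Measure (Path d) => μ A) (map_shift_restrict_quenchedLaw x ω n a)
  simp only [Measure.map_apply (measurable_shift n) hA, Measure.smul_apply, smul_eq_mul,
    Measure.restrict_apply (measurable_shift n hA)] at this
  rwa [Set.inter_comm]

/-- Turns a bound that is uniform over the endpoints of S into a bound for running through S and
then A. The lower estimates built from several stages rest on it. -/
theorem IsDet.le_quenchedLaw_inter_shift {n : ℕ} {S A : Set (Path d)} (hS : IsDet n S)
    (hA : MeasurableSet A) (x : Site d) (ω : Env d) {c : ℝ≥0∞}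
    (h : ∀ a ∈ S, c ≤ quenchedLaw (a n) ω A) :
    c * quenchedLaw x ω S ≤ quenchedLaw x ω (S ∩ shift n ⁻¹' A) := by
  have := hS.measure_le (μ := c • quenchedLaw x ω)
    (ν := (quenchedLaw x ω).restrict (shift n ⁻¹' A)) fun a ha => by
      rw [Measure.restrict_apply (measurableSet_cyl n a), quenchedLaw_cyl_inter_shift _ _ _ _ hA,
        mul_comm]
      exact mul_le_mul_left (h a ha) _
  rwa [Measure.restrict_apply hS.measurableSet] at this

theorem quenchedLaw_start (x : Site d) (ω : Env d) :
    ∀ᵐ X ∂(quenchedLaw x ω), X 0 = x := by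
  have e : {X : Path d | X 0 = x} = cyl 0 fun _ => x := by
    ext X
    simp [cyl]
  have h : quenchedLaw x ω {X : Path d | X 0 = x} = 1 := by
    rw [e, quenchedLaw_cyl]
    simp
  exact (mem_ae_iff_prob_eq_one (by rw [e]; exact measurableSet_cyl _ _)).2 h

/-- The law of the position at time `n`. -/
noncomputable def marginal (x : Site d) (ω : Env d) (n : ℕ) : Measure (Site d) :=
  (quenchedLaw x ω).map fun X => X n

theorem marginal_zero (x : Site d) (ω : Env d) : marginal x ω 0 = Measure.dirac x := by
  rw [marginal, Measure.map_congr (g := fun _ => x) (quenchedLaw_start x ω), Measure.map_const]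
  simp

theorem quenchedLaw_inter_step (x : Site d) (ω : Env d) (n : ℕ) (v w : Site d) :
    quenchedLaw x ω ({X | X n = v} ∩ {X | X (n + 1) = w}) =
      quenchedLaw x ω {X | X n = v} * ENNReal.ofReal (trans ω v w) := by
  have hm : MeasurableSet {X : Path d | X (n + 1) = w} :=
    measurableSet_coord (n + 1) (· = w)
  have hS : IsDet n {X : Path d | X n = v} := fun X X' h h' => by
    simpa [h' n le_rfl] using h
  have := hS.measure_congr (μ := (quenchedLaw x ω).restrict {X | X (n + 1) = w})
    (ν := ENNReal.ofReal (trans ω v w) • quenchedLaw x ω) fun a ha => by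
      have e : cyl n a ∩ {X | X (n + 1) = w} = cyl (n + 1) (Function.update a (n + 1) w) := by
        ext X
        simp only [cyl, Set.mem_inter_iff, Set.mem_ofPred_eq]
        constructor
        · rintro ⟨h1, h2⟩ i hi
          rcases hi.eq_or_lt with rfl | hi
          · simp [h2]
          · rw [Function.update_of_ne (by omega), h1 i (by omega)]
        · intro h
          refine ⟨fun i hi => ?_, ?_⟩
          · rw [h i (by omega), Function.update_of_ne (by omega)]
          · rw [h (n + 1) le_rfl, Function.update_self]
      have ha' : a n = v := ha
      rw [Measure.restrict_apply (measurableSet_cyl n a), e, Measure.smul_apply, smul_eq_mul,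
        quenchedLaw_cyl, quenchedLaw_cyl, Finset.prod_range_succ, Function.update_self,
        Function.update_of_ne (by omega : n ≠ n + 1), Function.update_of_ne (by omega : 0 ≠ n + 1),
        ha', mul_comm (ENNReal.ofReal _), mul_assoc]
      congr 2
      refine Finset.prod_congr rfl fun i hi => ?_
      rw [Finset.mem_range] at hi
      rw [Function.update_of_ne (by omega), Function.update_of_ne (by omega)]
  rw [Measure.restrict_apply hS.measurableSet, Measure.smul_apply, smul_eq_mul] at this
  rw [this, mul_comm]

/-- One step of the walk, for expectations. -/
theorem lintegral_step (x : Site d) (ω : Env d) (n : ℕ) (F : Site d → Site d → ℝ≥0∞) :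
    ∫⁻ X, F (X n) (X (n + 1)) ∂(quenchedLaw x ω) =
      ∫⁻ v, ∑' z, ENNReal.ofReal ((ω v).1 z) * F v (v + z) ∂(marginal x ω n) := by
  have hf : Measurable fun X : Path d => (X n, X (n + 1)) :=
    (measurable_coord n).prodMk (measurable_coord (n + 1))
  have h1 : ∫⁻ X, F (X n) (X (n + 1)) ∂(quenchedLaw x ω) =
      ∫⁻ e : Site d × Site d, F e.1 e.2 ∂((quenchedLaw x ω).map fun X => (X n, X (n + 1))) :=
    (lintegral_map (f := fun e : Site d × Site d => F e.1 e.2) (measurable_of_countable _) hf).symm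
  rw [h1, lintegral_countable', lintegral_countable', ENNReal.tsum_prod']
  congr 1
  funext v
  rw [← (Equiv.addLeft v).tsum_eq, ← ENNReal.tsum_mul_right]
  congr 1
  funext z
  have e : (fun X : Path d => (X n, X (n + 1))) ⁻¹' {(v, v + z)} =
      {X | X n = v} ∩ {X | X (n + 1) = v + z} := by
    ext X
    simp
  rw [Equiv.coe_addLeft, Measure.map_apply hf (measurableSet_singleton _), e,
    quenchedLaw_inter_step, marginal,
    Measure.map_apply (measurable_coord n) (measurableSet_singleton _)]
  simp only [trans, add_sub_cancel_left]
  rw [mul_comm, mul_comm (quenchedLaw x ω _), mul_right_comm]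
  rfl

theorem lintegral_marginal_succ (x : Site d) (ω : Env d) (n : ℕ) (F : Site d → ℝ≥0∞) :
    ∫⁻ w, F w ∂(marginal x ω (n + 1)) =
      ∫⁻ v, ∑' z, ENNReal.ofReal ((ω v).1 z) * F (v + z) ∂(marginal x ω n) := by
  rw [marginal, lintegral_map (measurable_of_countable F) (measurable_coord _)]
  exact lintegral_step x ω n fun _ w => F w

/-- Paths that stay at levels at least `l`. -/
def staysAbove (u : Site d) (l : ℤ) : Set (Path d) := {X | ∀ n, l ≤ level u (X n)}

/-- On the event that the walk stays at levels at least `l`, its law only depends on the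
environment at these levels. -/
theorem restrict_staysAbove_congr (x : Site d) {ω ω' : Env d} {l : ℤ}
    (h : ∀ z, l ≤ level u z → ω z = ω' z) :
    (quenchedLaw x ω).restrict (staysAbove u l) = (quenchedLaw x ω').restrict (staysAbove u l) := by
  refine pathMeasure_ext fun n a => ?_
  rw [Measure.restrict_apply (measurableSet_cyl n a), Measure.restrict_apply (measurableSet_cyl n a)]
  -- Staying above l is the decreasing limit of its finite-time versions. On each of these, every
  -- transition leaves from a site at level at least l, where the two environments agree.
  let H : ℕ → Set (Path d) := fun k => cyl n a ∩ {X | ∀ i ≤ n + k, l ≤ level u (X i)}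
  have hdet : ∀ k, IsDet (n + k) (H k) := by
    intro k X X' hX hX'
    refine ⟨fun i hi => ?_, fun i hi => ?_⟩
    · rw [hX' i (by omega)]
      exact hX.1 i hi
    · rw [hX' i hi]
      exact hX.2 i hi
  have e : cyl n a ∩ staysAbove u l = ⋂ k, H k := by
    ext X
    simp only [H, Set.mem_inter_iff, Set.mem_iInter, staysAbove, Set.mem_ofPred_eq]
    constructor
    · exact fun hX k => ⟨hX.1, fun i _ => hX.2 i⟩
    · exact fun hX => ⟨(hX 0).1, fun i => (hX i).2 i (by omega)⟩
  have hanti : Antitone H := fun k k' hk X hX => ⟨hX.1, fun i hi => hX.2 i (by omega)⟩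
  have hlim (ω : Env d) : Filter.Tendsto (fun k => quenchedLaw x ω (H k)) Filter.atTop
      (nhds (quenchedLaw x ω (⋂ k, H k))) :=
    tendsto_measure_iInter_atTop (fun k => (hdet k).measurableSet.nullMeasurableSet) hanti
      ⟨0, measure_ne_top _ _⟩
  rw [e]
  refine tendsto_nhds_unique (hlim ω) ?_
  have : (fun k => quenchedLaw x ω (H k)) = fun k => quenchedLaw x ω' (H k) := by
    funext k
    refine (hdet k).measure_congr fun b hb => ?_
    rw [quenchedLaw_cyl, quenchedLaw_cyl]
    congr 1
    refine Finset.prod_congr rfl fun i hi => ?_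
    rw [Finset.mem_range] at hi
    rw [trans, trans, h _ (hb.2 i hi.le)]
  rw [this]
  exact hlim ω'

/-- Before its last time, the law of a path segment only depends on the environment at the levels
it visits. -/
theorem quenchedLaw_cyl_congr (x : Site d) {ω ω' : Env d} {n : ℕ} {a : Path d}
    (h : ∀ i < n, ω (a i) = ω' (a i)) :
    quenchedLaw x ω (cyl n a) = quenchedLaw x ω' (cyl n a) := by
  rw [quenchedLaw_cyl, quenchedLaw_cyl]
  congr 1
  refine Finset.prod_congr rfl fun i hi => ?_
  rw [trans, trans, h i (Finset.mem_range.1 hi)]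

/-- The environment seen from the site `c`. -/
def shiftEnv (c : Site d) (ω : Env d) : Env d := fun x => ω (x + c)

/-- Translation of a path. -/
def translate (c : Site d) (X : Path d) : Path d := fun n => X n + c

theorem measurable_translate (c : Site d) : Measurable (translate c) :=
  measurable_pi_lambda _ fun n => (measurable_coord n).add_const c

theorem quenchedLaw_add (x c : Site d) (ω : Env d) :
    quenchedLaw (x + c) ω = (quenchedLaw x (shiftEnv c ω)).map (translate c) := by
  refine pathMeasure_ext fun n a => ?_
  rw [Measure.map_apply (measurable_translate c) (measurableSet_cyl n a)]
  have e : translate c ⁻¹' cyl n a = cyl n (translate (-c) a) := by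
    ext X
    simp only [cyl, translate, Set.mem_preimage, Set.mem_ofPred_eq]
    refine forall₂_congr fun i _ => ?_
    rw [← sub_eq_add_neg, eq_sub_iff_add_eq]
  rw [e, quenchedLaw_cyl, quenchedLaw_cyl]
  congr 1
  · simp only [translate, ← sub_eq_add_neg, sub_eq_iff_eq_add]
  · refine Finset.prod_congr rfl fun i _ => ?_
    simp [trans, shiftEnv, translate]

/-! ### Exponential estimates for one step -/

/-- The left side is (e^y - 1)² e^(-y), and e^y - 1 ≤ y e^y; negative y follow by symmetry. It
serves as a second-order remainder that an exponential moment controls. -/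
theorem exp_add_exp_neg_sub_two_le (y : ℝ) :
    Real.exp y + Real.exp (-y) - 2 ≤ y ^ 2 * Real.exp (3 * |y|) := by
  wlog hy : 0 ≤ y generalizing y
  · have := this (-y) (by linarith)
    rwa [neg_neg, add_comm (Real.exp (-y)), neg_sq, abs_neg] at this
  have hb : 0 < Real.exp y := Real.exp_pos y
  have hinv : Real.exp y * Real.exp (-y) = 1 := by rw [← Real.exp_add, add_neg_cancel, Real.exp_zero]
  have h1 : Real.exp y - 1 ≤ y * Real.exp y := by
    have := mul_le_mul_of_nonneg_left (Real.add_one_le_exp (-y)) hb.le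
    rw [hinv] at this
    linarith
  have h0 : 0 ≤ Real.exp y - 1 := by linarith [Real.add_one_le_exp y]
  have h2 : (Real.exp y - 1) ^ 2 ≤ (y * Real.exp y) ^ 2 := pow_le_pow_left₀ h0 h1 2
  have h3 : Real.exp y + Real.exp (-y) - 2 = (Real.exp y - 1) ^ 2 * Real.exp (-y) := by
    linear_combination (2 - Real.exp y) * hinv
  have h4 : Real.exp (-y) ≤ Real.exp y := Real.exp_le_exp.2 (by linarith)
  rw [h3, abs_of_nonneg hy]
  calc (Real.exp y - 1) ^ 2 * Real.exp (-y) ≤ (y * Real.exp y) ^ 2 * Real.exp y :=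
        mul_le_mul h2 h4 (Real.exp_pos _).le (sq_nonneg _)
    _ = y ^ 2 * Real.exp (3 * y) := by
        rw [show 3 * y = y + y + y by ring, Real.exp_add, Real.exp_add]
        ring

theorem exp_neg_le (y : ℝ) : Real.exp (-y) ≤ 1 - y + (Real.exp y + Real.exp (-y) - 2) := by
  linarith [Real.add_one_le_exp y]

/-- The decreasing logistic function. -/
noncomputable def logistic (t : ℝ) : ℝ := 1 / (1 + Real.exp t)

theorem logistic_nonneg (t : ℝ) : 0 ≤ logistic t := by
  unfold logistic; positivity

theorem logistic_le_one (t : ℝ) : logistic t ≤ 1 := by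
  unfold logistic
  rw [div_le_one (by positivity)]
  linarith [Real.exp_pos t]

/-- A first-order expansion whose remainder carries the same factor as the derivative, so that a
small drift beats the remainder uniformly in t. With a = e^t and b = e^y, replacing -y by the
smaller 1 - b leaves the explicit gap a(1 - b)² / ((1 + a)² b (1 + ab)). -/
theorem logistic_add_le (t y : ℝ) : logistic (t + y) ≤ logistic t +
    Real.exp t / (1 + Real.exp t) ^ 2 * (-y + (Real.exp y + Real.exp (-y) - 2)) := by
  unfold logistic
  rw [Real.exp_add]
  set a := Real.exp t
  set b := Real.exp y
  have ha : 0 < a := Real.exp_pos t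
  have hb : 0 < b := Real.exp_pos y
  have hinv : Real.exp (-y) = 1 / b := by rw [Real.exp_neg, one_div]
  rw [hinv]
  have hy : y ≤ b - 1 := by linarith [Real.add_one_le_exp y]
  have h1 : a / (1 + a) ^ 2 * ((1 - b) + (b + 1 / b - 2)) ≤
      a / (1 + a) ^ 2 * (-y + (b + 1 / b - 2)) := by
    apply mul_le_mul_of_nonneg_left _ (by positivity)
    linarith
  refine le_trans ?_ (add_le_add_right h1 _)
  have h2 : 1 / (1 + a) + a / (1 + a) ^ 2 * ((1 - b) + (b + 1 / b - 2)) - 1 / (1 + a * b) =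
      a * (1 - b) ^ 2 / ((1 + a) ^ 2 * b * (1 + a * b)) := by
    field_simp
    ring
  have h3 : 0 ≤ a * (1 - b) ^ 2 / ((1 + a) ^ 2 * b * (1 + a * b)) := by positivity
  linarith

/-- Uniform one-step estimates for a step law: contraction of an exponential, a Lyapunov
function, the probability of stepping one level up, and an exponential moment. -/
structure IsGoodLaw (u : Site d) (lam : ℝ) (r c κ C : ℝ≥0∞) (p : StepLaw d) : Prop where
  contract : ∑' z, ENNReal.ofReal (p.1 z) * ENNReal.ofReal (Real.exp (-(lam * level u z))) ≤ r
  drift : ∀ t : ℤ, ∑' z, ENNReal.ofReal (p.1 z) *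
      ENNReal.ofReal (logistic (lam * (t + level u z : ℤ))) +
      c * (if t ≤ 0 then ENNReal.ofReal (Real.exp (lam * t)) else 0) ≤
        ENNReal.ofReal (logistic (lam * t))
  up : κ ≤ ∑' z, ENNReal.ofReal (p.1 z) * (if level u z = 1 then 1 else 0)
  moment : ∑' z, ENNReal.ofReal (p.1 z) * ENNReal.ofReal (Real.exp (lam * level u z)) ≤ C

/-- All sites have good step laws, with the same constants. -/
def IsGoodEnv (u : Site d) (ω : Env d) : Prop :=
  ∃ (lam : ℝ) (r c κ C : ℝ≥0∞), 0 < lam ∧ r < 1 ∧ c ≠ 0 ∧ κ ≠ 0 ∧ C ≠ ⊤ ∧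
    ∀ x, IsGoodLaw u lam r c κ C (ω x)

theorem tsum_ofReal_mul_le {ι : Type*} {p F G : ι → ℝ} {v w : ℝ} (hp : ∀ z, 0 ≤ p z)
    (hF : ∀ z, 0 ≤ F z) (hFG : ∀ z, F z ≤ G z) (h : HasSum (fun z => p z * G z) v) (hv : v ≤ w) :
    ∑' z, ENNReal.ofReal (p z) * ENNReal.ofReal (F z) ≤ ENNReal.ofReal w := by
  calc ∑' z, ENNReal.ofReal (p z) * ENNReal.ofReal (F z)
      ≤ ∑' z, ENNReal.ofReal (p z * G z) := ENNReal.tsum_le_tsum fun z => by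
        rw [← ENNReal.ofReal_mul (hp z)]
        exact ENNReal.ofReal_le_ofReal (mul_le_mul_of_nonneg_left (hFG z) (hp z))
    _ = ENNReal.ofReal v := by
        rw [← ENNReal.ofReal_tsum_of_nonneg
          (fun z => mul_nonneg (hp z) ((hF z).trans (hFG z))) h.summable, h.tsum_eq]
    _ ≤ ENNReal.ofReal w := ENNReal.ofReal_le_ofReal hv

theorem abs_level_le (u z : Site d) : |(level u z : ℝ)| ≤ siteNorm u * siteNorm z := by
  have h : (level u z : ℝ) = ∑ i, (z i : ℝ) * (u i : ℝ) := by
    simp [level, dotProduct]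
  have h2 := Finset.sum_mul_sq_le_sq_mul_sq Finset.univ (fun i => (z i : ℝ)) fun i => (u i : ℝ)
  rw [← h] at h2
  rw [siteNorm, siteNorm, ← Real.sqrt_mul (by positivity)]
  refine Real.abs_le_sqrt ?_
  linarith [mul_comm (∑ i, (z i : ℝ) ^ 2) (∑ i, (u i : ℝ) ^ 2)]

/-- The one-step estimates follow from a drift and an exponential moment. -/
theorem isGoodLaw_of_moments {δ s B κ lam : ℝ} (hδ : 0 < δ) (hs : 0 < s) (hlam : 0 < lam)
    (hlams : 6 * lam ≤ s) (hlamB : 8 * lam * B ≤ s ^ 2 * (δ / 2)) {p : StepLaw d}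
    (hsum : Summable fun z => (level u z : ℝ) * p.1 z) (hdrift : δ ≤ ∑' z, (level u z : ℝ) * p.1 z)
    (hexp : Summable fun z => p.1 z * Real.exp (s * |(level u z : ℝ)|))
    (hB : ∑' z, p.1 z * Real.exp (s * |(level u z : ℝ)|) ≤ B)
    (hκ : κ ≤ ∑' z : {z : Site d // level u z = 1}, p.1 z) :
    IsGoodLaw u lam (ENNReal.ofReal (1 - lam * (δ / 2))) (ENNReal.ofReal (lam * δ / 8))
      (ENNReal.ofReal κ) (ENNReal.ofReal B) p := by
  have hp : ∀ z, 0 ≤ p.1 z := p.2.1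
  -- Half of the exponent s|y| absorbs exp(3λ|y|), since 6λ ≤ s; the other half absorbs the square,
  -- by v²/2 ≤ e^v. The remainder is thus of order λ².
  have hquad : ∀ y : ℝ, (lam * y) ^ 2 * Real.exp (3 * |lam * y|) ≤
      8 * lam ^ 2 / s ^ 2 * Real.exp (s * |y|) := by
    intro y
    have h1 : (s * |y| / 2) ^ 2 / 2 ≤ Real.exp (s * |y| / 2) := by
      have := Real.quadratic_le_exp_of_nonneg (x := s * |y| / 2) (by positivity)
      have h0 : 0 ≤ s * |y| / 2 := by positivity
      linarith
    have h2 : Real.exp (3 * |lam * y|) ≤ Real.exp (s * |y| / 2) := by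
      rw [Real.exp_le_exp, abs_mul, abs_of_pos hlam]
      nlinarith [abs_nonneg y]
    have h3 : (lam * y) ^ 2 = 8 * lam ^ 2 / s ^ 2 * ((s * |y| / 2) ^ 2 / 2) := by
      field_simp
      rw [sq_abs]
      ring
    calc (lam * y) ^ 2 * Real.exp (3 * |lam * y|)
        ≤ 8 * lam ^ 2 / s ^ 2 * Real.exp (s * |y| / 2) * Real.exp (s * |y| / 2) := by
          rw [h3]
          gcongr
      _ = 8 * lam ^ 2 / s ^ 2 * Real.exp (s * |y|) := by
          rw [mul_assoc, ← Real.exp_add]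
          congr 2
          ring
  have hW : ∀ y : ℝ, Real.exp (lam * y) + Real.exp (-(lam * y)) - 2 ≤
      8 * lam ^ 2 / s ^ 2 * Real.exp (s * |y|) :=
    fun y => (exp_add_exp_neg_sub_two_le _).trans (hquad y)
  set E := ∑' z, p.1 z * Real.exp (s * |(level u z : ℝ)|)
  set D := ∑' z, (level u z : ℝ) * p.1 z
  -- The smallness of λ lets the second-order term consume at most half of the drift λδ.
  have hKE : 8 * lam ^ 2 / s ^ 2 * E ≤ lam * (δ / 2) := by
    have h1 : 8 * lam ^ 2 / s ^ 2 * E ≤ 8 * lam ^ 2 / s ^ 2 * B := by gcongr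
    refine h1.trans ?_
    rw [div_mul_eq_mul_div, div_le_iff₀ (by positivity)]
    nlinarith
  -- One affine majorant for both estimates: α = β = 1 gives the contraction, while the value and
  -- the negated slope of `logistic` at λt give the Lyapunov bound.
  have hsumG : ∀ α β : ℝ, HasSum (fun z => p.1 z * (α + β * (-(lam * (level u z : ℝ)) +
      8 * lam ^ 2 / s ^ 2 * Real.exp (s * |(level u z : ℝ)|))))
      (α * 1 + (β * (-lam)) * D + (β * (8 * lam ^ 2 / s ^ 2)) * E) := by
    intro α β
    have := ((p.2.2.mul_left α).add (hsum.hasSum.mul_left (β * (-lam)))).add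
      (hexp.hasSum.mul_left (β * (8 * lam ^ 2 / s ^ 2)))
    refine this.congr_fun ?_
    intro z
    ring
  have hDD : lam * δ ≤ lam * D := mul_le_mul_of_nonneg_left hdrift hlam.le
  refine ⟨?_, fun t => ?_, ?_, ?_⟩
  · refine tsum_ofReal_mul_le hp (fun z => (Real.exp_pos _).le) (fun z => ?_) (hsumG 1 1) ?_
    · have h1 := exp_neg_le (lam * level u z)
      have h2 := hW (level u z)
      linarith
    · linarith
  · set a := Real.exp (lam * t) with ha_def
    have ha : 0 < a := Real.exp_pos _
    have hβ : 0 ≤ a / (1 + a) ^ 2 := by positivity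
    have key : ∑' z, ENNReal.ofReal (p.1 z) *
        ENNReal.ofReal (logistic (lam * (t + level u z : ℤ))) ≤
        ENNReal.ofReal (logistic (lam * t) - a / (1 + a) ^ 2 * (lam * (δ / 2))) := by
      refine tsum_ofReal_mul_le hp (fun z => logistic_nonneg _) (fun z => ?_)
        (hsumG (logistic (lam * t)) (a / (1 + a) ^ 2)) ?_
      · push_cast
        rw [mul_add]
        refine (logistic_add_le _ _).trans ?_
        rw [← ha_def]
        gcongr
        exact hW _
      · have : a / (1 + a) ^ 2 * (-lam * D + 8 * lam ^ 2 / s ^ 2 * E) ≤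
            a / (1 + a) ^ 2 * (-(lam * (δ / 2))) := mul_le_mul_of_nonneg_left (by linarith) hβ
        linarith
    refine (add_le_add_left key _).trans ?_
    split_ifs with ht
    · rw [← ENNReal.ofReal_mul (by positivity)]
      have ha1 : a ≤ 1 := by
        rw [ha_def, Real.exp_le_one_iff]
        have : (t : ℝ) ≤ 0 := by exact_mod_cast ht
        nlinarith
      -- For t ≤ 0 one has a ≤ 1, so (1 + a)² ≤ 4 and the gain is at least (λδ/8) a; this is the
      -- origin of the constant c.
      have h4 : lam * δ / 8 * a ≤ a / (1 + a) ^ 2 * (lam * (δ / 2)) := by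
        rw [div_mul_eq_mul_div a, le_div_iff₀ (by positivity)]
        have h4 : (1 + a) ^ 2 ≤ 4 := by nlinarith
        have h5 : 0 ≤ lam * δ / 8 * a := by positivity
        linarith [mul_le_mul_of_nonneg_left h4 h5]
      -- `ENNReal.ofReal` truncates at 0, so the real inequality transfers only if the decreased
      -- value is nonnegative. It is, being an upper bound for a mean of nonnegative terms.
      have h5 : a / (1 + a) ^ 2 * (lam * (δ / 2)) ≤ logistic (lam * t) := by
        by_contra! hlt
        have h0 := hsumG (logistic (lam * t)) (a / (1 + a) ^ 2)
        have h6 : 0 ≤ logistic (lam * t) * 1 + a / (1 + a) ^ 2 * (-lam) * D +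
            a / (1 + a) ^ 2 * (8 * lam ^ 2 / s ^ 2) * E := by
          refine h0.nonneg fun z => mul_nonneg (hp z) ?_
          refine (logistic_nonneg (lam * t + lam * level u z)).trans
            ((logistic_add_le _ _).trans ?_)
          rw [← ha_def]
          gcongr
          exact hW _
        have : a / (1 + a) ^ 2 * (-lam * D + 8 * lam ^ 2 / s ^ 2 * E) ≤
            a / (1 + a) ^ 2 * (-(lam * (δ / 2))) := mul_le_mul_of_nonneg_left (by linarith) hβ
        linarith
      rw [← ENNReal.ofReal_add (by linarith) (by positivity)]
      exact ENNReal.ofReal_le_ofReal (by linarith)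
    · rw [mul_zero, add_zero]
      refine ENNReal.ofReal_le_ofReal ?_
      have : 0 ≤ a / (1 + a) ^ 2 * (lam * (δ / 2)) := by positivity
      linarith
  · refine (ENNReal.ofReal_le_ofReal hκ).trans ?_
    rw [ENNReal.ofReal_tsum_of_nonneg (f := fun z : {z : Site d // level u z = 1} => p.1 z)
      (fun z => hp z) (p.2.2.summable.subtype {z : Site d | level u z = 1})]
    refine (tsum_subtype {z : Site d | level u z = 1}
      fun z => ENNReal.ofReal (p.1 z)).le.trans (ENNReal.tsum_le_tsum fun z => ?_)
    by_cases hz : level u z = 1 <;> simp [hz]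
  · refine tsum_ofReal_mul_le hp (fun z => (Real.exp_pos _).le) (fun z => ?_) hexp.hasSum hB
    rw [Real.exp_le_exp]
    have h1 := le_abs_self (level u z : ℝ)
    have h2 := abs_nonneg (level u z : ℝ)
    nlinarith

/-- The hypotheses provide constants for which the step law at the origin is almost surely good. -/
theorem exists_isGoodLaw {P : Measure (Env d)} (hN : HypN P u)
    (hM : HypM P) (hR : HypR P u) :
    ∃ (lam : ℝ) (r c κ C : ℝ≥0∞), 0 < lam ∧ r < 1 ∧ c ≠ 0 ∧ κ ≠ 0 ∧ C ≠ ⊤ ∧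
      ∀ᵐ ω ∂P, IsGoodLaw u lam r c κ C (ω 0) := by
  obtain ⟨δ, hδ, hN⟩ := hN
  obtain ⟨M, s₀, hM0, hs₀, hM⟩ := hM
  obtain ⟨⟨κ, hκ0, hκ⟩, -, -⟩ := hR
  set U := siteNorm u + 1
  have hU : 0 < U := by
    have : 0 ≤ siteNorm u := Real.sqrt_nonneg _
    positivity
  set s := s₀ / U with hs_def
  have hs : 0 < s := by positivity
  set B := Real.exp (s₀ * M)
  have hB0 : 0 < B := Real.exp_pos _
  -- The two entries are the two smallness conditions of `isGoodLaw_of_moments`.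
  set lam := min (s / 6) (s ^ 2 * (δ / 2) / (8 * B))
  have hlam : 0 < lam := lt_min (by positivity) (by positivity)
  have h1 : 6 * lam ≤ s := by
    have : lam ≤ s / 6 := min_le_left _ _
    linarith
  have h2 : 8 * lam * B ≤ s ^ 2 * (δ / 2) := by
    have : lam ≤ s ^ 2 * (δ / 2) / (8 * B) := min_le_right _ _
    rw [le_div_iff₀ (by positivity)] at this
    linarith
  refine ⟨lam, ENNReal.ofReal (1 - lam * (δ / 2)), ENNReal.ofReal (lam * δ / 8),
    ENNReal.ofReal κ, ENNReal.ofReal B, hlam, ?_, ?_, ?_, ENNReal.ofReal_ne_top, ?_⟩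
  rotate_left 3
  · filter_upwards [hN, hM, hκ] with ω h3 h4 h5
    simp only [trans, sub_zero] at h3 h4 h5
    have hp : ∀ z, 0 ≤ (ω 0).1 z := (ω 0).2.1
    have hle : ∀ z, (ω 0).1 z * Real.exp (s * |(level u z : ℝ)|) ≤
        Real.exp (s₀ * siteNorm z) * (ω 0).1 z := by
      intro z
      rw [mul_comm]
      refine mul_le_mul_of_nonneg_right (Real.exp_le_exp.2 ?_) (hp z)
      have h0 : 0 ≤ siteNorm z := Real.sqrt_nonneg _
      calc s * |(level u z : ℝ)| ≤ s * (U * siteNorm z) := by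
            gcongr
            refine (abs_level_le u z).trans ?_
            gcongr
            linarith
        _ = s₀ * siteNorm z := by
            rw [hs_def]
            field_simp
    have hnn : ∀ z, 0 ≤ Real.exp (s₀ * siteNorm z) * (ω 0).1 z :=
      fun z => mul_nonneg (Real.exp_pos _).le (hp z)
    have hS : Summable fun z => Real.exp (s₀ * siteNorm z) * (ω 0).1 z := by
      have := ENNReal.summable_toReal (ne_top_of_le_ne_top ENNReal.ofReal_ne_top h4)
      simpa [ENNReal.toReal_ofReal (hnn _)] using this
    have hS' : ∑' z, Real.exp (s₀ * siteNorm z) * (ω 0).1 z ≤ B := by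
      rw [← ENNReal.ofReal_tsum_of_nonneg hnn hS] at h4
      exact (ENNReal.ofReal_le_ofReal_iff hB0.le).1 h4
    have hS2 := Summable.of_nonneg_of_le
      (fun z => mul_nonneg (hp z) (Real.exp_pos (s * |(level u z : ℝ)|)).le) hle hS
    exact isGoodLaw_of_moments hδ hs hlam h1 h2 h3.1 h3.2 hS2
      ((hS2.tsum_le_tsum hle hS).trans hS') h5
  · rw [← ENNReal.ofReal_one]
    exact (ENNReal.ofReal_lt_ofReal_iff one_pos).2 (by linarith [mul_pos hlam (half_pos hδ)])
  · rw [Ne, ENNReal.ofReal_eq_zero, not_le]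
    positivity
  · rwa [Ne, ENNReal.ofReal_eq_zero, not_le]

/-! ### Ballistic estimates for the walk in a good environment -/

theorem level_add (u x y : Site d) : level u (x + y) = level u x + level u y :=
  add_dotProduct x y u

theorem level_sub (u x y : Site d) : level u (x - y) = level u x - level u y :=
  sub_dotProduct x y u

theorem exists_mul_exp_neg_le {lam : ℝ} (hlam : 0 < lam) {K : ℝ≥0∞} (hK : K ≠ ⊤) :
    ∃ N : ℕ, K * ENNReal.ofReal (Real.exp (-(lam * N))) ≤ 1 / 2 := by
  have h1 : ENNReal.ofReal (Real.exp (-lam)) < 1 := by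
    rw [ENNReal.ofReal_lt_one, Real.exp_lt_one_iff]
    linarith
  have h2 := ENNReal.Tendsto.const_mul (ENNReal.tendsto_pow_atTop_nhds_zero_of_lt_one h1)
    (Or.inr hK)
  rw [mul_zero] at h2
  obtain ⟨N, hN⟩ := (h2.eventually_le_const (by simp : (0 : ℝ≥0∞) < 1 / 2)).exists
  refine ⟨N, ?_⟩
  have e : -(lam * N) = N * -lam := by ring
  rwa [e, Real.exp_nat_mul, ENNReal.ofReal_pow (Real.exp_pos _).le]

section GoodEnv

variable {lam : ℝ} {r c κ C : ℝ≥0∞} {ω : Env d}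

theorem lintegral_exp_neg_level_le (hω : ∀ x, IsGoodLaw u lam r c κ C (ω x)) (x : Site d) (n : ℕ) :
    ∫⁻ w, ENNReal.ofReal (Real.exp (-(lam * level u w))) ∂(marginal x ω n) ≤
      r ^ n * ENNReal.ofReal (Real.exp (-(lam * level u x))) := by
  induction n with
  | zero => rw [marginal_zero, lintegral_dirac, pow_zero, one_mul]
  | succ n ih =>
    rw [lintegral_marginal_succ]
    calc _ ≤ ∫⁻ v, r * ENNReal.ofReal (Real.exp (-(lam * level u v))) ∂(marginal x ω n) := by
          refine lintegral_mono fun v => ?_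
          have e : ∀ z, ENNReal.ofReal ((ω v).1 z) *
              ENNReal.ofReal (Real.exp (-(lam * level u (v + z)))) =
              ENNReal.ofReal ((ω v).1 z) * ENNReal.ofReal (Real.exp (-(lam * level u z))) *
                ENNReal.ofReal (Real.exp (-(lam * level u v))) := by
            intro z
            rw [mul_assoc, ← ENNReal.ofReal_mul (Real.exp_pos _).le, ← Real.exp_add, level_add]
            congr 3
            push_cast
            ring
          simp_rw [e, ENNReal.tsum_mul_right]
          gcongr
          exact (hω v).contract
      _ = r * ∫⁻ v, ENNReal.ofReal (Real.exp (-(lam * level u v))) ∂(marginal x ω n) :=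
          lintegral_const_mul _ (measurable_of_countable _)
      _ ≤ r * (r ^ n * ENNReal.ofReal (Real.exp (-(lam * level u x)))) := by gcongr
      _ = _ := by rw [← mul_assoc, ← pow_succ']

theorem quenchedLaw_eq_marginal (x : Site d) (ω : Env d) (n : ℕ) (p : Site d → Prop) :
    quenchedLaw x ω {X | p (X n)} = marginal x ω n {v | p v} := by
  rw [marginal, Measure.map_apply (measurable_coord n) (Set.to_countable _).measurableSet]
  rfl

/-- Markov's inequality for exp(-λ X·û), whose mean shrinks by the factor r at each step.
Summability in n gives both the escape of the level to infinity and the control of deep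
backtracking. -/
theorem quenchedLaw_level_le (hlam : 0 < lam) (hω : ∀ x, IsGoodLaw u lam r c κ C (ω x))
    (x : Site d) (n : ℕ) (l : ℤ) : quenchedLaw x ω {X | level u (X n) ≤ l} ≤
      r ^ n * ENNReal.ofReal (Real.exp (-(lam * (level u x - l)))) := by
  rw [quenchedLaw_eq_marginal x ω n (level u · ≤ l), ← setLIntegral_one]
  calc ∫⁻ v in {v | level u v ≤ l}, 1 ∂(marginal x ω n)
      ≤ ∫⁻ v in {v | level u v ≤ l}, ENNReal.ofReal (Real.exp (lam * l)) *
          ENNReal.ofReal (Real.exp (-(lam * level u v))) ∂(marginal x ω n) := by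
        refine setLIntegral_mono (measurable_of_countable _) fun v hv => ?_
        rw [← ENNReal.ofReal_mul (Real.exp_pos _).le, ← Real.exp_add, ENNReal.one_le_ofReal,
          Real.one_le_exp_iff, ← sub_eq_add_neg, ← mul_sub]
        have : (level u v : ℝ) ≤ l := by exact_mod_cast hv
        exact mul_nonneg hlam.le (by linarith)
    _ ≤ ∫⁻ v, ENNReal.ofReal (Real.exp (lam * l)) *
          ENNReal.ofReal (Real.exp (-(lam * level u v))) ∂(marginal x ω n) :=
        setLIntegral_le_lintegral _ _
    _ = ENNReal.ofReal (Real.exp (lam * l)) *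
          ∫⁻ v, ENNReal.ofReal (Real.exp (-(lam * level u v))) ∂(marginal x ω n) :=
        lintegral_const_mul _ (measurable_of_countable _)
    _ ≤ ENNReal.ofReal (Real.exp (lam * l)) *
          (r ^ n * ENNReal.ofReal (Real.exp (-(lam * level u x)))) := by
        gcongr
        exact lintegral_exp_neg_level_le hω x n
    _ = _ := by
        rw [mul_left_comm, ← ENNReal.ofReal_mul (Real.exp_pos _).le, ← Real.exp_add]
        congr 3
        ring

theorem ae_unbounded_of_isGoodLaw (hlam : 0 < lam) (hr : r < 1)
    (hω : ∀ x, IsGoodLaw u lam r c κ C (ω x)) (x : Site d) :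
    ∀ᵐ X ∂(quenchedLaw x ω), ∀ l : ℤ, ∃ n, l < level u (X n) := by
  rw [ae_all_iff]
  intro l
  rw [ae_iff]
  refine le_antisymm (ge_of_tendsto' (x := Filter.atTop)
    (f := fun n : ℕ => r ^ n * ENNReal.ofReal (Real.exp (-(lam * (level u x - l))))) ?_ fun n =>
      (measure_mono fun X hX => ?_).trans (quenchedLaw_level_le hlam hω x n l)) (zero_le)
  · have := ENNReal.Tendsto.mul_const (ENNReal.tendsto_pow_atTop_nhds_zero_of_lt_one hr)
      (Or.inr (ENNReal.ofReal_ne_top (r := Real.exp (-(lam * (level u x - l))))))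
    rwa [zero_mul] at this
  · simp only [Set.mem_ofPred_eq, not_exists, not_lt] at hX
    exact hX n

theorem quenchedLaw_step (x : Site d) (ω : Env d) (n : ℕ) (p : Site d → Site d → Prop)
    [∀ v w, Decidable (p v w)] :
    quenchedLaw x ω {X | p (X n) (X (n + 1))} =
      ∫⁻ v, ∑' z, ENNReal.ofReal ((ω v).1 z) * (if p v (v + z) then 1 else 0)
        ∂(marginal x ω n) := by
  have hm : MeasurableSet {X : Path d | p (X n) (X (n + 1))} :=
    ((measurable_coord n).prodMk (measurable_coord (n + 1)))
      (Set.to_countable {e : Site d × Site d | p e.1 e.2}).measurableSet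
  rw [← lintegral_step x ω n fun v w => if p v w then 1 else 0, ← lintegral_indicator_one hm]
  congr 1
  funext X
  simp [Set.indicator_apply]

/-- Paths whose level increases by one in the first step. -/
def stepsUp (u : Site d) : Set (Path d) := {X | level u (X 1) = level u (X 0) + 1}

theorem measurable_level_coord (u : Site d) (n : ℕ) : Measurable fun X : Path d => level u (X n) :=
  (measurable_of_countable (level u)).comp (measurable_coord n)

theorem measurableSet_stepsUp : MeasurableSet (stepsUp u) :=
  measurableSet_eq_fun (measurable_level_coord u 1) ((measurable_level_coord u 0).add_const 1)

theorem le_quenchedLaw_stepsUp (hω : ∀ x, IsGoodLaw u lam r c κ C (ω x)) (x : Site d) :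
    κ ≤ quenchedLaw x ω (stepsUp u) := by
  have h := quenchedLaw_step x ω 0 fun v w => level u w = level u v + 1
  rw [marginal_zero, lintegral_dirac] at h
  refine le_of_le_of_eq ?_ h.symm
  refine (hω x).up.trans_eq ?_
  congr 1
  funext z
  simp only [level_add, add_right_inj]

/-- Paths that start at level `l` and whose level increases by one in each of the first `n`
steps. -/
def climbs (u : Site d) (l : ℤ) (n : ℕ) : Set (Path d) := {X | ∀ i ≤ n, level u (X i) = l + i}

theorem isDet_climbs (l : ℤ) (n : ℕ) : IsDet n (climbs u l n) := fun X X' h h' i hi => by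
  rw [h' i hi]
  exact h i hi

theorem le_quenchedLaw_climbs (hω : ∀ x, IsGoodLaw u lam r c κ C (ω x)) (x : Site d) (n : ℕ) :
    κ ^ n ≤ quenchedLaw x ω (climbs u (level u x) n) := by
  induction n with
  | zero =>
    have : ∀ᵐ X ∂(quenchedLaw x ω), X ∈ climbs u (level u x) 0 := by
      filter_upwards [quenchedLaw_start x ω] with X hX i hi
      obtain rfl : i = 0 := by omega
      simp [hX]
    rw [pow_zero, (mem_ae_iff_prob_eq_one (isDet_climbs _ _).measurableSet).1 this]
  | succ n ih =>
    calc κ ^ (n + 1) = κ * κ ^ n := pow_succ' ..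
      _ ≤ κ * quenchedLaw x ω (climbs u (level u x) n) := by gcongr
      _ ≤ _ := (isDet_climbs (u := u) (level u x) n).le_quenchedLaw_inter_shift
          measurableSet_stepsUp x ω fun a _ => le_quenchedLaw_stepsUp hω (a n)
      _ ≤ quenchedLaw x ω (climbs u (level u x) (n + 1)) := measure_mono fun X hX i hi => by
        rcases hi.eq_or_lt with rfl | hi
        · have h1 := hX.1 n le_rfl
          have h2 : level u (X (1 + n)) = level u (X (0 + n)) + 1 := hX.2
          rw [zero_add, h1, add_comm 1 n] at h2
          rw [h2]
          push_cast
          ring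
        · exact hX.1 i (by omega)

theorem kappa_le_one (hω : ∀ x, IsGoodLaw u lam r c κ C (ω x)) : κ ≤ 1 := by
  simpa using (le_quenchedLaw_climbs hω 0 1).trans prob_le_one

/-- From any start, the chance of ever dropping by more than N levels is at most a geometric sum
times exp(-λN), hence at most 1/2 for large N. Climbing N unit steps first, at cost κ^N, makes such
drops harmless. -/
theorem exists_le_quenchedLaw_staysAbove (hlam : 0 < lam) (hr : r < 1) (hκ : κ ≠ 0)
    (hω : ∀ x, IsGoodLaw u lam r c κ C (ω x)) :
    ∃ η : ℝ≥0∞, η ≠ 0 ∧ ∀ x, η ≤ quenchedLaw x ω (staysAbove u (level u x)) := by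
  obtain ⟨N, hN⟩ := exists_mul_exp_neg_le hlam (K := (1 - r)⁻¹)
    (ENNReal.inv_ne_top.2 (tsub_pos_of_lt hr).ne')
  let A : Set (Path d) := {X | ∀ n, level u (X 0) - N ≤ level u (X n)}
  have hA : MeasurableSet A := by
    have : A = ⋂ n, {X : Path d | level u (X 0) - N ≤ level u (X n)} := by
      ext
      simp [A]
    rw [this]
    exact MeasurableSet.iInter fun n => measurableSet_le
      ((measurable_level_coord u 0).sub_const _) (measurable_level_coord u n)
  have hA2 : ∀ w, 1 / 2 ≤ quenchedLaw w ω A := by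
    intro w
    have h1 : quenchedLaw w ω Aᶜ ≤ 1 / 2 := by
      calc quenchedLaw w ω Aᶜ
          ≤ quenchedLaw w ω (⋃ n, {X | level u (X n) ≤ level u w - N}) := by
            refine measure_mono_ae ?_
            filter_upwards [quenchedLaw_start w ω] with X hX hXA
            have hXA' : ¬ ∀ n, level u (X 0) - N ≤ level u (X n) := hXA
            push Not at hXA'
            obtain ⟨n, hn⟩ := hXA'
            rw [hX] at hn
            exact Set.mem_iUnion.2 ⟨n, hn.le⟩
        _ ≤ ∑' n, r ^ n * ENNReal.ofReal (Real.exp (-(lam * N))) := by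
            refine (measure_iUnion_le _).trans (ENNReal.tsum_le_tsum fun n => ?_)
            refine (quenchedLaw_level_le hlam hω w n _).trans_eq ?_
            congr 4
            push_cast
            ring
        _ = (1 - r)⁻¹ * ENNReal.ofReal (Real.exp (-(lam * N))) := by
            rw [ENNReal.tsum_mul_right, ENNReal.tsum_geometric]
        _ ≤ 1 / 2 := hN
    have h2 := prob_add_prob_compl (μ := quenchedLaw w ω) hA
    by_contra! h3
    have : quenchedLaw w ω A + quenchedLaw w ω Aᶜ < 1 / 2 + 1 / 2 :=
      ENNReal.add_lt_add_of_lt_of_le (ne_top_of_le_ne_top (by simp) h1) h3 h1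
    rw [h2, ENNReal.add_halves] at this
    exact lt_irrefl _ this
  refine ⟨1 / 2 * κ ^ N, mul_ne_zero (by simp) (pow_ne_zero _ hκ), fun x => ?_⟩
  calc 1 / 2 * κ ^ N ≤ 1 / 2 * quenchedLaw x ω (climbs u (level u x) N) := by
        gcongr
        exact le_quenchedLaw_climbs hω x N
    _ ≤ quenchedLaw x ω (climbs u (level u x) N ∩ shift N ⁻¹' A) :=
        (isDet_climbs (u := u) (level u x) N).le_quenchedLaw_inter_shift hA x ω fun a _ => hA2 _
    _ ≤ quenchedLaw x ω (staysAbove u (level u x)) := measure_mono fun X hX n => by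
        rcases le_total n N with hn | hn
        · rw [hX.1 n hn]
          omega
        · have h1 := hX.2 (n - N)
          simp only [shift, zero_add, Nat.sub_add_cancel hn] at h1
          rw [hX.1 N le_rfl] at h1
          omega

/-- The weight `exp(λ t)` of nonpositive heights `t`. -/
noncomputable def heightWeight (lam : ℝ) (t : ℤ) : ℝ≥0∞ :=
  if t ≤ 0 then ENNReal.ofReal (Real.exp (lam * t)) else 0

/-- The mean of the logistic function of the height decreases at each step by at least c times the
mean weight. It starts at most at 1 and stays nonnegative, so the telescoped losses sum to at most
1. -/
theorem tsum_occupation_le (hω : ∀ x, IsGoodLaw u lam r c κ C (ω x)) (x : Site d) (k : ℤ) :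
    c * ∑' n, ∫⁻ v, heightWeight lam (level u v - k) ∂(marginal x ω n) ≤ 1 := by
  set G : ℕ → ℝ≥0∞ := fun n => ∫⁻ v, heightWeight lam (level u v - k) ∂(marginal x ω n) with hG
  set a : ℕ → ℝ≥0∞ := fun n =>
    ∫⁻ v, ENNReal.ofReal (logistic (lam * (level u v - k : ℤ))) ∂(marginal x ω n) with ha
  have hstep : ∀ n, a (n + 1) + c * G n ≤ a n := by
    intro n
    simp only [ha, hG]
    rw [lintegral_marginal_succ, ← lintegral_const_mul _ (measurable_of_countable _),
      ← lintegral_add_left (measurable_of_countable _)]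
    refine lintegral_mono fun v => ?_
    have := (hω v).drift (level u v - k)
    simp only [level_add, add_sub_right_comm]
    exact this
  have hsum : ∀ N, a N + ∑ n ∈ Finset.range N, c * G n ≤ a 0 := by
    intro N
    induction N with
    | zero => simp
    | succ N ih =>
      rw [Finset.sum_range_succ, add_comm (∑ n ∈ _, _), ← add_assoc]
      exact (add_le_add_left (hstep N) _).trans ih
  have ha0 : a 0 ≤ 1 := by
    simp only [ha]
    rw [marginal_zero, lintegral_dirac]
    exact ENNReal.ofReal_le_one.2 (logistic_le_one _)
  rw [← ENNReal.tsum_mul_left, ENNReal.tsum_eq_iSup_nat]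
  exact iSup_le fun N => (le_add_self.trans (hsum N)).trans ha0

/-- From height t = level - k < 0 the jump must exceed J - t, which by the exponential moment has
probability at most C exp(-λJ) exp(λt). The last factor is exactly the weight whose occupation sum
is bounded. -/
theorem quenchedLaw_overshoot_le (hlam : 0 < lam) (hω : ∀ x, IsGoodLaw u lam r c κ C (ω x))
    (x : Site d) (k : ℤ) (J n : ℕ) :
    quenchedLaw x ω {X | level u (X n) < k ∧ k + J < level u (X (n + 1))} ≤
      C * ENNReal.ofReal (Real.exp (-(lam * J))) *
        ∫⁻ v, heightWeight lam (level u v - k) ∂(marginal x ω n) := by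
  rw [quenchedLaw_step x ω n fun v w => level u v < k ∧ k + J < level u w,
    ← lintegral_const_mul _ (measurable_of_countable _)]
  refine lintegral_mono fun v => ?_
  by_cases hv : level u v < k
  · rw [heightWeight, if_pos (by omega)]
    calc ∑' z, ENNReal.ofReal ((ω v).1 z) *
          (if level u v < k ∧ k + J < level u (v + z) then 1 else 0)
        ≤ ∑' z, ENNReal.ofReal ((ω v).1 z) * ENNReal.ofReal (Real.exp (lam * level u z)) *
            (ENNReal.ofReal (Real.exp (-(lam * J))) *
              ENNReal.ofReal (Real.exp (lam * (level u v - k : ℤ)))) := by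
          refine ENNReal.tsum_le_tsum fun z => ?_
          rw [mul_assoc]
          gcongr
          split_ifs with h
          · rw [← ENNReal.ofReal_mul (Real.exp_pos _).le, ← ENNReal.ofReal_mul (Real.exp_pos _).le,
              ← Real.exp_add, ← Real.exp_add, ENNReal.one_le_ofReal, Real.one_le_exp_iff]
            have h2 := h.2
            rw [level_add] at h2
            have h3 : (k : ℝ) + J < level u v + level u z := by exact_mod_cast h2
            push_cast
            have : 0 ≤ lam * (level u z - J + level u v - k) := mul_nonneg hlam.le (by linarith)
            linarith
          · exact zero_le
      _ ≤ _ := by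
          rw [ENNReal.tsum_mul_right, mul_assoc]
          gcongr
          exact (hω v).moment
  · simp [hv]

/-- Paths that enter the levels at least `l` exactly at level `l`. -/
def ladder (u : Site d) (l : ℤ) : Set (Path d) :=
  {X | ∃ m, level u (X m) = l ∧ ∀ i < m, level u (X i) < l}

theorem measurableSet_ladder (u : Site d) (l : ℤ) : MeasurableSet (ladder u l) := by
  have : ladder u l = ⋃ m, ({X : Path d | level u (X m) = l} ∩
      ⋂ i, ⋂ (_ : i < m), {X : Path d | level u (X i) < l}) := by
    ext
    simp [ladder]
  rw [this]
  exact MeasurableSet.iUnion fun m => (measurableSet_coord m (level u · = l)).inter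
    (MeasurableSet.iInter fun i => MeasurableSet.iInter fun _ =>
      measurableSet_coord i (level u · < l))

/-- Aim at the window from k = l - J to l. Missing it at the first entry into levels at least k
requires a jump from below k to above l, and J is chosen so that the overshoots have total
probability at most 1/2. From the window at most J unit steps up enter level l exactly. -/
theorem exists_le_quenchedLaw_ladder (hlam : 0 < lam) (hr : r < 1) (hc : c ≠ 0) (hκ : κ ≠ 0)
    (hC : C ≠ ⊤) (hω : ∀ x, IsGoodLaw u lam r c κ C (ω x)) :
    ∃ η : ℝ≥0∞, η ≠ 0 ∧ ∃ J : ℕ, ∀ x l, level u x + J < l → η ≤ quenchedLaw x ω (ladder u l) := by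
  obtain ⟨J, hJ⟩ := exists_mul_exp_neg_le hlam (K := C * c⁻¹)
    (ENNReal.mul_ne_top hC (ENNReal.inv_ne_top.2 hc))
  refine ⟨κ ^ J * (1 / 2), mul_ne_zero (pow_ne_zero _ hκ) (by simp), J, fun x l hl => ?_⟩
  set k : ℤ := l - J with hk
  let E : ℕ → Set (Path d) := fun n =>
    {X | (∀ i < n, level u (X i) < k) ∧ k ≤ level u (X n) ∧ level u (X n) ≤ l}
  have hdet : ∀ n, IsDet n (E n) := by
    intro n X X' h h'
    refine ⟨fun i hi => ?_, ?_⟩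
    · rw [h' i hi.le]
      exact h.1 i hi
    · rw [h' n le_rfl]
      exact h.2
  have hdisj : ∀ m n X, X ∈ E m → X ∈ E n → m = n := by
    intro m n X hm hn
    by_contra hne
    rcases Nat.lt_or_gt_of_ne hne with h | h
    · exact (hn.1 m h).not_ge hm.2.1
    · exact (hm.1 n h).not_ge hn.2.1
  have hE : 1 / 2 ≤ ∑' n, quenchedLaw x ω (E n) := by
    have h1 : (1 : ℝ≥0∞) ≤ quenchedLaw x ω ((⋃ n, E n) ∪
        ⋃ n, {X | level u (X n) < k ∧ k + J < level u (X (n + 1))}) := by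
      rw [← measure_univ (μ := quenchedLaw x ω)]
      refine measure_mono_ae ?_
      filter_upwards [quenchedLaw_start x ω, ae_unbounded_of_isGoodLaw hlam hr hω x] with X h0 hX _
      classical
      have hex : ∃ n, k ≤ level u (X n) := (hX k).imp fun _ => le_of_lt
      have hmin : ∀ i < Nat.find hex, level u (X i) < k :=
        fun i hi => not_le.1 (Nat.find_min hex hi)
      have hspec := Nat.find_spec hex
      rcases le_or_gt (level u (X (Nat.find hex))) l with h | h
      · exact Or.inl (Set.mem_iUnion.2 ⟨_, hmin, hspec, h⟩)
      · refine Or.inr (Set.mem_iUnion.2 ⟨Nat.find hex - 1, ?_⟩)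
        -- The start lies below k because level x + J < l, so the first entry time has a predecessor
        -- from which the overshooting jump is made.
        have hpos : 0 < Nat.find hex := by
          rw [Nat.find_pos, h0]
          omega
        refine ⟨hmin _ (by omega), ?_⟩
        rw [Nat.sub_add_cancel hpos]
        omega
    have h2 : quenchedLaw x ω (⋃ n, {X | level u (X n) < k ∧ k + J < level u (X (n + 1))}) ≤
        1 / 2 := by
      have h3 : ∑' n, ∫⁻ v, heightWeight lam (level u v - k) ∂(marginal x ω n) ≤ c⁻¹ := by
        by_cases hct : c = ⊤
        · have := tsum_occupation_le hω x k
          rw [hct] at this ⊢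
          by_contra! h4
          rw [ENNReal.top_mul (by simpa using h4.ne')] at this
          simp at this
        · have := tsum_occupation_le hω x k
          rwa [mul_comm, ← ENNReal.le_div_iff_mul_le (Or.inl hc) (Or.inl hct), one_div] at this
      calc _ ≤ ∑' n, C * ENNReal.ofReal (Real.exp (-(lam * J))) *
            ∫⁻ v, heightWeight lam (level u v - k) ∂(marginal x ω n) :=
            (measure_iUnion_le _).trans (ENNReal.tsum_le_tsum fun n =>
              quenchedLaw_overshoot_le hlam hω x k J n)
        _ ≤ C * ENNReal.ofReal (Real.exp (-(lam * J))) * c⁻¹ := by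
            rw [ENNReal.tsum_mul_left]
            gcongr
        _ ≤ 1 / 2 := by rwa [mul_right_comm]
    by_contra! h3
    have : quenchedLaw x ω ((⋃ n, E n) ∪
        ⋃ n, {X | level u (X n) < k ∧ k + J < level u (X (n + 1))}) < 1 / 2 + 1 / 2 :=
      (measure_union_le _ _).trans_lt (ENNReal.add_lt_add_of_lt_of_le
        (ne_top_of_le_ne_top (by simp) h2) ((measure_iUnion_le _).trans_lt h3) h2)
    rw [ENNReal.add_halves] at this
    exact this.not_ge h1
  have hstart : ∀ v, k ≤ level u v → level u v ≤ l → κ ^ J ≤ quenchedLaw v ω (ladder u l) := by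
    intro v h1 h2
    obtain ⟨D, hD⟩ := Int.eq_ofNat_of_zero_le (sub_nonneg.2 h2)
    calc κ ^ J ≤ κ ^ D := pow_le_pow_right_of_le_one' (kappa_le_one hω) (by omega)
      _ ≤ _ := le_quenchedLaw_climbs hω v D
      _ ≤ quenchedLaw v ω (ladder u l) := measure_mono fun X hX => ⟨D, by rw [hX D le_rfl]; omega, fun i hi => by
          rw [hX i hi.le]
          omega⟩
  calc κ ^ J * (1 / 2) ≤ κ ^ J * ∑' n, quenchedLaw x ω (E n) := by gcongr
    _ = ∑' n, κ ^ J * quenchedLaw x ω (E n) := ENNReal.tsum_mul_left.symm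
    _ ≤ ∑' n, quenchedLaw x ω (E n ∩ shift n ⁻¹' ladder u l) :=
        ENNReal.tsum_le_tsum fun n => (hdet n).le_quenchedLaw_inter_shift
          (measurableSet_ladder u l) x ω fun a ha => hstart _ ha.2.1 ha.2.2
    _ = quenchedLaw x ω (⋃ n, E n ∩ shift n ⁻¹' ladder u l) := by
        refine (measure_iUnion (fun m n hmn => ?_) fun n => ?_).symm
        · exact Set.disjoint_left.2 fun X h1 h2 => hmn (hdisj m n X h1.1 h2.1)
        · exact (hdet n).measurableSet.inter (measurable_shift n (measurableSet_ladder u l))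
    _ ≤ _ := by
        refine measure_mono (Set.iUnion_subset fun n X hX => ?_)
        obtain ⟨m, h1, h2⟩ := hX.2
        refine ⟨m + n, h1, fun i hi => ?_⟩
        rcases lt_or_ge i n with h | h
        · have := hX.1.1 i h
          omega
        · have := h2 (i - n) (by omega)
          simpa [shift, h] using this

end GoodEnv

theorem IsGoodEnv.ae_unbounded {ω : Env d} (h : IsGoodEnv u ω) (x : Site d) :
    ∀ᵐ X ∂(quenchedLaw x ω), ∀ l : ℤ, ∃ n, l < level u (X n) := by
  obtain ⟨lam, r, c, κ, C, hlam, hr, -, -, -, hω⟩ := h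
  exact ae_unbounded_of_isGoodLaw hlam hr hω x

theorem IsGoodEnv.exists_le_staysAbove {ω : Env d} (h : IsGoodEnv u ω) :
    ∃ η : ℝ≥0∞, η ≠ 0 ∧ ∀ x, η ≤ quenchedLaw x ω (staysAbove u (level u x)) := by
  obtain ⟨lam, r, c, κ, C, hlam, hr, -, hκ, -, hω⟩ := h
  exact exists_le_quenchedLaw_staysAbove hlam hr hκ hω

theorem IsGoodEnv.exists_le_ladder {ω : Env d} (h : IsGoodEnv u ω) :
    ∃ η : ℝ≥0∞, η ≠ 0 ∧ ∃ J : ℕ, ∀ x l, level u x + J < l → η ≤ quenchedLaw x ω (ladder u l) := by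
  obtain ⟨lam, r, c, κ, C, hlam, hr, hc, hκ, hC, hω⟩ := h
  exact exists_le_quenchedLaw_ladder hlam hr hc hκ hC hω

/-! ### Two independent walks in fixed environments -/

/-- Two independent walks, in the environments `ω` and `ω'`. -/
noncomputable def quenchedPair (ω ω' : Env d) (x y : Site d) : Measure (Path d × Path d) :=
  (quenchedLaw x ω).prod (quenchedLaw y ω')

instance (ω ω' : Env d) (x y : Site d) : IsProbabilityMeasure (quenchedPair ω ω' x y) := by
  unfold quenchedPair; infer_instance

/-- The shift `θ^{m,n}` of a pair of paths. -/
def shiftPair (m n : ℕ) : Path d × Path d → Path d × Path d := Prod.map (shift m) (shift n)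

theorem measurable_shiftPair (m n : ℕ) : Measurable (shiftPair (d := d) m n) :=
  (measurable_shift m).prodMap (measurable_shift n)

/-- The two walks may be stopped at different times because they are independent once the
environments are fixed. -/
theorem quenchedPair_cyl_inter_shift (ω ω' : Env d) (x y : Site d) (m n : ℕ) (a b : Path d)
    {A : Set (Path d × Path d)} (hA : MeasurableSet A) :
    quenchedPair ω ω' x y ((cyl m a ×ˢ cyl n b) ∩ shiftPair m n ⁻¹' A) =
      quenchedPair ω ω' x y (cyl m a ×ˢ cyl n b) * quenchedPair ω ω' (a m) (b n) A := by
  have h : ((quenchedPair ω ω' x y).restrict (cyl m a ×ˢ cyl n b)).map (shiftPair m n) =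
      (quenchedLaw x ω (cyl m a) * quenchedLaw y ω' (cyl n b)) •
        quenchedPair ω ω' (a m) (b n) := by
    rw [quenchedPair, ← Measure.prod_restrict, shiftPair,
      ← Measure.map_prod_map _ _ (measurable_shift m) (measurable_shift n),
      map_shift_restrict_quenchedLaw, map_shift_restrict_quenchedLaw, Measure.prod_smul_left,
      Measure.prod_smul_right, smul_smul]
    rfl
  have h2 := congrArg (fun μ : Measure (Path d × Path d) => μ A) h
  simp only [Measure.map_apply (measurable_shiftPair m n) hA, Measure.smul_apply, smul_eq_mul,
    Measure.restrict_apply (measurable_shiftPair m n hA)] at h2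
  rw [Set.inter_comm, h2]
  congr 1
  rw [quenchedPair, Measure.prod_prod]

theorem IsDetermined.quenchedPair_inter_shift_le {m n : ℕ} {S A : Set (Path d × Path d)}
    (hS : IsDetermined m n S) (hA : MeasurableSet A) (ω ω' : Env d) (x y : Site d) {c : ℝ≥0∞}
    (h : ∀ w v, quenchedPair ω ω' w v A ≤ c) :
    quenchedPair ω ω' x y (S ∩ shiftPair m n ⁻¹' A) ≤ c * quenchedPair ω ω' x y S := by
  have := hS.measure_le (μ := (quenchedPair ω ω' x y).restrict (shiftPair m n ⁻¹' A))
    (ν := c • quenchedPair ω ω' x y) fun p _ => by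
      rw [Measure.restrict_apply ((measurableSet_cyl m _).prod (measurableSet_cyl n _)),
        quenchedPair_cyl_inter_shift _ _ _ _ _ _ _ _ hA, mul_comm]
      exact mul_le_mul_left (h _ _) _
  rwa [Measure.restrict_apply hS.measurableSet] at this

theorem isDetermined_univ (m n : ℕ) : IsDetermined m n (Set.univ : Set (Path d × Path d)) :=
  fun _ _ _ _ _ _ _ => trivial

theorem quenchedPair_shift_eq_zero {A : Set (Path d × Path d)} {ω ω' : Env d}
    (h : ∀ w v, quenchedPair ω ω' w v A = 0) (x y : Site d) (m n : ℕ) :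
    quenchedPair ω ω' x y (shiftPair m n ⁻¹' A) = 0 := by
  -- A itself need not be measurable. There are only countably many starting pairs, so the
  -- intersection of measurable null covers is a measurable set that is null for all of them.
  choose! B hB1 hB2 hB3 using fun w v => exists_measurable_superset_of_null (h w v)
  have hB : MeasurableSet (⋂ w, ⋂ v, B w v) :=
    MeasurableSet.iInter fun w => MeasurableSet.iInter fun v => hB2 w v
  have h1 := (isDetermined_univ m n).quenchedPair_inter_shift_le hB ω ω' x y (c := 0) fun w v =>
    (measure_mono ((Set.iInter_subset _ w).trans (Set.iInter_subset _ v))).trans (hB3 w v).le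
  rw [zero_mul, Set.univ_inter] at h1
  refine le_antisymm ((measure_mono (Set.preimage_mono ?_)).trans h1) zero_le
  exact Set.subset_iInter fun w => Set.subset_iInter fun v => hB1 w v

theorem IsDetermined.mono {m n m' n' : ℕ} (hm : m ≤ m') (hn : n ≤ n') {S : Set (Path d × Path d)}
    (hS : IsDetermined m n S) : IsDetermined m' n' S :=
  fun _ _ _ _ h hx hy => hS h (fun i hi => hx i (hi.trans hm)) fun i hi => hy i (hi.trans hn)

theorem isSetRing_isDetermined :
    IsSetRing {S : Set (Path d × Path d) | ∃ n, IsDetermined n n S} where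
  empty_mem := ⟨0, fun _ _ _ _ h => h.elim⟩
  union_mem := by
    rintro S T ⟨m, hS⟩ ⟨n, hT⟩
    refine ⟨max m n, fun x y x' y' h hx hy => ?_⟩
    rcases h with h | h
    · exact Or.inl (hS.mono (le_max_left _ _) (le_max_left _ _) h hx hy)
    · exact Or.inr (hT.mono (le_max_right _ _) (le_max_right _ _) h hx hy)
  sdiff_mem := by
    rintro S T ⟨m, hS⟩ ⟨n, hT⟩
    refine ⟨max m n, fun x y x' y' h hx hy => ?_⟩
    refine ⟨hS.mono (le_max_left _ _) (le_max_left _ _) h.1 hx hy, fun h' => h.2 ?_⟩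
    exact hT.mono (le_max_right _ _) (le_max_right _ _) h' (fun i hi => (hx i hi).symm)
      fun i hi => (hy i hi).symm

theorem generateFrom_isDetermined :
    (inferInstance : MeasurableSpace (Path d × Path d)) =
      MeasurableSpace.generateFrom {S | ∃ n, IsDetermined n n S} := by
  refine le_antisymm (sup_le ?_ ?_) (MeasurableSpace.generateFrom_le ?_)
  · change MeasurableSpace.comap Prod.fst inferInstance ≤ _
    rw [generateFrom_isDet, MeasurableSpace.comap_generateFrom]
    refine MeasurableSpace.generateFrom_mono ?_
    rintro _ ⟨S, ⟨n, hS⟩, rfl⟩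
    exact ⟨n, fun x y x' y' h hx _ => hS h hx⟩
  · change MeasurableSpace.comap Prod.snd inferInstance ≤ _
    rw [generateFrom_isDet, MeasurableSpace.comap_generateFrom]
    refine MeasurableSpace.generateFrom_mono ?_
    rintro _ ⟨S, ⟨n, hS⟩, rfl⟩
    exact ⟨n, fun x y x' y' h _ hy => hS h hy⟩
  · rintro S ⟨n, hS⟩
    exact hS.measurableSet

/-- A zero-one law: a shift-invariant event whose probability is bounded below uniformly in the
starting points has probability one. -/
theorem quenchedPair_compl_eq_zero_of_invariant {A : Set (Path d × Path d)} (hA : MeasurableSet A)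
    (hinv : ∀ n, shiftPair n n ⁻¹' A = A) {ω ω' : Env d} {c : ℝ≥0∞} (hc : c ≠ 0)
    (h : ∀ w v, c ≤ quenchedPair ω ω' w v A) (x y : Site d) :
    quenchedPair ω ω' x y Aᶜ = 0 := by
  set μ := quenchedPair ω ω' x y
  have hle : ∀ w v, quenchedPair ω ω' w v Aᶜ ≤ 1 - c := fun w v => by
    rw [prob_compl_eq_one_sub hA]
    exact tsub_le_tsub_left (h w v) 1
  have hdet : ∀ n S, IsDetermined n n S → μ (S ∩ Aᶜ) ≤ (1 - c) * μ S := by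
    intro n S hS
    have := hS.quenchedPair_inter_shift_le hA.compl ω ω' x y hle
    rwa [Set.preimage_compl, hinv n] at this
  have hc1 : c ≤ 1 := (h x y).trans prob_le_one
  -- `hdet` says that, given any finite past, the complement has conditional probability at most 1 -
  -- c. Approximating the complement by a finitely determined S gives μ(Aᶜ) ≤ (1 - c) μ(Aᶜ), which
  -- forces μ(Aᶜ) = 0.
  have key : μ Aᶜ ≤ (1 - c) * μ Aᶜ := by
    refine ENNReal.le_of_forall_pos_le_add fun ε hε _ => ?_
    have hε2 : (0 : ℝ≥0∞) < ε / 2 := ENNReal.half_pos (by exact_mod_cast hε.ne')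
    obtain ⟨S, ⟨n, hS⟩, hSε⟩ := exists_measure_symmDiff_lt_of_generateFrom_isSetRing (μ := μ)
      isSetRing_isDetermined ⟨{Set.univ}, Set.countable_singleton _,
        by rintro _ rfl; exact ⟨0, isDetermined_univ 0 0⟩, by simp⟩
      generateFrom_isDetermined hA.compl hε2
    have h1 : μ Aᶜ ≤ μ (S ∩ Aᶜ) + ε / 2 := by
      refine (measure_mono (t := (S ∩ Aᶜ) ∪ symmDiff S Aᶜ) fun p hp => ?_).trans
        ((measure_union_le _ _).trans (by gcongr))
      by_cases hpS : p ∈ S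
      · exact Or.inl ⟨hpS, hp⟩
      · exact Or.inr (Or.inr ⟨hp, hpS⟩)
    have h2 : μ S ≤ μ Aᶜ + ε / 2 := by
      refine (measure_mono (t := Aᶜ ∪ symmDiff S Aᶜ) fun p hp => ?_).trans
        ((measure_union_le _ _).trans (by gcongr))
      by_cases hpA : p ∈ Aᶜ
      · exact Or.inl hpA
      · exact Or.inr (Or.inl ⟨hp, hpA⟩)
    calc μ Aᶜ ≤ (1 - c) * μ S + ε / 2 := h1.trans (by gcongr; exact hdet n S hS)
      _ ≤ (1 - c) * (μ Aᶜ + ε / 2) + ε / 2 := by gcongr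
      _ ≤ (1 - c) * μ Aᶜ + 1 * (ε / 2) + ε / 2 := by
          rw [mul_add]
          gcongr
          exact tsub_le_self
      _ = (1 - c) * μ Aᶜ + ε := by rw [one_mul, add_assoc, ENNReal.add_halves]
  have hfin : (1 - c) * μ Aᶜ ≠ ⊤ := ENNReal.mul_ne_top (by simp) (measure_ne_top _ _)
  have h3 : (1 - c) * μ Aᶜ + c * μ Aᶜ ≤ (1 - c) * μ Aᶜ + 0 := by
    rw [← add_mul, tsub_add_cancel_of_le hc1, one_mul, add_zero]
    exact key
  have h4 := (ENNReal.add_le_add_iff_left hfin).1 h3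
  exact (mul_eq_zero.1 (le_antisymm h4 zero_le)).resolve_left hc

/-- Pairs of paths with arbitrarily high common ladder levels. -/
def commonLadders (u : Site d) : Set (Path d × Path d) :=
  {p | ∀ N : ℕ, ∃ l : ℤ, N ≤ l ∧ p.1 ∈ ladder u l ∧ p.2 ∈ ladder u l}

/-! ### Common ladder levels of two walks -/

theorem commonLadders_eq : commonLadders u =
    ⋂ N : ℕ, ⋃ l : ℤ, ⋃ (_ : N ≤ l), ladder u l ×ˢ ladder u l := by
  ext p
  simp only [commonLadders, Set.mem_ofPred_eq, Set.mem_iInter, Set.mem_iUnion, Set.mem_prod,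
    exists_prop]

theorem measurableSet_iUnion_ladder (N : ℕ) :
    MeasurableSet (⋃ l : ℤ, ⋃ (_ : N ≤ l), ladder u l ×ˢ ladder u l) :=
  MeasurableSet.iUnion fun l => MeasurableSet.iUnion fun _ =>
    (measurableSet_ladder u l).prod (measurableSet_ladder u l)

/-- Levels above the running maximum are first reached after time n, so discarding the first n steps
changes nothing. Hence the existence of arbitrarily high common ladder levels is shift invariant. -/
theorem shift_mem_ladder_iff {x : Path d} {n : ℕ} {l : ℤ} (h : runMax u x n < l) :
    shift n x ∈ ladder u l ↔ x ∈ ladder u l := by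
  constructor
  · rintro ⟨m, h1, h2⟩
    refine ⟨m + n, h1, fun i hi => ?_⟩
    rcases le_total i n with hin | hin
    · exact (level_le_runMax hin).trans_lt h
    · have := h2 (i - n) (by omega)
      simpa [shift, hin] using this
  · rintro ⟨m, h1, h2⟩
    have hnm : n ≤ m := by
      by_contra! hlt
      exact (level_le_runMax (u := u) (x := x) hlt.le).not_gt (h1 ▸ h)
    refine ⟨m - n, by simpa [shift, hnm] using h1, fun i hi => h2 _ (by omega)⟩

theorem shiftPair_mem_commonLadders_iff {p : Path d × Path d} (m n : ℕ) :
    shiftPair m n p ∈ commonLadders u ↔ p ∈ commonLadders u := by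
  have hN : ∀ (N : ℕ) (l : ℤ), max N (max (runMax u p.1 m) (runMax u p.2 n) + 1).toNat ≤ l →
      N ≤ l ∧ runMax u p.1 m < l ∧ runMax u p.2 n < l := by
    intro N l hl
    push_cast at hl
    omega
  constructor
  · intro h N
    obtain ⟨l, hl, h1, h2⟩ := h (max N (max (runMax u p.1 m) (runMax u p.2 n) + 1).toNat)
    obtain ⟨h3, h4, h5⟩ := hN N l (by exact_mod_cast hl)
    exact ⟨l, h3, (shift_mem_ladder_iff h4).1 h1, (shift_mem_ladder_iff h5).1 h2⟩
  · intro h N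
    obtain ⟨l, hl, h1, h2⟩ := h (max N (max (runMax u p.1 m) (runMax u p.2 n) + 1).toNat)
    obtain ⟨h3, h4, h5⟩ := hN N l (by exact_mod_cast hl)
    exact ⟨l, h3, (shift_mem_ladder_iff h4).2 h1, (shift_mem_ladder_iff h5).2 h2⟩

theorem freshLevels_nonempty {p : Path d × Path d} (h : p ∈ commonLadders u) :
    (freshLevels u p.1 p.2).Nonempty := by
  -- Freshness compares with the lower of the two starts, so exceeding the level of the first walk
  -- is enough.
  obtain ⟨l, hl, ⟨m, h1, h2⟩, n, h3, h4⟩ := h ((level u (p.1 0)).toNat + 1)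
  refine ⟨l, mem_freshLevels.2 ⟨m, n, ⟨?_, ?_, ?_, ?_⟩, h1⟩⟩
  · rw [h1]
    push_cast at hl
    omega
  · rwa [h1]
  · rwa [h3]
  · rw [h1, h3]

/-- Given the environments the walks are independent, so every sufficiently high level is a common
ladder level with probability at least ηη'. The events of having one above N decrease in N, so their
limit has at least this probability from every starting pair, and the zero-one law raises it to 1.
-/
theorem ae_mem_commonLadders {ω ω' : Env d} (hω : IsGoodEnv u ω) (hω' : IsGoodEnv u ω')
    (x y : Site d) : ∀ᵐ p ∂(quenchedPair ω ω' x y), p ∈ commonLadders u := by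
  obtain ⟨η, hη, J, hJ⟩ := hω.exists_le_ladder
  obtain ⟨η', hη', J', hJ'⟩ := hω'.exists_le_ladder
  refine quenchedPair_compl_eq_zero_of_invariant (A := commonLadders u) (c := η * η') ?_
    (fun n => Set.ext fun p => shiftPair_mem_commonLadders_iff n n) (mul_ne_zero hη hη') ?_ x y
  · rw [commonLadders_eq]
    exact MeasurableSet.iInter measurableSet_iUnion_ladder
  · intro w v
    rw [commonLadders_eq]
    refine ge_of_tendsto' (tendsto_measure_iInter_atTop
      (fun N => (measurableSet_iUnion_ladder N).nullMeasurableSet) ?_ ⟨0, measure_ne_top _ _⟩) ?_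
    · intro N N' hN
      refine Set.iUnion_mono fun l => Set.iUnion_mono' fun hl => ⟨?_, le_rfl⟩
      exact le_trans (by exact_mod_cast hN) hl
    · intro N
      set l : ℤ := max N (max (level u w + J) (level u v + J') + 1) with hl
      calc η * η' ≤ quenchedLaw w ω (ladder u l) * quenchedLaw v ω' (ladder u l) :=
            mul_le_mul' (hJ w l (by omega)) (hJ' v l (by omega))
        _ = quenchedPair ω ω' w v (ladder u l ×ˢ ladder u l) := by
            rw [quenchedPair, Measure.prod_prod]
        _ ≤ _ := measure_mono (Set.subset_iUnion₂_of_subset l (by omega) subset_rfl)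

theorem noBacktrack_eq : noBacktrack u =
    ⋂ n, ({p : Path d × Path d | level u (p.1 0) ≤ level u (p.1 n)} ∩
      {p : Path d × Path d | level u (p.2 0) ≤ level u (p.2 n)}) := by
  ext p
  simp [mem_noBacktrack, forall_and]

theorem measurableSet_noBacktrack : MeasurableSet (noBacktrack u) := by
  rw [noBacktrack_eq]
  exact MeasurableSet.iInter fun n =>
    (measurableSet_le ((measurable_level_coord u 0).comp measurable_fst)
      ((measurable_level_coord u n).comp measurable_fst)).inter
    (measurableSet_le ((measurable_level_coord u 0).comp measurable_snd)
      ((measurable_level_coord u n).comp measurable_snd))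

theorem quenchedPair_start (ω ω' : Env d) (x y : Site d) :
    ∀ᵐ p ∂(quenchedPair ω ω' x y), p.1 0 = x ∧ p.2 0 = y := by
  have h1 : ∀ᵐ p ∂(quenchedPair ω ω' x y), p.1 0 = x :=
    Measure.quasiMeasurePreserving_fst.ae (quenchedLaw_start x ω)
  have h2 : ∀ᵐ p ∂(quenchedPair ω ω' x y), p.2 0 = y :=
    Measure.quasiMeasurePreserving_snd.ae (quenchedLaw_start y ω')
  exact h1.and h2

/-- The starting points are almost surely known, which gives the event a product form that can be
treated walk by walk. -/
theorem quenchedPair_noBacktrack_inter (ω ω' : Env d) (x y : Site d) (A : Set (Path d × Path d)) :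
    quenchedPair ω ω' x y (noBacktrack u ∩ A) = quenchedPair ω ω' x y
      ((staysAbove u (level u x) ×ˢ staysAbove u (level u y)) ∩ A) := by
  refine measure_congr ?_
  filter_upwards [quenchedPair_start ω ω' x y] with p hp
  refine propext (and_congr_left fun _ => ?_)
  rw [mem_noBacktrack, hp.1, hp.2]
  rfl

theorem exists_le_quenchedPair_noBacktrack {ω ω' : Env d} (hω : IsGoodEnv u ω)
    (hω' : IsGoodEnv u ω') :
    ∃ η : ℝ≥0∞, η ≠ 0 ∧ ∀ x y, η ≤ quenchedPair ω ω' x y (noBacktrack u) := by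
  obtain ⟨η, hη, h⟩ := hω.exists_le_staysAbove
  obtain ⟨η', hη', h'⟩ := hω'.exists_le_staysAbove
  refine ⟨η * η', mul_ne_zero hη hη', fun x y => ?_⟩
  have := quenchedPair_noBacktrack_inter (u := u) ω ω' x y Set.univ
  rw [Set.inter_univ, Set.inter_univ] at this
  rw [this, quenchedPair, Measure.prod_prod]
  exact mul_le_mul' (h x) (h' y)

/-! ### Finiteness of the number of attempts -/

theorem IsAdapted.isDetermined {σ : Path d → Path d → ℕ∞ × ℕ∞} (hσ : IsAdapted σ) (m n : ℕ) :
    IsDetermined m n {p | σ p.1 p.2 = (↑m, ↑n)} :=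
  fun _ _ _ _ h hx hy => hσ h hx hy

theorem setOf_isFin_eq_iUnion (σ : Path d → Path d → ℕ∞ × ℕ∞) :
    {p : Path d × Path d | IsFin (σ p.1 p.2)} =
      ⋃ e : ℕ × ℕ, {p | σ p.1 p.2 = (↑e.1, ↑e.2)} := by
  ext p
  simp [IsFin]

theorem pairwise_disjoint_eq_coe (σ : Path d → Path d → ℕ∞ × ℕ∞) :
    Pairwise (Function.onFun Disjoint fun e : ℕ × ℕ =>
      {p : Path d × Path d | σ p.1 p.2 = (↑e.1, ↑e.2)}) := by
  intro e e' hne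
  refine Set.disjoint_left.2 fun p h1 h2 => hne ?_
  have := (show σ p.1 p.2 = _ from h1).symm.trans h2
  rw [Prod.mk.injEq, Nat.cast_inj, Nat.cast_inj] at this
  exact Prod.ext this.1 this.2

/-- A further attempt requires a backtracking after the present one. As ν_k is adapted, this has
conditional probability at most 1 - η whatever the past. -/
theorem quenchedPair_isFin_nu_le {ω ω' : Env d} {η : ℝ≥0∞}
    (h : ∀ x y, η ≤ quenchedPair ω ω' x y (noBacktrack u)) (x y : Site d) (k : ℕ) :
    quenchedPair ω ω' x y {p | IsFin (nu u k p.1 p.2)} ≤ (1 - η) ^ k := by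
  induction k with
  | zero => simpa using prob_le_one
  | succ k ih =>
    have hle : ∀ w v, quenchedPair ω ω' w v (noBacktrack u)ᶜ ≤ 1 - η := fun w v => by
      rw [prob_compl_eq_one_sub measurableSet_noBacktrack]
      exact tsub_le_tsub_left (h w v) 1
    calc quenchedPair ω ω' x y {p | IsFin (nu u (k + 1) p.1 p.2)}
        ≤ quenchedPair ω ω' x y (⋃ e : ℕ × ℕ, {p | nu u k p.1 p.2 = (↑e.1, ↑e.2)} ∩
            shiftPair e.1 e.2 ⁻¹' (noBacktrack u)ᶜ) := by
          refine measure_mono fun p hp => ?_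
          obtain ⟨m, n, h1, h2⟩ := isFin_andThen_iff.1 hp
          obtain ⟨r, s, h3, -⟩ := isFin_andThen_iff.1 h2
          exact Set.mem_iUnion.2 ⟨(m, n), h1, fun hb => not_isFin_rho_of_noBacktrack hb ⟨r, s, h3⟩⟩
      _ ≤ ∑' e : ℕ × ℕ, (1 - η) * quenchedPair ω ω' x y {p | nu u k p.1 p.2 = (↑e.1, ↑e.2)} :=
          (measure_iUnion_le _).trans (ENNReal.tsum_le_tsum fun e =>
            ((isAdapted_nu k).isDetermined e.1 e.2).quenchedPair_inter_shift_le
              measurableSet_noBacktrack.compl ω ω' x y hle)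
      _ = (1 - η) * quenchedPair ω ω' x y {p | IsFin (nu u k p.1 p.2)} := by
          rw [ENNReal.tsum_mul_left, setOf_isFin_eq_iUnion, measure_iUnion
            (pairwise_disjoint_eq_coe _)
            fun e => ((isAdapted_nu k).isDetermined e.1 e.2).measurableSet]
      _ ≤ (1 - η) * (1 - η) ^ k := by gcongr
      _ = _ := (pow_succ' ..).symm

theorem ae_bddAbove_finiteNu {ω ω' : Env d} (hω : IsGoodEnv u ω) (hω' : IsGoodEnv u ω')
    (x y : Site d) : ∀ᵐ p ∂(quenchedPair ω ω' x y), BddAbove (finiteNu u p.1 p.2) := by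
  obtain ⟨η, hη, h⟩ := exists_le_quenchedPair_noBacktrack hω hω'
  refine le_antisymm (ge_of_tendsto' (ENNReal.tendsto_pow_atTop_nhds_zero_of_lt_one
    (ENNReal.sub_lt_self ENNReal.one_ne_top one_ne_zero hη)) fun k =>
      (measure_mono fun p hp => ?_).trans (quenchedPair_isFin_nu_le h x y k)) zero_le
  obtain ⟨j, hj, hkj⟩ := not_bddAbove_iff.1 hp k
  exact isFin_nu_mono hkj.le (isFin_iff.2 hj)

/-- In good environments, almost every pair of paths is regular. -/
theorem ae_isRegular {ω ω' : Env d} (hω : IsGoodEnv u ω) (hω' : IsGoodEnv u ω')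
    (x y : Site d) : ∀ᵐ p ∂(quenchedPair ω ω' x y), IsRegular u p.1 p.2 := by
  have h1 : ∀ᵐ p ∂(quenchedPair ω ω' x y), ∀ l : ℤ, ∃ n, l < level u (p.1 n) :=
    Measure.quasiMeasurePreserving_fst.ae (hω.ae_unbounded x)
  have h2 : ∀ᵐ p ∂(quenchedPair ω ω' x y), ∀ l : ℤ, ∃ n, l < level u (p.2 n) :=
    Measure.quasiMeasurePreserving_snd.ae (hω'.ae_unbounded y)
  have h4 : ∀ᵐ p ∂(quenchedPair ω ω' x y), ∀ m n,
      BddAbove (finiteNu u (shift m p.1) (shift n p.2)) := by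
    rw [ae_all_iff]
    intro m
    rw [ae_all_iff]
    intro n
    exact quenchedPair_shift_eq_zero (A := {p | ¬ BddAbove (finiteNu u p.1 p.2)})
      (ae_bddAbove_finiteNu hω hω') x y m n
  filter_upwards [h1, h2, ae_mem_commonLadders hω hω' x y, h4] with p h1 h2 h3 h4
  refine ⟨h1, h2, fun m n => ?_, h4⟩
  exact freshLevels_nonempty (p := shiftPair m n p) ((shiftPair_mem_commonLadders_iff m n).2 h3)

/-! ### Measurability of the regeneration times -/

/-- The events that the pair of times has a given finite value are measurable. -/
def IsMeasurableTime (σ : Path d → Path d → ℕ∞ × ℕ∞) : Prop :=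
  ∀ m n : ℕ, MeasurableSet {p : Path d × Path d | σ p.1 p.2 = (↑m, ↑n)}

theorem IsAdapted.isMeasurableTime {σ : Path d → Path d → ℕ∞ × ℕ∞} (hσ : IsAdapted σ) :
    IsMeasurableTime σ := fun m n => (hσ.isDetermined m n).measurableSet

theorem IsMeasurableTime.measurableSet_isFin {σ : Path d → Path d → ℕ∞ × ℕ∞}
    (hσ : IsMeasurableTime σ) : MeasurableSet {p : Path d × Path d | IsFin (σ p.1 p.2)} := by
  rw [setOf_isFin_eq_iUnion]
  exact MeasurableSet.iUnion fun e => hσ e.1 e.2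

theorem IsMeasurableTime.andThen {σ τ : Path d → Path d → ℕ∞ × ℕ∞} (hσ : IsMeasurableTime σ)
    (hτ : IsMeasurableTime τ) : IsMeasurableTime (andThen σ τ) := by
  intro m n
  have : {p : Path d × Path d | RWRE.andThen σ τ p.1 p.2 = (↑m, ↑n)} =
      ⋃ (m' : ℕ) (n' : ℕ) (k : ℕ) (l : ℕ) (_ : m = m' + k ∧ n = n' + l),
        ({p : Path d × Path d | σ p.1 p.2 = (↑m', ↑n')} ∩
          shiftPair m' n' ⁻¹' {p | τ p.1 p.2 = (↑k, ↑l)}) := by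
    ext p
    simp only [Set.mem_ofPred_eq, andThen_eq_coe_iff, Set.mem_iUnion, exists_prop]
    refine exists_congr fun m' => exists_congr fun n' => exists_congr fun k => exists_congr fun l =>
      ?_
    constructor
    · rintro ⟨h1, h2, h3, h4⟩
      exact ⟨⟨h3, h4⟩, h1, h2⟩
    · rintro ⟨⟨h3, h4⟩, h1, h2⟩
      exact ⟨h1, h2, h3, h4⟩
  rw [this]
  exact MeasurableSet.iUnion fun m' => MeasurableSet.iUnion fun n' => MeasurableSet.iUnion fun k =>
    MeasurableSet.iUnion fun l => MeasurableSet.iUnion fun _ =>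
      (hσ m' n').inter (measurable_shiftPair m' n' (hτ k l))

theorem isMeasurableTime_nuLast : IsMeasurableTime (nuLast u) := by
  intro m n
  have : {p : Path d × Path d | nuLast u p.1 p.2 = (↑m, ↑n)} =
      ⋃ k, ({p : Path d × Path d | nu u k p.1 p.2 = (↑m, ↑n)} ∩
        {p : Path d × Path d | IsFin (nu u (k + 1) p.1 p.2)}ᶜ) := by
    ext p
    simp only [Set.mem_ofPred_eq, nuLast_eq_coe_iff, Set.mem_iUnion]
    rfl
  rw [this]
  exact MeasurableSet.iUnion fun k => ((isAdapted_nu k).isMeasurableTime m n).inter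
    (isAdapted_nu (k + 1)).isMeasurableTime.measurableSet_isFin.compl

theorem isMeasurableTime_regenOne : IsMeasurableTime (regenOne u) :=
  isAdapted_gamL.isMeasurableTime.andThen isMeasurableTime_nuLast

theorem isMeasurableTime_regen (i : ℕ) : IsMeasurableTime (regen u i) := by
  induction i with
  | zero => exact (isAdapted_zero (u := u)).isMeasurableTime
  | succ i ih => exact ih.andThen isMeasurableTime_regenOne

/-- The two times are both finite or both infinite. -/
def IsPure (σ : Path d → Path d → ℕ∞ × ℕ∞) : Prop :=
  ∀ x y, IsFin (σ x y) ∨ σ x y = (⊤, ⊤)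

theorem IsPure.andThen (σ : Path d → Path d → ℕ∞ × ℕ∞) {τ : Path d → Path d → ℕ∞ × ℕ∞}
    (hτ : IsPure τ) : IsPure (andThen σ τ) := by
  intro x y
  by_cases h : IsFin (σ x y)
  · obtain ⟨m, n, h⟩ := h
    rcases hτ (shift m x) (shift n y) with h' | h'
    · exact Or.inl (isFin_andThen_iff.2 ⟨m, n, h, h'⟩)
    · rw [andThen_of_eq_coe h, h']
      right
      simp
  · right
    rw [RWRE.andThen, if_neg (mt isFin_iff.2 h)]

theorem isPure_nuLast : IsPure (nuLast u) := by
  intro x y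
  by_cases h : BddAbove (finiteNu u x y)
  · exact Or.inl (isFin_nuLast h)
  · exact Or.inr (by rw [nuLast, if_neg h])

theorem isPure_regen (i : ℕ) : IsPure (regen u i) := by
  cases i with
  | zero => exact fun x y => Or.inl ⟨0, 0, rfl⟩
  | succ i => exact IsPure.andThen _ (IsPure.andThen _ isPure_nuLast)

/-- The two times are infinite together and the `toNat` of ⊤ is 0, so the default value is the
initial difference. Measurability and the symmetries of `regenDiff` therefore hold without an
exceptional set. -/
theorem regenDiff_of_not_isFin {x y : Path d} {i : ℕ} (h : ¬ IsFin (regen u i x y)) :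
    regenDiff u i (x, y) = y 0 - x 0 := by
  simp [regenDiff, (isPure_regen i x y).resolve_left h]

theorem measurable_regenDiff (i : ℕ) : Measurable (regenDiff u i) := by
  refine measurable_to_countable' fun z => ?_
  have hdiff : ∀ m n, MeasurableSet {p : Path d × Path d | p.2 n - p.1 m = z} := fun m n =>
    (((measurable_coord n).comp measurable_snd).prodMk ((measurable_coord m).comp measurable_fst))
      (Set.to_countable {e : Site d × Site d | e.1 - e.2 = z}).measurableSet
  have : regenDiff u i ⁻¹' {z} =
      (⋃ e : ℕ × ℕ, ({p : Path d × Path d | regen u i p.1 p.2 = (↑e.1, ↑e.2)} ∩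
        {p | p.2 e.2 - p.1 e.1 = z})) ∪
      ({p : Path d × Path d | IsFin (regen u i p.1 p.2)}ᶜ ∩ {p | p.2 0 - p.1 0 = z}) := by
    ext ⟨x, y⟩
    simp only [Set.mem_preimage, Set.mem_singleton_iff, Set.mem_union, Set.mem_iUnion,
      Set.mem_inter_iff, Set.mem_compl_iff, Set.mem_ofPred_eq, Prod.exists]
    constructor
    · intro h
      by_cases hf : IsFin (regen u i x y)
      · obtain ⟨m, n, hf⟩ := hf
        exact Or.inl ⟨m, n, hf, by rw [← h, regenDiff_of_eq hf]⟩
      · exact Or.inr ⟨hf, by rw [← h, regenDiff_of_not_isFin hf]⟩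
    · rintro (⟨m, n, hf, h⟩ | ⟨hf, h⟩)
      · rw [regenDiff_of_eq hf, h]
      · rw [regenDiff_of_not_isFin hf, h]
  rw [this]
  exact (MeasurableSet.iUnion fun e : ℕ × ℕ =>
      (isMeasurableTime_regen i e.1 e.2).inter (hdiff _ _)).union
    ((isMeasurableTime_regen i).measurableSet_isFin.compl.inter (hdiff _ _))

theorem bddAbove_finiteNu_iff {x y : Path d} :
    BddAbove (finiteNu u x y) ↔ ∃ k, ¬ IsFin (nu u k x y) := by
  constructor
  · rintro ⟨k, hk⟩
    refine ⟨k + 1, fun h => ?_⟩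
    have := hk (isFin_iff.1 h : k + 1 ∈ finiteNu u x y)
    omega
  · rintro ⟨k, hk⟩
    refine ⟨k, fun j hj => ?_⟩
    by_contra! hlt
    exact hk (isFin_nu_mono hlt.le (isFin_iff.2 hj))

theorem measurableSet_isRegular :
    MeasurableSet {p : Path d × Path d | IsRegular u p.1 p.2} := by
  have : {p : Path d × Path d | IsRegular u p.1 p.2} =
      (⋂ l : ℤ, ⋃ n, Prod.fst ⁻¹' {X : Path d | l < level u (X n)}) ∩
      (⋂ l : ℤ, ⋃ n, Prod.snd ⁻¹' {X : Path d | l < level u (X n)}) ∩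
      (⋂ m, ⋂ n, shiftPair m n ⁻¹' {p : Path d × Path d | IsFin (gamL u p.1 p.2)}) ∩
      (⋂ m, ⋂ n, ⋃ k, shiftPair m n ⁻¹'
        {p : Path d × Path d | IsFin (nu u k p.1 p.2)}ᶜ) := by
    ext p
    simp only [Set.mem_inter_iff, Set.mem_iInter, Set.mem_iUnion, Set.mem_preimage,
      Set.mem_compl_iff, Set.mem_ofPred_eq, isFin_gamL_iff]
    constructor
    · intro h
      exact ⟨⟨⟨h.1, h.2⟩, h.3⟩, fun m n => bddAbove_finiteNu_iff.1 (h.4 m n)⟩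
    · rintro ⟨⟨⟨h1, h2⟩, h3⟩, h4⟩
      exact ⟨h1, h2, h3, fun m n => bddAbove_finiteNu_iff.2 (h4 m n)⟩
  rw [this]
  refine MeasurableSet.inter (MeasurableSet.inter (MeasurableSet.inter ?_ ?_) ?_) ?_
  · exact MeasurableSet.iInter fun l => MeasurableSet.iUnion fun n =>
      measurable_fst (measurableSet_coord n (l < level u ·))
  · exact MeasurableSet.iInter fun l => MeasurableSet.iUnion fun n =>
      measurable_snd (measurableSet_coord n (l < level u ·))
  · exact MeasurableSet.iInter fun m => MeasurableSet.iInter fun n =>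
      measurable_shiftPair m n isAdapted_gamL.isMeasurableTime.measurableSet_isFin
  · exact MeasurableSet.iInter fun m => MeasurableSet.iInter fun n => MeasurableSet.iUnion fun k =>
      measurable_shiftPair m n (isAdapted_nu k).isMeasurableTime.measurableSet_isFin.compl

/-! ### Symmetries of the regeneration times -/

/-- The levels of `x'` are those of `x`, raised by `a`. -/
def IsRaised (u : Site d) (a : ℤ) (x x' : Path d) : Prop :=
  ∀ n, level u (x' n) = level u (x n) + a

theorem IsRaised.symm {a : ℤ} {x x' : Path d} (h : IsRaised u a x x') : IsRaised u (-a) x' x :=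
  fun n => by rw [h n]; ring

theorem IsRaised.shift {a : ℤ} {x x' : Path d} (h : IsRaised u a x x') (m : ℕ) :
    IsRaised u a (shift m x) (shift m x') := fun n => h (n + m)

theorem isRaised_translate (c : Site d) (x : Path d) :
    IsRaised u (level u c) x (translate c x) := fun n => level_add u (x n) c

/-- A pair of times that does not change if both paths are raised by the same amount. -/
def IsLevelInvariant (u : Site d) (σ : Path d → Path d → ℕ∞ × ℕ∞) : Prop :=
  ∀ ⦃a : ℤ⦄ ⦃x x' y y' : Path d⦄, IsRaised u a x x' → IsRaised u a y y' → ∀ ⦃m n : ℕ⦄,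
    σ x y = (↑m, ↑n) → σ x' y' = (↑m, ↑n)

theorem IsLevelInvariant.isFin {σ : Path d → Path d → ℕ∞ × ℕ∞} (hσ : IsLevelInvariant u σ)
    {a : ℤ} {x x' y y' : Path d} (hx : IsRaised u a x x') (hy : IsRaised u a y y')
    (h : IsFin (σ x y)) : IsFin (σ x' y') := by
  obtain ⟨m, n, h⟩ := h
  exact ⟨m, n, hσ hx hy h⟩

theorem IsLevelInvariant.andThen {σ τ : Path d → Path d → ℕ∞ × ℕ∞} (hσ : IsLevelInvariant u σ)
    (hτ : IsLevelInvariant u τ) : IsLevelInvariant u (andThen σ τ) := by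
  intro a x x' y y' hx hy m n h
  obtain ⟨m', n', k, l, h1, h2, h3, h4⟩ := andThen_eq_coe_iff.1 h
  exact andThen_eq_coe_iff.2 ⟨m', n', k, l, hσ hx hy h1, hτ (hx.shift m') (hy.shift n') h2, h3, h4⟩

theorem IsFresh.raise {a : ℤ} {x x' y y' : Path d} (hx : IsRaised u a x x')
    (hy : IsRaised u a y y') {m n : ℕ} (h : IsFresh u m n x y) : IsFresh u m n x' y' := by
  obtain ⟨h0, h1, h2, h3⟩ := h
  refine ⟨?_, fun i hi => ?_, fun i hi => ?_, ?_⟩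
  · rw [hx, hy, hx]
    omega
  · rw [hx, hx]
    exact add_lt_add_left (h1 i hi) a
  · rw [hy, hy]
    exact add_lt_add_left (h2 i hi) a
  · rw [hx, hy, h3]

theorem isLevelInvariant_gamL : IsLevelInvariant u (gamL u) := by
  intro a x x' y y' hx hy m n h
  rw [gamL_eq_coe_iff] at h ⊢
  exact ⟨h.1.raise hx hy, fun k hk l hl hf => h.2 k hk l hl (hf.raise hx.symm hy.symm)⟩

theorem IsRaised.runMax {a : ℤ} {x x' : Path d} (h : IsRaised u a x x') (n : ℕ) :
    runMax u x' n = runMax u x n + a := by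
  have key : ∀ (b : ℤ) (z z' : Path d), IsRaised u b z z' →
      RWRE.runMax u z' n ≤ RWRE.runMax u z n + b := by
    intro b z z' h
    refine Finset.sup'_le _ _ fun i hi => ?_
    rw [h]
    exact add_le_add_left (level_le_runMax (Nat.lt_succ_iff.1 (Finset.mem_range.1 hi))) b
  refine le_antisymm (key a x x' h) ?_
  have := key (-a) x' x h.symm
  linarith

theorem IsRaised.gamPlus {a : ℤ} {x x' : Path d} (h : IsRaised u a x x') (l : ℤ) :
    gamPlus u (l + a) x' = gamPlus u l x := by
  unfold RWRE.gamPlus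
  congr 1
  funext n
  rw [h n, add_lt_add_iff_right]

theorem isLevelInvariant_rho : IsLevelInvariant u (rho u) := by
  intro a x x' y y' hx hy m n h
  rw [rho_eq_coe_iff] at h ⊢
  obtain ⟨b, hb, h1, h2⟩ := h
  refine ⟨b, ?_, ?_, ?_⟩
  · simpa only [hx _, hy _, add_lt_add_iff_right] using hb
  · rw [hx.runMax, hy.runMax, max_add_add_right, hx.gamPlus, h1]
  · rw [hx.runMax, hy.runMax, max_add_add_right, hy.gamPlus, h2]

theorem isLevelInvariant_nu (k : ℕ) : IsLevelInvariant u (nu u k) := by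
  induction k with
  | zero => exact fun _ _ _ _ _ _ _ _ _ h => h
  | succ k ih => exact ih.andThen (isLevelInvariant_rho.andThen isLevelInvariant_gamL)

theorem isLevelInvariant_nuLast : IsLevelInvariant u (nuLast u) := by
  intro a x x' y y' hx hy m n h
  rw [nuLast_eq_coe_iff] at h ⊢
  obtain ⟨k, h1, h2⟩ := h
  exact ⟨k, isLevelInvariant_nu k hx hy h1,
    fun h3 => h2 ((isLevelInvariant_nu _).isFin hx.symm hy.symm h3)⟩

theorem isLevelInvariant_regen (i : ℕ) : IsLevelInvariant u (regen u i) := by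
  induction i with
  | zero => exact fun _ _ _ _ _ _ _ _ _ h => h
  | succ i ih => exact ih.andThen (isLevelInvariant_gamL.andThen isLevelInvariant_nuLast)

/-- The times depend only on the levels, and c and c' raise both paths equally. Taking c = c' gives
joint invariance; different c and c' are needed to move one of two independent walks. -/
theorem regenDiff_translate {c c' : Site d} (h : level u c = level u c') (i : ℕ) (x y : Path d) :
    regenDiff u i (translate c x, translate c' y) = regenDiff u i (x, y) + (c' - c) := by
  have hx := isRaised_translate (u := u) c x
  have hy := isRaised_translate (u := u) c' y
  rw [← h] at hy
  by_cases hf : IsFin (regen u i x y)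
  · obtain ⟨m, n, hf⟩ := hf
    rw [regenDiff_of_eq hf, regenDiff_of_eq (isLevelInvariant_regen i hx hy hf)]
    simp only [translate]
    abel
  · rw [regenDiff_of_not_isFin hf, regenDiff_of_not_isFin
      (mt ((isLevelInvariant_regen i).isFin hx.symm hy.symm) hf)]
    simp only [translate]
    abel

theorem translate_mem_noBacktrack_iff (c c' : Site d) (x y : Path d) :
    (translate c x, translate c' y) ∈ noBacktrack u ↔ (x, y) ∈ noBacktrack u := by
  simp [mem_noBacktrack, translate, level_add]

/-- A pair of times that is swapped with the two paths. -/
def IsSwapInvariant (σ : Path d → Path d → ℕ∞ × ℕ∞) : Prop :=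
  ∀ ⦃x y : Path d⦄ ⦃m n : ℕ⦄, σ x y = (↑m, ↑n) → σ y x = (↑n, ↑m)

theorem IsSwapInvariant.isFin {σ : Path d → Path d → ℕ∞ × ℕ∞} (hσ : IsSwapInvariant σ)
    {x y : Path d} (h : IsFin (σ x y)) : IsFin (σ y x) := by
  obtain ⟨m, n, h⟩ := h
  exact ⟨n, m, hσ h⟩

theorem IsSwapInvariant.andThen {σ τ : Path d → Path d → ℕ∞ × ℕ∞} (hσ : IsSwapInvariant σ)
    (hτ : IsSwapInvariant τ) : IsSwapInvariant (andThen σ τ) := by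
  intro x y m n h
  obtain ⟨m', n', k, l, h1, h2, h3, h4⟩ := andThen_eq_coe_iff.1 h
  exact andThen_eq_coe_iff.2 ⟨n', m', l, k, hσ h1, hτ h2, h4, h3⟩

theorem IsFresh.swap {x y : Path d} {m n : ℕ} (h : IsFresh u m n x y) : IsFresh u n m y x := by
  obtain ⟨h0, h1, h2, h3⟩ := h
  exact ⟨by rwa [min_comm, ← h3], h2, h1, h3.symm⟩

theorem isSwapInvariant_gamL : IsSwapInvariant (gamL u) := by
  intro x y m n h
  rw [gamL_eq_coe_iff] at h ⊢
  exact ⟨h.1.swap, fun k hk l hl hf => h.2 l hl k hk hf.swap⟩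

theorem isSwapInvariant_rho : IsSwapInvariant (rho u) := by
  intro x y m n h
  rw [rho_eq_coe_iff] at h ⊢
  obtain ⟨b, hb, h1, h2⟩ := h
  refine ⟨b, ?_, ?_, ?_⟩
  · simpa only [or_comm] using hb
  · rwa [max_comm]
  · rwa [max_comm]

theorem isSwapInvariant_zero : IsSwapInvariant fun _ _ : Path d => ((0 : ℕ∞), (0 : ℕ∞)) := by
  intro x y m n h
  rw [Prod.mk.injEq] at h ⊢
  exact ⟨h.2, h.1⟩

theorem isSwapInvariant_nu (k : ℕ) : IsSwapInvariant (nu u k) := by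
  induction k with
  | zero => exact isSwapInvariant_zero
  | succ k ih => exact ih.andThen (isSwapInvariant_rho.andThen isSwapInvariant_gamL)

theorem isSwapInvariant_nuLast : IsSwapInvariant (nuLast u) := by
  intro x y m n h
  rw [nuLast_eq_coe_iff] at h ⊢
  obtain ⟨k, h1, h2⟩ := h
  exact ⟨k, isSwapInvariant_nu k h1, fun h3 => h2 ((isSwapInvariant_nu _).isFin h3)⟩

theorem isSwapInvariant_regen (i : ℕ) : IsSwapInvariant (regen u i) := by
  induction i with
  | zero => exact isSwapInvariant_zero
  | succ i ih => exact ih.andThen (isSwapInvariant_gamL.andThen isSwapInvariant_nuLast)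

theorem regenDiff_swap (i : ℕ) (x y : Path d) :
    regenDiff u i (y, x) = -regenDiff u i (x, y) := by
  by_cases hf : IsFin (regen u i x y)
  · obtain ⟨m, n, hf⟩ := hf
    rw [regenDiff_of_eq hf, regenDiff_of_eq (isSwapInvariant_regen i hf), neg_sub]
  · rw [regenDiff_of_not_isFin hf, regenDiff_of_not_isFin (mt (isSwapInvariant_regen i).isFin hf),
      neg_sub]

theorem swap_mem_noBacktrack_iff (x y : Path d) :
    (y, x) ∈ noBacktrack u ↔ (x, y) ∈ noBacktrack u := by
  rw [mem_noBacktrack, mem_noBacktrack, and_comm]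

/-! ### Two walks in a random pair of environments -/

instance (x : Site d) : IsMarkovKernel (quenched (d := d) x) :=
  ⟨fun ω => isProbabilityMeasure_quenchedLaw x ω⟩

/-- The law of two walks as a kernel from pairs of environments. -/
noncomputable def pairKernel (x y : Site d) : Kernel (Env d × Env d) (Path d × Path d) :=
  quenched x ∥ₖ quenched y

theorem pairKernel_apply (x y : Site d) (e : Env d × Env d) :
    pairKernel x y e = quenchedPair e.1 e.2 x y :=
  Kernel.parallelComp_apply _ _ e

instance (x y : Site d) : IsMarkovKernel (pairKernel x y) := by
  unfold pairKernel; infer_instance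

/-- The averaged law of two walks, for a random pair of environments of law `Q`. -/
noncomputable def pairLaw (Q : Measure (Env d × Env d)) (x y : Site d) :
    Measure (Path d × Path d) :=
  Q.bind (pairKernel x y)

instance (Q : Measure (Env d × Env d)) [IsProbabilityMeasure Q] (x y : Site d) :
    IsProbabilityMeasure (pairLaw Q x y) := by
  unfold pairLaw; infer_instance

theorem measurable_quenchedPair (x y : Site d) {A : Set (Path d × Path d)} (hA : MeasurableSet A) :
    Measurable fun e : Env d × Env d => quenchedPair e.1 e.2 x y A := by
  simp_rw [← pairKernel_apply]
  exact (pairKernel x y).measurable_coe hA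

theorem pairLaw_apply (Q : Measure (Env d × Env d)) (x y : Site d) {A : Set (Path d × Path d)}
    (hA : MeasurableSet A) : pairLaw Q x y A = ∫⁻ e, quenchedPair e.1 e.2 x y A ∂Q := by
  rw [pairLaw, Measure.bind_apply hA (Kernel.aemeasurable _)]
  simp_rw [pairKernel_apply]

/-- The environment that agrees with `ω` below level `l` and with `ω'` at levels at least `l`. -/
def splice (u : Site d) (l : ℤ) (ω ω' : Env d) : Env d :=
  fun x => if level u x < l then ω x else ω' x

/-- Splicing two pairs of environments. -/
def splicePair (u : Site d) (l : ℤ) (e : (Env d × Env d) × Env d × Env d) : Env d × Env d :=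
  (splice u l e.1.1 e.2.1, splice u l e.1.2 e.2.2)

/-- The environment seen from `c`, for pairs. -/
def shiftEnvPair (c : Site d) (e : Env d × Env d) : Env d × Env d :=
  (shiftEnv c e.1, shiftEnv c e.2)

theorem measurable_splice (l : ℤ) :
    Measurable fun e : Env d × Env d => splice u l e.1 e.2 := by
  refine measurable_pi_lambda _ fun x => ?_
  by_cases h : level u x < l
  · simp only [splice, h, if_true]
    exact (measurable_pi_apply x).comp measurable_fst
  · simp only [splice, h, if_false]
    exact (measurable_pi_apply x).comp measurable_snd

theorem measurable_splicePair (l : ℤ) : Measurable (splicePair (d := d) u l) :=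
  ((measurable_splice l).comp (measurable_fst.fst.prodMk measurable_snd.fst)).prodMk
    ((measurable_splice l).comp (measurable_fst.snd.prodMk measurable_snd.snd))

theorem measurable_shiftEnv (c : Site d) : Measurable (shiftEnv c) :=
  measurable_pi_lambda _ fun x => measurable_pi_apply (x + c)

theorem measurable_shiftEnvPair (c : Site d) : Measurable (shiftEnvPair c) :=
  ((measurable_shiftEnv c).comp measurable_fst).prodMk
    ((measurable_shiftEnv c).comp measurable_snd)

/-- A law of pairs of good environments that is translation invariant, and under which the
environments below a level are independent of those at higher levels. -/
structure IsEnvPairLaw (u : Site d) (Q : Measure (Env d × Env d)) : Prop where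
  prob : IsProbabilityMeasure Q
  good : ∀ᵐ e ∂Q, IsGoodEnv u e.1 ∧ IsGoodEnv u e.2
  map_shift : ∀ c, Q.map (shiftEnvPair c) = Q
  map_splice : ∀ l, (Q.prod Q).map (splicePair u l) = Q

/-- A walk that does not backtrack never reads the environment below its starting level. -/
theorem quenchedPair_noBacktrack_inter_congr {ω₁ ω₂ ω₁' ω₂' : Env d} {x y : Site d}
    (h₁ : ∀ z, level u x ≤ level u z → ω₁ z = ω₁' z)
    (h₂ : ∀ z, level u y ≤ level u z → ω₂ z = ω₂' z) {A : Set (Path d × Path d)}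
    (hA : MeasurableSet A) :
    quenchedPair ω₁ ω₂ x y (noBacktrack u ∩ A) = quenchedPair ω₁' ω₂' x y (noBacktrack u ∩ A) := by
  rw [quenchedPair_noBacktrack_inter, quenchedPair_noBacktrack_inter, Set.inter_comm,
    ← Measure.restrict_apply hA, ← Measure.restrict_apply hA, quenchedPair, quenchedPair,
    ← Measure.prod_restrict, ← Measure.prod_restrict, restrict_staysAbove_congr x h₁,
    restrict_staysAbove_congr y h₂]

/-- A set of pairs of paths that is invariant under joint translations. -/
def IsTranslationInvariant (A : Set (Path d × Path d)) : Prop :=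
  ∀ c x y, (translate c x, translate c y) ∈ A ↔ (x, y) ∈ A

theorem quenchedPair_add (ω ω' : Env d) (x y c : Site d) {A : Set (Path d × Path d)}
    (hA : MeasurableSet A) (hinv : IsTranslationInvariant A) :
    quenchedPair ω ω' (x + c) (y + c) A = quenchedPair (shiftEnv c ω) (shiftEnv c ω') x y A := by
  rw [quenchedPair, quenchedLaw_add, quenchedLaw_add,
    Measure.map_prod_map _ _ (measurable_translate c) (measurable_translate c),
    Measure.map_apply ((measurable_translate c).prodMap (measurable_translate c)) hA]
  congr 1
  ext p
  exact hinv c p.1 p.2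

/-! ### Restart at a common record -/

section EnvPairLaw

variable {Q : Measure (Env d × Env d)}

theorem IsEnvPairLaw.pairLaw_add (hQ : IsEnvPairLaw u Q) (x y c : Site d)
    {A : Set (Path d × Path d)} (hA : MeasurableSet A) (hinv : IsTranslationInvariant A) :
    pairLaw Q (x + c) (y + c) A = pairLaw Q x y A := by
  rw [pairLaw_apply _ _ _ hA, pairLaw_apply _ _ _ hA]
  simp_rw [quenchedPair_add _ _ _ _ _ hA hinv]
  conv_rhs => rw [← hQ.map_shift c]
  rw [lintegral_map (measurable_quenchedPair x y hA) (measurable_shiftEnvPair c)]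
  rfl

/-- Functions of the environments below a level and at higher levels are independent. -/
theorem IsEnvPairLaw.lintegral_mul (hQ : IsEnvPairLaw u Q) (l : ℤ) {f g : Env d × Env d → ℝ≥0∞}
    (hf : Measurable f) (hg : Measurable g) (hfs : ∀ e, f (splicePair u l e) = f e.1)
    (hgs : ∀ e, g (splicePair u l e) = g e.2) :
    ∫⁻ e, f e * g e ∂Q = (∫⁻ e, f e ∂Q) * ∫⁻ e, g e ∂Q := by
  have := hQ.prob
  rw [← lintegral_prod_mul hf.aemeasurable hg.aemeasurable]
  conv_lhs => rw [← hQ.map_splice l]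
  rw [lintegral_map (f := fun e => f e * g e) (hf.mul hg) (measurable_splicePair _)]
  simp_rw [hfs, hgs]

/-- The hyperplane at the record level separates what the two pasts have read from what the two
futures can read. That the level is common to both walks is essential: in a shared environment a
single hyperplane has to serve for both. -/
theorem IsEnvPairLaw.pairLaw_cyl_inter_shift (hQ : IsEnvPairLaw u Q) (x y : Site d) {m n : ℕ}
    {a b : Path d} (hab : IsRecord u m n a b) {A : Set (Path d × Path d)}
    (hA : MeasurableSet A) (hinv : IsTranslationInvariant A) :
    pairLaw Q x y ((cyl m a ×ˢ cyl n b) ∩ shiftPair m n ⁻¹' (noBacktrack u ∩ A)) =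
      pairLaw Q x y (cyl m a ×ˢ cyl n b) * pairLaw Q 0 (b n - a m) (noBacktrack u ∩ A) := by
  have hB : MeasurableSet (noBacktrack u ∩ A) := measurableSet_noBacktrack.inter hA
  have hBinv : IsTranslationInvariant (noBacktrack u ∩ A) := fun c x y =>
    and_congr (translate_mem_noBacktrack_iff c c x y) (hinv c x y)
  have hC : MeasurableSet (cyl m a ×ˢ cyl n b) :=
    (measurableSet_cyl m a).prod (measurableSet_cyl n b)
  obtain ⟨ha, hb, hl⟩ := hab
  -- The pair (a m, b n) is the translate by a m of (0, b n - a m), so only the difference matters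
  -- for the future.
  have h1 := hQ.pairLaw_add 0 (b n - a m) (a m) hB hBinv
  rw [zero_add, sub_add_cancel] at h1
  rw [← h1, pairLaw_apply _ _ _ (hC.inter (measurable_shiftPair m n hB)), pairLaw_apply _ _ _ hC,
    pairLaw_apply _ _ _ hB]
  simp_rw [quenchedPair_cyl_inter_shift _ _ _ _ _ _ _ _ hB]
  -- The past segments take steps only from a i with i < m and b i with i < n, all strictly below
  -- the record level. The final sites of the segments belong to the future.
  have hpast : ∀ e, quenchedPair (splicePair u (level u (a m)) e).1
      (splicePair u (level u (a m)) e).2 x y (cyl m a ×ˢ cyl n b) =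
      quenchedPair e.1.1 e.1.2 x y (cyl m a ×ˢ cyl n b) := by
    intro e
    have h2 : ∀ i < m, (splicePair u (level u (a m)) e).1 (a i) = e.1.1 (a i) := fun i hi => by
      simp only [splicePair, splice, if_pos (ha i hi)]
    have h3 : ∀ i < n, (splicePair u (level u (a m)) e).2 (b i) = e.1.2 (b i) := fun i hi => by
      simp only [splicePair, splice, if_pos (hl.symm ▸ hb i hi)]
    rw [quenchedPair, quenchedPair, Measure.prod_prod, Measure.prod_prod,
      quenchedLaw_cyl_congr x h2, quenchedLaw_cyl_congr y h3]
  have hfuture : ∀ e, quenchedPair (splicePair u (level u (a m)) e).1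
      (splicePair u (level u (a m)) e).2 (a m) (b n) (noBacktrack u ∩ A) =
      quenchedPair e.2.1 e.2.2 (a m) (b n) (noBacktrack u ∩ A) := by
    intro e
    refine quenchedPair_noBacktrack_inter_congr (fun w hw => ?_) (fun w hw => ?_) hA
    · simp only [splicePair, splice, if_neg hw.not_gt]
    · rw [← hl] at hw
      simp only [splicePair, splice, if_neg hw.not_gt]
  exact hQ.lintegral_mul (level u (a m))
    (f := fun e => quenchedPair e.1 e.2 x y (cyl m a ×ˢ cyl n b))
    (g := fun e => quenchedPair e.1 e.2 (a m) (b n) (noBacktrack u ∩ A))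
    (measurable_quenchedPair x y hC) (measurable_quenchedPair (a m) (b n) hB) hpast hfuture

/-- At a record that is never undercut, the walks restart: the past and the future are independent,
and the future is a pair of walks that do not backtrack. -/
theorem IsEnvPairLaw.pairLaw_inter_shift (hQ : IsEnvPairLaw u Q) (x y z : Site d) {m n : ℕ}
    {S A : Set (Path d × Path d)} (hS : IsDetermined m n S)
    (hrec : ∀ x y, (x, y) ∈ S → IsRecord u m n x y ∧ y n - x m = z)
    (hA : MeasurableSet A) (hinv : IsTranslationInvariant A) :
    pairLaw Q x y (S ∩ shiftPair m n ⁻¹' (noBacktrack u ∩ A)) =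
      pairLaw Q x y S * pairLaw Q 0 z (noBacktrack u ∩ A) := by
  have key := hS.measure_congr
    (μ := (pairLaw Q x y).restrict (shiftPair m n ⁻¹' (noBacktrack u ∩ A)))
    (ν := pairLaw Q 0 z (noBacktrack u ∩ A) • pairLaw Q x y) fun p hp => by
      obtain ⟨h1, h2⟩ := hrec p.1 p.2 hp
      rw [Measure.restrict_apply ((measurableSet_cyl m _).prod (measurableSet_cyl n _)),
        hQ.pairLaw_cyl_inter_shift x y h1 hA hinv, h2, Measure.smul_apply, smul_eq_mul, mul_comm]
  rw [Measure.restrict_apply hS.measurableSet, Measure.smul_apply, smul_eq_mul, mul_comm] at key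
  exact key

theorem IsEnvPairLaw.noBacktrack_pos (hQ : IsEnvPairLaw u Q) (x y : Site d) :
    0 < pairLaw Q x y (noBacktrack u) := by
  have := hQ.prob
  rw [pos_iff_ne_zero]
  intro h
  rw [pairLaw_apply _ _ _ measurableSet_noBacktrack,
    lintegral_eq_zero_iff (measurable_quenchedPair x y measurableSet_noBacktrack)] at h
  obtain ⟨e, he, hgood⟩ := (h.and hQ.good).exists
  obtain ⟨η, hη, hle⟩ := exists_le_quenchedPair_noBacktrack hgood.1 hgood.2
  exact hη (le_antisymm ((hle x y).trans_eq he) zero_le)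

theorem IsEnvPairLaw.ae_isRegular (hQ : IsEnvPairLaw u Q) (x y : Site d) :
    ∀ᵐ p ∂(pairLaw Q x y), IsRegular u p.1 p.2 := by
  refine Measure.ae_comp_of_ae_ae measurableSet_isRegular ?_
  filter_upwards [hQ.good] with e he
  rw [pairKernel_apply]
  exact RWRE.ae_isRegular he.1 he.2 x y

/-- The transition probability of the chain of differences at regeneration times. -/
noncomputable def pairTransition (Q : Measure (Env d × Env d)) (u x y : Site d) : ℝ≥0∞ :=
  (pairLaw Q 0 x)[|noBacktrack u] {p | regenDiff u 1 p = y}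

/-! ### The Markov chain of differences -/

theorem pairTransition_eq (Q : Measure (Env d × Env d)) (x y : Site d) :
    pairTransition Q u x y = (pairLaw Q 0 x (noBacktrack u))⁻¹ *
      pairLaw Q 0 x (noBacktrack u ∩ {p | regenDiff u 1 p = y}) :=
  cond_apply measurableSet_noBacktrack _ _

theorem isTranslationInvariant_regenDiff (i : ℕ) (y : Site d) :
    IsTranslationInvariant {p : Path d × Path d | regenDiff u i p = y} := by
  intro c x x'
  simp only [Set.mem_ofPred_eq]
  rw [regenDiff_translate rfl, sub_self, add_zero]

theorem measurableSet_regenDiff_eq (i : ℕ) (y : Site d) :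
    MeasurableSet {p : Path d × Path d | regenDiff u i p = y} :=
  measurable_regenDiff i (measurableSet_singleton y)

/-- A regeneration takes place at a record, where both walks are at the same level. -/
theorem IsRegular.regenDiff_mem {p : Path d × Path d} (h : IsRegular u p.1 p.2) (i : ℕ) :
    regenDiff u (i + 1) p ∈ hyperplane u := by
  obtain ⟨m, n, hmn⟩ := h.isFin_regen (i + 1)
  obtain ⟨S, -, h1, h2⟩ := exists_isDetermined_regen (u := u) (fun k => regenDiff u k p) i m n
  obtain ⟨h3, h4⟩ := h1 _ _ ((h2 _ _ h).1 ⟨hmn, fun _ _ _ => rfl⟩).1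
  change level u (regenDiff u (i + 1) p) = 0
  rw [← h4, level_sub, h3.2.2, sub_self]

/-- The differences at the regeneration times form a Markov chain. -/
theorem IsEnvPairLaw.isMarkovChain (hQ : IsEnvPairLaw u Q) (x y : Site d) :
    IsMarkovChain (pairLaw Q x y) (hyperplane u) (regenDiff u) (pairTransition Q u) where
  measurable k _ := measurable_regenDiff k
  mem k hk := by
    obtain ⟨i, rfl⟩ := Nat.exists_eq_add_of_le' hk
    filter_upwards [hQ.ae_isRegular x y] with p hp
    exact hp.regenDiff_mem i
  stochastic z _ := by
    have := hQ.prob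
    have hpos := hQ.noBacktrack_pos 0 z
    have hc := cond_isProbabilityMeasure (μ := pairLaw Q 0 z) hpos.ne'
    have h1 : ∀ᵐ p ∂((pairLaw Q 0 z)[|noBacktrack u]), regenDiff u 1 p ∈ hyperplane u := by
      refine cond_absolutelyContinuous.ae_le ?_
      filter_upwards [hQ.ae_isRegular 0 z] with p hp
      exact hp.regenDiff_mem 0
    have h2 : (pairLaw Q 0 z)[|noBacktrack u]
        (⋃ y : hyperplane u, {p | regenDiff u 1 p = y}) = 1 := by
      rw [← measure_univ (μ := (pairLaw Q 0 z)[|noBacktrack u])]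
      refine measure_congr ?_
      filter_upwards [h1] with p hp
      refine propext ⟨fun _ => trivial, fun _ => ?_⟩
      exact Set.mem_iUnion.2 ⟨⟨_, hp⟩, rfl⟩
    rw [← h2, measure_iUnion]
    · rfl
    · intro y y' hne
      refine Set.disjoint_left.2 fun p h3 h4 => hne (Subtype.ext ?_)
      exact (show regenDiff u 1 p = y from h3).symm.trans h4
    · exact fun y => measurableSet_regenDiff_eq 1 y.1
  markov n hn z _ := by
    have := hQ.prob
    obtain ⟨i, rfl⟩ := Nat.exists_eq_add_of_le' hn
    have hreg := hQ.ae_isRegular x y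
    choose S hS1 hS2 hS3 using exists_isDetermined_regen (u := u) z i
    set E : Set (Path d × Path d) := {p | ∀ k, 1 ≤ k → k ≤ i + 1 → regenDiff u k p = z k} with hE
    have hEm : MeasurableSet E := by
      have : E = ⋂ k, ⋂ (_ : 1 ≤ k), ⋂ (_ : k ≤ i + 1), {p | regenDiff u k p = z k} := by
        ext
        simp [hE]
      rw [this]
      exact MeasurableSet.iInter fun k => MeasurableSet.iInter fun _ =>
        MeasurableSet.iInter fun _ => measurableSet_regenDiff_eq k _
    let R : ℕ × ℕ → Set (Path d × Path d) := fun e => {p | regen u (i + 1) p.1 p.2 = (↑e.1, ↑e.2)}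
    have hRm : ∀ e, MeasurableSet (R e) := fun e => isMeasurableTime_regen (i + 1) e.1 e.2
    -- Regeneration times are almost surely finite, so events may be split according to their
    -- values.
    have hsplit : ∀ B : Set (Path d × Path d), MeasurableSet B →
        pairLaw Q x y B = ∑' e, pairLaw Q x y (R e ∩ B) := by
      intro B hB
      rw [← measure_iUnion]
      · refine measure_congr ?_
        filter_upwards [hreg] with p hp
        refine propext ⟨fun h => ?_, fun h => ?_⟩
        · obtain ⟨m, n, h'⟩ := hp.isFin_regen (i + 1)
          exact Set.mem_iUnion.2 ⟨(m, n), h', h⟩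
        · obtain ⟨_, h'⟩ := Set.mem_iUnion.1 h
          exact h'.2
      · intro e e' hne
        exact (pairwise_disjoint_eq_coe (regen u (i + 1)) hne).mono
          Set.inter_subset_left Set.inter_subset_left
      · exact fun e => (hRm e).inter hB
    have hnext : MeasurableSet {p | regenDiff u (i + 1 + 1) p = z (i + 1 + 1)} :=
      measurableSet_regenDiff_eq (i + 1 + 1) _
    -- The past weight of S is the same here and in `hsecond`; only the second factor changes when
    -- the next difference is prescribed.
    have hfirst : ∀ e, pairLaw Q x y (R e ∩ E) =
        pairLaw Q x y (S e.1 e.2) * pairLaw Q 0 (z (i + 1)) (noBacktrack u) := by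
      intro e
      have h1 := hQ.pairLaw_inter_shift x y (z (i + 1)) (hS1 e.1 e.2) (hS2 e.1 e.2)
        MeasurableSet.univ (fun _ _ _ => Iff.rfl)
      rw [Set.inter_univ] at h1
      rw [← h1]
      refine measure_congr ?_
      filter_upwards [hreg] with p hp
      exact propext (hS3 e.1 e.2 p.1 p.2 hp)
    have hsecond : ∀ e, pairLaw Q x y
        (R e ∩ (E ∩ {p | regenDiff u (i + 1 + 1) p = z (i + 1 + 1)})) =
        pairLaw Q x y (S e.1 e.2) * pairLaw Q 0 (z (i + 1))
          (noBacktrack u ∩ {p | regenDiff u 1 p = z (i + 1 + 1)}) := by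
      intro e
      rw [← hQ.pairLaw_inter_shift x y (z (i + 1)) (hS1 e.1 e.2) (hS2 e.1 e.2)
        (measurableSet_regenDiff_eq 1 _) (isTranslationInvariant_regenDiff 1 _)]
      refine measure_congr ?_
      filter_upwards [hreg] with p hp
      refine propext ⟨fun h => ?_, fun h => ?_⟩
      · have h1 := (hS3 e.1 e.2 p.1 p.2 hp).1 ⟨h.1, h.2.1⟩
        exact ⟨h1.1, h1.2, (hp.regenDiff_succ h.1).symm.trans h.2.2⟩
      · have h1 := (hS3 e.1 e.2 p.1 p.2 hp).2 ⟨h.1, h.2.1⟩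
        exact ⟨h1.1, h1.2, (hp.regenDiff_succ h1.1).trans h.2.2⟩
    have hE' : {p | ∀ k, 1 ≤ k → k ≤ i + 1 + 1 → regenDiff u k p = z k} =
        E ∩ {p | regenDiff u (i + 1 + 1) p = z (i + 1 + 1)} := by
      ext p
      constructor
      · exact fun h => ⟨fun k hk hk' => h k hk (by omega), h _ (by omega) le_rfl⟩
      · rintro ⟨h1, h2⟩ k hk hk'
        rcases hk'.eq_or_lt with rfl | hk'
        · exact h2
        · exact h1 k hk (by omega)
    rw [hE', hsplit _ (hEm.inter hnext), hsplit _ hEm]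
    simp_rw [hfirst, hsecond]
    -- The sums of past weights coincide, and the probability of no backtracking cancels against the
    -- normalisation of the conditional law; it is positive and finite.
    rw [ENNReal.tsum_mul_right, ENNReal.tsum_mul_right, pairTransition_eq, mul_assoc,
      ← mul_assoc (pairLaw Q 0 (z (i + 1)) (noBacktrack u)),
      ENNReal.mul_inv_cancel (hQ.noBacktrack_pos 0 _).ne' (measure_ne_top _ _), one_mul]

end EnvPairLaw

/-! ### Independent and identically distributed environments -/

section IID

variable (ϖ : Measure (StepLaw d)) [IsProbabilityMeasure ϖ]

theorem map_shiftEnv_infinitePi (c : Site d) :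
    (Measure.infinitePi fun _ : Site d => ϖ).map (shiftEnv c) =
      Measure.infinitePi fun _ : Site d => ϖ := by
  refine Measure.eq_infinitePi _ fun s t ht => ?_
  have e : shiftEnv c ⁻¹' Set.pi s t =
      Set.pi (s.map (addRightEmbedding c)) fun x => t (x - c) := by
    ext ω
    constructor
    · intro h i hi
      have := h (i - c) (by simpa [sub_eq_add_neg] using hi)
      simpa [shiftEnv] using this
    · intro h i hi
      have := h (i + c) (by simpa using hi)
      simpa [shiftEnv] using this
  rw [Measure.map_apply (measurable_shiftEnv c)
    (MeasurableSet.pi s.countable_toSet fun i _ => ht i), e,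
    Measure.infinitePi_pi _ fun i _ => ht _, Finset.prod_map]
  simp

/-- A finite box splits into its coordinates below l and the rest, drawn from two independent
copies; the two products recombine to that of one copy. -/
theorem map_splice_infinitePi (u : Site d) (l : ℤ) :
    ((Measure.infinitePi fun _ : Site d => ϖ).prod (Measure.infinitePi fun _ : Site d => ϖ)).map
      (fun e => splice u l e.1 e.2) = Measure.infinitePi fun _ : Site d => ϖ := by
  refine Measure.eq_infinitePi _ fun s t ht => ?_
  have e : (fun e : Env d × Env d => splice u l e.1 e.2) ⁻¹' Set.pi s t =
      Set.pi (s.filter fun x => level u x < l) t ×ˢ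
        Set.pi (s.filter fun x => ¬ level u x < l) t := by
    ext ω
    simp only [Set.mem_preimage, Set.mem_pi, Set.mem_prod, Finset.coe_filter, Set.mem_ofPred_eq,
      Finset.mem_coe]
    constructor
    · intro h
      refine ⟨fun i hi => ?_, fun i hi => ?_⟩
      · simpa [splice, hi.2] using h i hi.1
      · have := h i hi.1
        rwa [splice, if_neg hi.2] at this
    · rintro ⟨h1, h2⟩ i hi
      by_cases hl : level u i < l
      · rw [splice, if_pos hl]
        exact h1 i ⟨hi, hl⟩
      · rw [splice, if_neg hl]
        exact h2 i ⟨hi, hl⟩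
  rw [Measure.map_apply (measurable_splice l)
    (MeasurableSet.pi s.countable_toSet fun i _ => ht i), e, Measure.prod_prod,
    Measure.infinitePi_pi _ fun i _ => ht _, Measure.infinitePi_pi _ fun i _ => ht _,
    Finset.prod_filter_mul_prod_filter_not]

end IID

/-- A law of good environments that is translation invariant, and under which the environments
below a level and at higher levels are independent. -/
structure IsEnvLaw (u : Site d) (P : Measure (Env d)) : Prop where
  prob : IsProbabilityMeasure P
  good : ∀ᵐ ω ∂P, IsGoodEnv u ω
  map_shift : ∀ c, P.map (shiftEnv c) = P
  map_splice : ∀ l, (P.prod P).map (fun e => splice u l e.1 e.2) = P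

theorem isEnvLaw_infinitePi (ϖ : Measure (StepLaw d)) [IsProbabilityMeasure ϖ] (u : Site d)
    (hN : HypN (Measure.infinitePi fun _ : Site d => ϖ) u)
    (hM : HypM (Measure.infinitePi fun _ : Site d => ϖ))
    (hR : HypR (Measure.infinitePi fun _ : Site d => ϖ) u) :
    IsEnvLaw u (Measure.infinitePi fun _ : Site d => ϖ) where
  prob := inferInstance
  good := by
    obtain ⟨lam, r, c, κ, C, hlam, hr, hc, hκ, hC, h⟩ := exists_isGoodLaw hN hM hR
    have h' : ∀ᵐ ω ∂(Measure.infinitePi fun _ : Site d => ϖ),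
        ∀ x, IsGoodLaw u lam r c κ C (ω x) := by
      rw [ae_all_iff]
      intro x
      -- Translation invariance carries the estimate from the origin to every site with the same
      -- constants, as the quenched bounds require.
      have hmp : MeasurePreserving (shiftEnv x) (Measure.infinitePi fun _ : Site d => ϖ)
          (Measure.infinitePi fun _ : Site d => ϖ) :=
        ⟨measurable_shiftEnv x, map_shiftEnv_infinitePi ϖ x⟩
      filter_upwards [hmp.quasiMeasurePreserving.ae h] with ω hω
      simpa [shiftEnv] using hω
    filter_upwards [h'] with ω hω
    exact ⟨lam, r, c, κ, C, hlam, hr, hc, hκ, hC, hω⟩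
  map_shift := map_shiftEnv_infinitePi ϖ
  map_splice := map_splice_infinitePi ϖ u

/-! ### Common and independent environments, and the symmetry of q̄ -/

section EnvLaw

variable {P : Measure (Env d)}

theorem measurable_diag : Measurable fun ω : Env d => (ω, ω) := measurable_id.prodMk measurable_id

/-- Translating or splicing commutes with duplicating an environment, so each property passes from P
to its image on the diagonal. -/
theorem IsEnvLaw.isEnvPairLaw_diag (hP : IsEnvLaw u P) :
    IsEnvPairLaw u (P.map fun ω => (ω, ω)) := by
  have := hP.prob
  refine ⟨Measure.isProbabilityMeasure_map measurable_diag.aemeasurable, ?_, fun c => ?_,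
    fun l => ?_⟩
  · have hmp : Measure.QuasiMeasurePreserving Prod.fst (P.map fun ω => (ω, ω)) P :=
      ⟨measurable_fst, by
        rw [Measure.map_map measurable_fst measurable_diag]
        exact (Measure.map_id (μ := P)).absolutelyContinuous⟩
    have hmp' : Measure.QuasiMeasurePreserving Prod.snd (P.map fun ω => (ω, ω)) P :=
      ⟨measurable_snd, by
        rw [Measure.map_map measurable_snd measurable_diag]
        exact (Measure.map_id (μ := P)).absolutelyContinuous⟩
    exact (hmp.ae hP.good).and (hmp'.ae hP.good)
  · conv_rhs => rw [← hP.map_shift c]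
    rw [Measure.map_map (measurable_shiftEnvPair c) measurable_diag,
      Measure.map_map measurable_diag (measurable_shiftEnv c)]
    rfl
  · rw [Measure.map_prod_map _ _ measurable_diag measurable_diag,
      Measure.map_map (measurable_splicePair l) (measurable_diag.prodMap measurable_diag)]
    conv_rhs => rw [← hP.map_splice l]
    rw [Measure.map_map measurable_diag (measurable_splice l)]
    rfl

theorem IsEnvLaw.isEnvPairLaw_prod (hP : IsEnvLaw u P) : IsEnvPairLaw u (P.prod P) := by
  have := hP.prob
  refine ⟨inferInstance, ?_, fun c => ?_, fun l => ?_⟩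
  · exact (Measure.quasiMeasurePreserving_fst.ae hP.good).and
      (Measure.quasiMeasurePreserving_snd.ae hP.good)
  · have := Measure.map_prod_map P P (measurable_shiftEnv c) (measurable_shiftEnv c)
    rw [hP.map_shift c] at this
    exact this.symm
  · refine (Measure.prod_eq fun s t hs ht => ?_).symm
    -- Condition on the environment below l. The conditional probabilities of the two coordinates
    -- multiply for fixed lower halves, and these are independent as well.
    have hpre : ∀ s, MeasurableSet s →
        P s = ∫⁻ a, P ((fun c => splice u l a c) ⁻¹' s) ∂P := by
      intro s hs
      conv_lhs => rw [← hP.map_splice l, Measure.map_apply (measurable_splice l) hs,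
        Measure.prod_apply (measurable_splice l hs)]
      rfl
    have hmeas : ∀ s, MeasurableSet s →
        Measurable fun a => P ((fun c => splice u l a c) ⁻¹' s) :=
      fun s hs => measurable_measure_prodMk_left (measurable_splice l hs)
    rw [Measure.map_apply (measurable_splicePair l) (hs.prod ht),
      Measure.prod_apply (measurable_splicePair l (hs.prod ht)), hpre s hs, hpre t ht,
      ← lintegral_prod_mul (hmeas s hs).aemeasurable (hmeas t ht).aemeasurable]
    refine lintegral_congr fun e => ?_
    rw [← Measure.prod_prod]
    rfl

theorem commonEnvLaw_eq (P : Measure (Env d)) (x y : Site d) :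
    commonEnvLaw P x y = pairLaw (P.map fun ω => (ω, ω)) x y := by
  have e : (fun ω : Env d => (quenched x ω).prod (quenched y ω)) =
      fun ω => pairKernel x y (ω, ω) := by
    funext ω
    rw [pairKernel_apply]
    rfl
  ext A hA
  rw [pairLaw_apply _ _ _ hA, lintegral_map (measurable_quenchedPair x y hA) measurable_diag,
    commonEnvLaw, Measure.bind_apply hA]
  · rfl
  · rw [e]
    exact ((pairKernel x y).measurable.comp measurable_diag).aemeasurable

theorem averaged_apply (P : Measure (Env d)) (x : Site d) {A : Set (Path d)}
    (hA : MeasurableSet A) : averaged P x A = ∫⁻ ω, quenchedLaw x ω A ∂P := by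
  rw [averaged, Measure.bind_apply hA (Kernel.aemeasurable _)]
  rfl

instance [IsProbabilityMeasure P] (x : Site d) : IsProbabilityMeasure (averaged P x) := by
  unfold averaged; infer_instance

theorem indepEnvLaw_eq (P : Measure (Env d)) [IsProbabilityMeasure P] (x y : Site d) :
    indepEnvLaw P x y = pairLaw (P.prod P) x y := by
  refine Measure.prod_eq fun s t hs ht => ?_
  rw [pairLaw_apply _ _ _ (hs.prod ht), averaged_apply _ _ hs, averaged_apply _ _ ht,
    ← lintegral_prod_mul (f := fun ω => quenchedLaw x ω s) (g := fun ω => quenchedLaw y ω t)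
      ((quenched x).measurable_coe hs).aemeasurable ((quenched y).measurable_coe ht).aemeasurable]
  refine lintegral_congr fun e => ?_
  rw [quenchedPair, Measure.prod_prod]

theorem IsEnvLaw.averaged_eq_map (hP : IsEnvLaw u P) (x : Site d) :
    averaged P x = (averaged P 0).map (translate x) := by
  ext A hA
  rw [Measure.map_apply (measurable_translate x) hA, averaged_apply _ _ hA,
    averaged_apply _ _ (measurable_translate x hA)]
  have h : ∀ ω, quenchedLaw x ω A = quenchedLaw 0 (shiftEnv x ω) (translate x ⁻¹' A) := by
    intro ω
    have := quenchedLaw_add 0 x ω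
    rw [zero_add] at this
    rw [this, Measure.map_apply (measurable_translate x) hA]
  simp_rw [h]
  conv_rhs => rw [← hP.map_shift x]
  exact (lintegral_map ((quenched 0).measurable_coe (measurable_translate x hA))
    (measurable_shiftEnv x)).symm

theorem qbar_eq (P : Measure (Env d)) (u x y : Site d) :
    qbar P u x y = (indepEnvLaw P 0 x (noBacktrack u))⁻¹ *
      indepEnvLaw P 0 x (noBacktrack u ∩ {p | regenDiff u 1 p = y}) :=
  cond_apply measurableSet_noBacktrack _ _

/-- In independent environments the second walk can be translated alone without affecting the first.
A translation inside the hyperplane preserves levels, hence the regeneration times, and adds x to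
the difference. -/
theorem IsEnvLaw.qbar_translation (hP : IsEnvLaw u P) {x : Site d} (hx : x ∈ hyperplane u)
    (y : Site d) : qbar P u x y = qbar P u 0 (y - x) := by
  have := hP.prob
  have hm : Measurable (Prod.map (id : Path d → Path d) (translate x)) :=
    measurable_id.prodMap (measurable_translate x)
  have h : indepEnvLaw P 0 x = (indepEnvLaw P 0 0).map (Prod.map id (translate x)) := by
    rw [indepEnvLaw, indepEnvLaw, hP.averaged_eq_map x,
      ← Measure.map_prod_map _ _ measurable_id (measurable_translate x), Measure.map_id]
  have hid : ∀ p : Path d × Path d, Prod.map id (translate x) p =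
      (translate 0 p.1, translate x p.2) := fun p => Prod.ext (funext fun n => by
        simp [translate]) rfl
  have hx' : level u 0 = level u x := by
    rw [show level u x = 0 from hx]
    exact zero_dotProduct u
  have e1 : Prod.map id (translate x) ⁻¹' noBacktrack u = noBacktrack u := by
    ext p
    rw [Set.mem_preimage, hid, translate_mem_noBacktrack_iff]
  have e2 : Prod.map id (translate x) ⁻¹' {p | regenDiff u 1 p = y} =
      {p | regenDiff u 1 p = y - x} := by
    ext p
    rw [Set.mem_preimage, hid, Set.mem_ofPred_eq, regenDiff_translate hx', sub_zero,
      ← eq_sub_iff_add_eq]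
    rfl
  rw [qbar_eq, qbar_eq, h, Measure.map_apply hm measurableSet_noBacktrack,
    Measure.map_apply hm (measurableSet_noBacktrack.inter (measurableSet_regenDiff_eq 1 y)),
    Set.preimage_inter, e1, e2]

/-- Exchanging two walks that start at 0 in independent environments preserves their law and
reverses the sign of the difference. -/
theorem qbar_zero_neg (P : Measure (Env d)) [IsProbabilityMeasure P] (u z : Site d) :
    qbar P u 0 (-z) = qbar P u 0 z := by
  have h : (indepEnvLaw P 0 0).map Prod.swap = indepEnvLaw P 0 0 := Measure.prod_swap
  rw [qbar_eq, qbar_eq]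
  congr 1
  conv_lhs => rw [← h, Measure.map_apply measurable_swap
    (measurableSet_noBacktrack.inter (measurableSet_regenDiff_eq 1 _))]
  congr 1
  ext p
  refine and_congr (swap_mem_noBacktrack_iff p.1 p.2) ?_
  change regenDiff u 1 (p.2, p.1) = -z ↔ regenDiff u 1 (p.1, p.2) = z
  rw [regenDiff_swap, neg_inj]

theorem IsEnvPairLaw.ae_regen_lt_top {Q : Measure (Env d × Env d)} (hQ : IsEnvPairLaw u Q)
    (x y : Site d) : ∀ᵐ p ∂(pairLaw Q x y), ∀ i,
      (regen u i p.1 p.2).1 < ⊤ ∧ (regen u i p.1 p.2).2 < ⊤ := by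
  filter_upwards [hQ.ae_isRegular x y] with p hp i
  exact max_lt_iff.1 (isFin_iff.1 (hp.isFin_regen i))

end EnvLaw

end RWRE

/-! ### The two claims -/

open MeasureTheory ProbabilityTheory RWRE in
theorem proposition7p4 {d : ℕ} (hd : 2 ≤ d)
    (ϖ : Measure (StepLaw d)) [IsProbabilityMeasure ϖ]
    (P : Measure (Env d)) (hP : P = Measure.infinitePi fun _ : Site d => ϖ)
    (u : Site d) (hu : u ≠ 0) (hN : HypN P u) (hM : HypM P) (hR : HypR P u) :
    (∀ x ∈ hyperplane u, 0 < commonEnvLaw P 0 x (noBacktrack u)) ∧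
    (∀ x y : Site d, level u x = level u y →
      (∀ᵐ p ∂(commonEnvLaw P x y), ∀ i,
        (regen u i p.1 p.2).1 < ⊤ ∧ (regen u i p.1 p.2).2 < ⊤) ∧
      IsMarkovChain (commonEnvLaw P x y) (hyperplane u) (regenDiff u) (q P u)) ∧
    (∀ x ∈ hyperplane u, 0 < indepEnvLaw P 0 x (noBacktrack u)) ∧
    (∀ x y : Site d, level u x = level u y →
      (∀ᵐ p ∂(indepEnvLaw P x y), ∀ i,
        (regen u i p.1 p.2).1 < ⊤ ∧ (regen u i p.1 p.2).2 < ⊤) ∧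
      IsSymmetricRandomWalk (indepEnvLaw P x y) (hyperplane u) (regenDiff u) (qbar P u)) ∧
    (∀ x ∈ hyperplane u, ∀ y ∈ hyperplane u,
      qbar P u x y = qbar P u 0 (y - x) ∧ qbar P u 0 (y - x) = qbar P u 0 (x - y) ∧
      qbar P u x y =
        ((averaged P 0).prod (averaged P 0))[|noBacktrack u] {p | regenDiff u 1 p = y - x}) := by
  subst hP
  have hE := isEnvLaw_infinitePi ϖ u hN hM hR
  set P := Measure.infinitePi fun _ : Site d => ϖ
  have hq : q P u = pairTransition (P.map fun ω => (ω, ω)) u := by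
    funext x y
    rw [q, commonEnvLaw_eq, pairTransition]
  have hqbar : qbar P u = pairTransition (P.prod P) u := by
    funext x y
    rw [qbar, indepEnvLaw_eq, pairTransition]
  have hsymm : ∀ x y, qbar P u 0 (y - x) = qbar P u 0 (x - y) := fun x y => by
    rw [← qbar_zero_neg, neg_sub]
  simp_rw [commonEnvLaw_eq, indepEnvLaw_eq]
  refine ⟨fun x _ => hE.isEnvPairLaw_diag.noBacktrack_pos 0 x, fun x y _ => ⟨?_, ?_⟩,
    fun x _ => hE.isEnvPairLaw_prod.noBacktrack_pos 0 x, fun x y _ => ⟨?_, ?_, ?_, ?_⟩,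
    fun x hx y _ => ⟨hE.qbar_translation hx y, hsymm x y, ?_⟩⟩
  · exact hE.isEnvPairLaw_diag.ae_regen_lt_top x y
  · rw [hq]
    exact hE.isEnvPairLaw_diag.isMarkovChain x y
  · exact hE.isEnvPairLaw_prod.ae_regen_lt_top x y
  · rw [hqbar]
    exact hE.isEnvPairLaw_prod.isMarkovChain x y
  · exact fun x hx y _ => hE.qbar_translation hx y
  · exact fun x _ y _ => hsymm x y
  -- For walks that both start at 0, the conditional law on the right is q̄(0, ·) by definition.
  · exact hE.qbar_translation hx y
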